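/- **Theorem.** Let $d\in\{1,2\}$, and let $e_1,\dots,e_d$ be the unit vectors of $\mathbb Z^d$. Consider the exclusion process on $\{0,1\}^{\mathbb Z^d}$ with generator $$(\mathcal L f)(\eta)=\sum_{x,y\in\mathbb Z^d}p(y-x)\,\eta_x(1-\eta_y)\,[f(\eta^{x,y})-f(\eta)]\qquad (f \text{ local}),$$ where $\eta^{x,y}$ is $\eta$ with the occupation variables at $x$ and $y$ exchanged. For $d=1$ let $p(e_1)=1$ and $p=0$ elsewhere (total asymmetry). For $d=2$ let $p(e_1)=1$, $p(e_2)=p(-e_2)=\tfrac12$ and $p=0$ elsewhere. Start the process from the Bernoulli product measure $\nu_\rho$ of density $\rho=\tfrac12$, and write $E_\rho$ for its expectation. (The process means any càdlàg process with initial law $\nu_\rho$ that solves the martingale problem for $\mathcal L$ on local functions; its law is unique.) Let $$S(x,t)=E_\rho\big[\{\eta_x(t)-\eta_x(0)\}\,\eta_0(0)\big],\qquad \chi=\sum_x\langle\eta_x;\eta_0\rangle_\rho=\rho(1-\rho),\qquad vt=\frac1\chi\sum_x x\,S(x,t),$$ $$D_{ij}(t)=\frac1t\,\frac1{2\chi}\Big\{\sum_x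 x_ix_jS(x,t)-\chi\,(v_it)(v_jt)\Big\}\quad(t>0),$$ where $\langle\cdot\,;\cdot\rangle_\rho$ is the covariance under $\nu_\rho$, and write $D=D_{11}$ if $d=1$. Then in both dimensions $\sum_x x_1^2S(x,t)$ converges absolutely for every $t\ge 0$. Moreover there are $C>0$ and $\lambda_0>0$ such that, for all $0<\lambda<\lambda_0$, the following integrals converge absolutely and $$d=1:\quad \int_0^\infty e^{-\lambda t}\,t\,D(t)\,dt\;\ge\; C\,\lambda^{-2-\frac14};\qquad\qquad d=2:\quad \int_0^\infty e^{-\lambda t}\,t\,D_{11}(t)\,dt\;\ge\; C\,\lambda^{-2}\,|\log\lambda|^{1/2}.$$ -/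

import Mathlib

open MeasureTheory ProbabilityTheory Filter Topology
open scoped NNReal

noncomputable section

/-- The lattice `ℤ^d`. -/
abbrev Site (d : ℕ) : Type := Fin d → ℤ

/-- Particle configurations, `{0,1}^{ℤ^d}`: `η x = true` means that the site `x` is occupied. -/
abbrev Config (d : ℕ) : Type := Site d → Bool

/-- The occupation number `η_x ∈ {0, 1}`, as a real number. -/
def occ {d : ℕ} (η : Config d) (x : Site d) : ℝ := if η x then 1 else 0

/-- The configuration `η^{x,y}`, in which the occupation variables at `x` and `y` are exchanged. -/
def exchange {d : ℕ} (η : Config d) (x y : Site d) : Config d := fun z => η (Equiv.swap x y z)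

/-- A local function depends on the occupation variables of finitely many sites only. -/
def IsLocalFunction {d : ℕ} (f : Config d → ℝ) : Prop :=
  ∃ Λ : Finset (Site d), DependsOn f (Λ : Set (Site d))

/-- The generator of the exclusion process with jump law `p`,
`(𝓛 f)(η) = ∑_{x,y} p(y - x) η_x (1 - η_y) [f(η^{x,y}) - f(η)]`.
It is applied to local `f` and finitely supported `p` only, and then the sum has finitely many
nonzero terms. -/
def exclusionGenerator {d : ℕ} (p : Site d → ℝ) (f : Config d → ℝ) (η : Config d) : ℝ :=
  ∑' x : Site d, ∑' y : Site d,
    p (y - x) * occ η x * (1 - occ η y) * (f (exchange η x y) - f η)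

/-- The unit vector `e_i` of `ℤ^d`. -/
def unitVec {d : ℕ} (i : Fin d) : Site d := Pi.single i 1

/-- Jump law in `d = 1`: jumps to the nearest neighbour on the right at rate `1`. -/
def jumpLaw1 (z : Site 1) : ℝ := if z = unitVec 0 then 1 else 0

/-- Jump law in `d = 2`: jumps by `e_1` at rate `1`, jumps by `± e_2` at rate `1 / 2` each.
(The coordinates are numbered `0` and `1` here.) -/
def jumpLaw2 (z : Site 2) : ℝ :=
  if z = unitVec 0 then 1 else if z = unitVec 1 ∨ z = -unitVec 1 then 1 / 2 else 0

/-- The Bernoulli product measure `ν_ρ` on `{0,1}^{ℤ^d}` of density `ρ ∈ [0, 1]`. -/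
def bernoulliProduct (d : ℕ) (ρ : unitInterval) : Measure (Config d) :=
  Measure.infinitePi fun _ : Site d => bernoulliMeasure true false ρ

/-- The density `1 / 2`. -/
def halfDensity : unitInterval := ⟨1 / 2, by norm_num, by norm_num⟩

/-- `X` is the exclusion process with jump law `p` in equilibrium at density `ρ`, on the probability
space `(Ω, P)` with the filtration `𝓕`: its paths are right-continuous with left limits, its initial
distribution is `ν_ρ`, and it solves the martingale problem for the generator on local functions. -/
structure IsEquilibriumExclusion {d : ℕ} (p : Site d → ℝ) (ρ : unitInterval)
    {Ω : Type*} [MeasurableSpace Ω] (P : Measure Ω) (𝓕 : Filtration ℝ≥0 ‹MeasurableSpace Ω›)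
    (X : ℝ≥0 → Ω → Config d) : Prop where
  adapted : ∀ t, Measurable[𝓕 t] (X t)
  right_continuous : ∀ ω t, ContinuousWithinAt (fun s => X s ω) (Set.Ici t) t
  left_limit : ∀ ω t, ∃ η, Tendsto (fun s => X s ω) (𝓝[<] t) (𝓝 η)
  initial_law : P.map (X 0) = bernoulliProduct d ρ
  martingale : ∀ f : Config d → ℝ, IsLocalFunction f →
    Martingale (fun (t : ℝ≥0) ω => f (X t ω) - f (X 0 ω)
      - ∫ s in (0 : ℝ)..t, exclusionGenerator p f (X s.toNNReal ω)) 𝓕 P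

/-- The time dependent correlation function `S_ρ(x, t) = E_ρ[(η_x(t) - η_x(0)) η_0(0)]`, for the
process `X` on the probability space `(Ω, P)`. -/
def corr {d : ℕ} {Ω : Type*} [MeasurableSpace Ω] (P : Measure Ω) (X : ℝ≥0 → Ω → Config d)
    (x : Site d) (t : ℝ≥0) : ℝ :=
  ∫ ω, (occ (X t ω) x - occ (X 0 ω) x) * occ (X 0 ω) 0 ∂P

/-- The compressibility `χ(ρ) = ∑_x ⟨η_x ; η_0⟩_ρ`. -/
def compressibility (d : ℕ) (ρ : unitInterval) : ℝ :=
  ∑' x : Site d, cov[fun η => occ η x, fun η => occ η 0; bernoulliProduct d ρ]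

/-- The displacement `v_i t = χ⁻¹ ∑_x x_i S_ρ(x, t)` in the `i`-th direction. -/
def meanDisplacement {d : ℕ} (ρ : unitInterval) {Ω : Type*} [MeasurableSpace Ω] (P : Measure Ω)
    (X : ℝ≥0 → Ω → Config d) (i : Fin d) (t : ℝ≥0) : ℝ :=
  1 / compressibility d ρ * ∑' x : Site d, (x i : ℝ) * corr P X x t

/-- The bulk diffusion coefficient
`D_{ij}(ρ, t) = (1 / t) (1 / (2 χ)) {∑_x x_i x_j S_ρ(x, t) - χ (v_i t) (v_j t)}`, for `t > 0`. -/
def diffusionCoeff {d : ℕ} (ρ : unitInterval) {Ω : Type*} [MeasurableSpace Ω] (P : Measure Ω)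
    (X : ℝ≥0 → Ω → Config d) (i j : Fin d) (t : ℝ≥0) : ℝ :=
  1 / (t : ℝ) * (1 / (2 * compressibility d ρ)) *
    (∑' x : Site d, (x i : ℝ) * (x j : ℝ) * corr P X x t
      - compressibility d ρ * meanDisplacement ρ P X i t * meanDisplacement ρ P X j t)

end

/-!
# Superdiffusivity of the asymmetric exclusion process

At density `1/2` the Walsh functions `σ_A = ∏_{x ∈ A} (2 η_x - 1)` are an orthonormal basis of
`L²(ν)`, and the generator acts on them by a matrix with finite rows (`exclusionGenerator_walsh`): the
symmetric part moves the sites of `A` by exchanges, the asymmetric part adds or removes one site. The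
martingale problem turns into a linear evolution equation for the two-time correlations
`E[σ_A(t) σ_B(0)]` (`isSolution_twoTime`). The powers of the generator on local functions grow like
`n!` only, so local functions are analytic vectors. This replaces the construction of the semigroup:
it gives uniqueness of solutions, exponential decay of the correlations in space, and the backward
equation.

By these, the moments of the correlation function `S` satisfy ordinary differential equations in `t`,
which amount to the Green–Kubo formula (`greenKubo`): the Laplace transform of `t D(t)` is
`λ⁻² (1/2 + 1/4 ∫ e^{-λ t} φ(t) dt)`, with `φ` the autocorrelation of the total current, that is, of the
sum of the translates of `σ_{0, e_0}`.

It remains to bound `∫ e^{-λ t} φ(t) dt = ⟨w, (λ - L)⁻¹ w⟩` from below, in the Hilbert space of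
translation classes of finite sets (`ClassSpace`), where `w` is the class of the bond `{0, e_0}`. For
every test vector `h`,
`⟨w, h⟩² ≤ K ⟨w, (λ - L)⁻¹ w⟩` as soon as `⟨(λ - L) f, h⟩² ≤ K ⟨f, (λ - L) f⟩` for all `f`
(`sq_inner_le_laplace`). The test vector is a function `H(b - a)` of pairs `{a, b}`. The symmetric part
of `λ - L` contributes the energy of `H` to `K`. The asymmetric part maps `h` to a function of the
triples `{0, e_0, z}` with values `∂_0 H(z)`, and to estimate it one needs a trace inequality
`∑_z f({0, e_0, z})² ≤ T ⟨f, (λ - L) f⟩`: a value of `f` at a triple is compared with its values after one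
of the three particles has moved away from the other two (`IsFlowBound.trace`). This is the question
of how much a function on a half-line or on a quadrant at the origin is controlled by its Dirichlet form
and its mean square at the scale `λ^{-1/2}`, and gives `T` of order `λ^{-1/2}` in one dimension, and of
order `|log λ|` in two, by a flow modelled on Pólya's urn (`isFlowBound_one`, `isFlowBound_two`).

With this, `K = λ ∑ H² + ∑ |∇H|² + T/2 ∑ |∂_0 H|²`, and `H` has to be of order `1` at `e_0`
(`le_laplace_of_cutoff`). A tent of width `λ^{-3/4}` makes `K` of order `λ^{1/4}` in one dimension
(`le_laplace_one`). In two dimensions a logarithmic cut-off, whose level sets are stretched by the factor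
`|log λ|^{1/2}` along the drift, makes `K` of order `|log λ|^{-1/2}` (`le_laplace_two`).
-/


noncomputable section

namespace Exclusion

open scoped Pointwise

/-! ### Moves of finite sets of sites -/

section Moves

variable {d : ℕ}

/-- The set `A` with the sites `x` and `y` exchanged. -/
def swapSet (x y : Site d) (A : Finset (Site d)) : Finset (Site d) :=
  A.map (Equiv.swap x y).toEmbedding

/-- The set `A` with the membership of `y` reversed. -/
def flip (y : Site d) (A : Finset (Site d)) : Finset (Site d) := symmDiff A {y}

@[simp] lemma mem_swapSet {x y z : Site d} {A : Finset (Site d)} :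
    z ∈ swapSet x y A ↔ Equiv.swap x y z ∈ A := by
  simp [swapSet, Finset.mem_map_equiv]

@[simp] lemma mem_flip {y z : Site d} {A : Finset (Site d)} :
    z ∈ flip y A ↔ (z ∈ A ∧ z ≠ y ∨ z = y ∧ y ∉ A) := by
  simp only [flip, Finset.mem_symmDiff, Finset.mem_singleton]
  constructor
  · rintro (h | ⟨rfl, h⟩)
    · exact Or.inl h
    · exact Or.inr ⟨rfl, h⟩
  · rintro (h | ⟨rfl, h⟩)
    · exact Or.inl h
    · exact Or.inr ⟨rfl, h⟩

lemma mem_vadd {x z : Site d} {A : Finset (Site d)} : z ∈ x +ᵥ A ↔ z - x ∈ A := by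
  rw [← Finset.neg_vadd_mem_iff, vadd_eq_add, neg_add_eq_sub]

@[simp] lemma swapSet_swapSet (x y : Site d) (A : Finset (Site d)) :
    swapSet x y (swapSet x y A) = A := by
  ext z; simp

@[simp] lemma flip_flip (y : Site d) (A : Finset (Site d)) : flip y (flip y A) = A := by
  simp [flip]

lemma swapSet_eq_self {x y : Site d} {A : Finset (Site d)} (h : x ∈ A ↔ y ∈ A) :
    swapSet x y A = A := by
  ext z
  rw [mem_swapSet, Equiv.swap_apply_def]
  split_ifs with h1 h2
  · rw [h1, h]
  · rw [h2, h]
  · rfl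

lemma swapSet_vadd (z x y : Site d) (A : Finset (Site d)) :
    swapSet (z + x) (z + y) (z +ᵥ A) = z +ᵥ swapSet x y A := by
  ext w
  rw [mem_swapSet, mem_vadd, mem_vadd, mem_swapSet]
  simp only [Equiv.swap_apply_def, sub_eq_iff_eq_add']
  split_ifs <;> simp

lemma flip_vadd (z y : Site d) (A : Finset (Site d)) :
    flip (z + y) (z +ᵥ A) = z +ᵥ flip y A := by
  ext w
  simp [mem_vadd, sub_eq_iff_eq_add']

@[simp] lemma card_swapSet (x y : Site d) (A : Finset (Site d)) :
    (swapSet x y A).card = A.card := by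
  simp [swapSet]

lemma card_flip_le (y : Site d) (A : Finset (Site d)) : (flip y A).card ≤ A.card + 1 := by
  have : flip y A ⊆ insert y A := by
    intro z hz
    rw [mem_flip] at hz
    rw [Finset.mem_insert]
    tauto
  exact (Finset.card_le_card this).trans (Finset.card_insert_le _ _)

lemma flip_of_notMem {y : Site d} {A : Finset (Site d)} (h : y ∉ A) : flip y A = insert y A := by
  ext z
  simp only [mem_flip, Finset.mem_insert]
  by_cases hz : z = y
  · subst hz; simp [h]
  · simp [hz]

lemma flip_of_mem {y : Site d} {A : Finset (Site d)} (h : y ∈ A) : flip y A = A.erase y := by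
  ext z
  simp only [mem_flip, Finset.mem_erase]
  by_cases hz : z = y
  · subst hz; simp [h]
  · simp [hz]

end Moves

/-! ### The generator in the Walsh basis -/

section Walsh

variable {d : ℕ}

/-- Formal finite linear combinations of the Walsh functions `∏_{x ∈ A} (2 η_x - 1)`,
which are indexed by the finite sets `A` of sites. -/
abbrev WalshSpace (d : ℕ) : Type := Finset (Site d) →₀ ℝ

/-- The linear functional with the value `u A` at the basis vector of `A`. -/
def ev (u : Finset (Site d) → ℝ) : WalshSpace d →ₗ[ℝ] ℝ := Finsupp.linearCombination ℝ u

/-- The sites `x` for which the bond `{x, x + e_i}` meets `A`. -/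
def bondSites (i : Fin d) (A : Finset (Site d)) : Finset (Site d) :=
  A ∪ A.image (· - unitVec i)

@[simp] lemma ev_single (u : Finset (Site d) → ℝ) (A : Finset (Site d)) (c : ℝ) :
    ev u (Finsupp.single A c) = c * u A := by
  simp [ev]

lemma ev_add (u w : Finset (Site d) → ℝ) (f : WalshSpace d) :
    ev (fun A => u A + w A) f = ev u f + ev w f := by
  simp [ev, Finsupp.linearCombination_apply, Finsupp.sum, mul_add, Finset.sum_add_distrib]

lemma ev_const_mul (c : ℝ) (u : Finset (Site d) → ℝ) (f : WalshSpace d) :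
    ev (fun A => c * u A) f = c * ev u f := by
  simp [ev, Finsupp.linearCombination_apply, Finsupp.sum, Finset.mul_sum]
  exact Finset.sum_congr rfl fun _ _ => by ring

lemma ev_sub (u w : Finset (Site d) → ℝ) (f : WalshSpace d) :
    ev (fun A => u A - w A) f = ev u f - ev w f := by
  simp [ev, Finsupp.linearCombination_apply, Finsupp.sum, mul_sub, Finset.sum_sub_distrib]

/-- `ev u f` is a finite sum, so it is additive over arbitrary finite families of functions. -/
lemma ev_sum {ι : Type*} (s : Finset ι) (u : ι → Finset (Site d) → ℝ) (f : WalshSpace d) :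
    ev (fun A => ∑ i ∈ s, u i A) f = ∑ i ∈ s, ev (u i) f := by
  simp [ev, Finsupp.linearCombination_apply, Finsupp.sum, Finset.mul_sum]
  rw [Finset.sum_comm]

lemma mem_bondSites {i : Fin d} {x : Site d} {A : Finset (Site d)} :
    x ∈ bondSites i A ↔ x ∈ A ∨ x + unitVec i ∈ A := by
  simp [bondSites, sub_eq_iff_eq_add]

lemma swapSet_of_notMem_bondSites {i : Fin d} {x : Site d} {A : Finset (Site d)}
    (h : x ∉ bondSites i A) : swapSet x (x + unitVec i) A = A := by
  rw [mem_bondSites, not_or] at h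
  exact swapSet_eq_self (by simp [h.1, h.2])

lemma ev_ite_eq (B : Finset (Site d)) (f : WalshSpace d) :
    ev (fun A => if A = B then 1 else 0) f = f B := by
  simp [ev, Finsupp.linearCombination_apply, Finsupp.sum]
  tauto

lemma card_bondSites_le (i : Fin d) (A : Finset (Site d)) : (bondSites i A).card ≤ 2 * A.card := by
  have := Finset.card_union_le A (A.image (· - unitVec i))
  have := Finset.card_image_le (s := A) (f := (· - unitVec i))
  simp only [bondSites]; omega

end Walsh

section Row

variable {d : ℕ} [NeZero d]

/-- The sites next to `A` in the direction `± e_0` of the drift. -/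
def driftSites (A : Finset (Site d)) : Finset (Site d) :=
  A.image (· + unitVec 0) ∪ A.image (· - unitVec 0)

/-- Twice the coefficient with which the asymmetric part of the generator changes `A` at `y`.

In terms of the spins `σ = 2 η - 1` the asymmetric part of the generator at the bond `{x, x + e_0}`
multiplies the Walsh functions of the sets that contain exactly one end of the bond by
`(σ_{x + e_0} - σ_x) / 2`. For the factor `σ_y` only the bonds from `y` to `y ± e_0` matter, with
opposite signs. -/
def drift (y : Site d) (A : Finset (Site d)) : ℝ :=
  (if y ∈ A then -1 else 1) *
    ((if y - unitVec 0 ∈ A then 1 else 0) - (if y + unitVec 0 ∈ A then 1 else 0))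

/-- The generator applied to the Walsh function of `A`, with the asymmetric part multiplied by `ε`.
So `ε = 1` gives the generator and `ε = -1` its adjoint in `L²` of the Bernoulli measure of
density `1/2`. -/
def row (ε : ℝ) (A : Finset (Site d)) : WalshSpace d :=
  ∑ i : Fin d, ∑ x ∈ bondSites i A, (1 / 2 : ℝ) •
      (Finsupp.single (swapSet x (x + unitVec i) A) 1 - Finsupp.single A 1) +
    ∑ y ∈ driftSites A, (ε / 2 * drift y A) • Finsupp.single (flip y A) 1

/-- The generator on formal combinations of Walsh functions. -/
def gen : WalshSpace d →ₗ[ℝ] WalshSpace d := Finsupp.linearCombination ℝ (row 1)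

lemma gen_single (A : Finset (Site d)) : gen (Finsupp.single A 1) = row 1 A := by
  simp [gen]

lemma ev_gen (u : Finset (Site d) → ℝ) (f : WalshSpace d) :
    ev u (gen f) = ev (fun A => ev u (row 1 A)) f := by
  induction f using Finsupp.induction_linear with
  | zero => simp
  | add f g hf hg => simp [hf, hg]
  | single A c => simp [gen]

lemma mem_driftSites {y : Site d} {A : Finset (Site d)} :
    y ∈ driftSites A ↔ y - unitVec 0 ∈ A ∨ y + unitVec 0 ∈ A := by
  simp only [driftSites, Finset.mem_union, Finset.mem_image, sub_eq_iff_eq_add, ← eq_sub_iff_add_eq]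
  simp

lemma drift_of_notMem {y : Site d} {A : Finset (Site d)} (h : y ∉ driftSites A) :
    drift y A = 0 := by
  rw [mem_driftSites, not_or] at h
  simp [drift, h.1, h.2]

lemma ev_row_eq_sum (u : Finset (Site d) → ℝ) (ε : ℝ) (A : Finset (Site d)) :
    ev u (row ε A) = ∑ i : Fin d, ∑ x ∈ bondSites i A,
        (1 / 2 : ℝ) * (u (swapSet x (x + unitVec i) A) - u A) +
      ∑ y ∈ driftSites A, (ε / 2 * drift y A) * u (flip y A) := by
  simp only [row, map_add, map_sum, map_smul, map_sub, ev_single, smul_eq_mul, one_mul]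

lemma ev_row (u : Finset (Site d) → ℝ) (ε : ℝ) (A : Finset (Site d)) :
    ev u (row ε A) = ∑ i : Fin d, (∑' x, (1 / 2 : ℝ) * (u (swapSet x (x + unitVec i) A) - u A)) +
      ∑' y, (ε / 2 * drift y A) * u (flip y A) := by
  rw [ev_row_eq_sum]
  congr 1
  · refine Finset.sum_congr rfl fun i _ => (tsum_eq_sum fun x hx => ?_).symm
    rw [swapSet_of_notMem_bondSites hx]; simp
  · refine (tsum_eq_sum fun x hx => ?_).symm
    rw [drift_of_notMem hx]; simp

lemma drift_vadd (z y : Site d) (A : Finset (Site d)) : drift (z + y) (z +ᵥ A) = drift y A := by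
  have h1 : z + y - z = y := by abel
  have h2 : z + y - unitVec 0 - z = y - unitVec 0 := by abel
  have h3 : z + y + unitVec 0 - z = y + unitVec 0 := by abel
  simp only [drift, mem_vadd, h1, h2, h3]

/-- The generator commutes with the translations of the lattice. -/
lemma ev_row_vadd (u : Finset (Site d) → ℝ) (ε : ℝ) (z : Site d) (A : Finset (Site d)) :
    ev u (row ε (z +ᵥ A)) = ev (fun B => u (z +ᵥ B)) (row ε A) := by
  rw [ev_row, ev_row]
  congr 1
  · refine Finset.sum_congr rfl fun i _ => ?_
    rw [← (Equiv.addLeft z).tsum_eq]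
    simp only [Equiv.coe_addLeft, add_assoc, swapSet_vadd]
  · rw [← (Equiv.addLeft z).tsum_eq]
    simp only [Equiv.coe_addLeft, flip_vadd, drift_vadd]

lemma drift_flip (y : Site d) (A : Finset (Site d)) : drift y (flip y A) = -drift y A := by
  have h0 : (unitVec 0 : Site d) ≠ 0 := by simp [unitVec]
  simp only [drift, mem_flip]
  by_cases h : y ∈ A <;> simp [h, h0]

/-- The symmetric part of the generator is symmetric and its asymmetric part antisymmetric. -/
lemma row_apply_comm (A B : Finset (Site d)) (ε : ℝ) : row ε A B = row (-ε) B A := by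
  rw [← ev_ite_eq, ← ev_ite_eq, ev_row, ev_row]
  congr 1
  · refine Finset.sum_congr rfl fun i _ => tsum_congr fun x => ?_
    have h1 : swapSet x (x + unitVec i) A = B ↔ swapSet x (x + unitVec i) B = A := by
      constructor <;> (rintro rfl; simp)
    simp only [h1, eq_comm]
  · refine tsum_congr fun y => ?_
    have h1 : flip y A = B ↔ flip y B = A := by
      constructor <;> (rintro rfl; simp)
    simp only [h1]
    split_ifs with h
    · rw [← h, drift_flip]; ring
    · simp

lemma card_driftSites_le (A : Finset (Site d)) : (driftSites A).card ≤ 2 * A.card := by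
  have := Finset.card_union_le (A.image (· + unitVec 0)) (A.image (· - unitVec 0))
  have := Finset.card_image_le (s := A) (f := (· - unitVec 0))
  have := Finset.card_image_le (s := A) (f := (· + unitVec 0))
  simp only [driftSites]; omega

lemma abs_drift_le (y : Site d) (A : Finset (Site d)) : |drift y A| ≤ 1 := by
  simp only [drift]
  split_ifs <;> simp

end Row

/-! ### Walsh functions and the exclusion generator -/

section WalshFunctions

variable {d : ℕ}

/-- The spin variable `2 η_x - 1 ∈ {-1, 1}`. -/
def spin (η : Config d) (x : Site d) : ℝ := 2 * occ η x - 1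

/-- The Walsh function `∏_{x ∈ A} (2 η_x - 1)`. -/
def walsh (A : Finset (Site d)) (η : Config d) : ℝ := ∏ x ∈ A, spin η x

lemma spin_mul_self (η : Config d) (x : Site d) : spin η x * spin η x = 1 := by
  unfold spin occ; split_ifs <;> norm_num

lemma spin_eq (η : Config d) (x : Site d) : spin η x = 1 ∨ spin η x = -1 := by
  unfold spin occ; split_ifs <;> norm_num

lemma abs_walsh (A : Finset (Site d)) (η : Config d) : |walsh A η| = 1 := by
  rw [walsh, Finset.abs_prod]
  refine Finset.prod_eq_one fun x _ => ?_
  rcases spin_eq η x with h | h <;> simp [h]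

lemma walsh_exchange (A : Finset (Site d)) (η : Config d) (x y : Site d) :
    walsh A (exchange η x y) = walsh (swapSet x y A) η := by
  simp only [walsh, swapSet, Finset.prod_map]
  rfl

lemma walsh_flip (y : Site d) (A : Finset (Site d)) (η : Config d) :
    walsh (flip y A) η = spin η y * walsh A η := by
  by_cases h : y ∈ A
  · rw [flip_of_mem h, walsh, walsh, ← Finset.mul_prod_erase A _ h, ← mul_assoc, spin_mul_self,
      one_mul]
  · rw [flip_of_notMem h, walsh, walsh, Finset.prod_insert h]

lemma walsh_mul_walsh (A B : Finset (Site d)) (η : Config d) :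
    walsh A η * walsh B η = walsh (symmDiff A B) η := by
  induction A using Finset.induction_on with
  | empty =>
    have : symmDiff (∅ : Finset (Site d)) B = B := by
      ext z; simp [Finset.mem_symmDiff]
    simp [walsh, this]
  | insert a A ha ih =>
    have : symmDiff (insert a A) B = flip a (symmDiff A B) := by
      rw [← flip_of_notMem ha, flip, flip, symmDiff_right_comm]
    rw [this, walsh_flip, ← ih, ← flip_of_notMem ha, walsh_flip, mul_assoc]

lemma swapSet_of_mem_of_notMem {x y : Site d} {A : Finset (Site d)} (h : ¬ (x ∈ A ↔ y ∈ A)) :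
    swapSet x y A = flip x (flip y A) := by
  have hxy : x ≠ y := by rintro rfl; exact h Iff.rfl
  ext z
  rw [mem_swapSet, Equiv.swap_apply_def]
  by_cases h1 : z = x
  · subst h1
    simp only [mem_flip, hxy]
    simp
    tauto
  · by_cases h2 : z = y
    · subst h2
      simp only [mem_flip, h1]
      simp
      tauto
    · simp [mem_flip, h1, h2]

lemma spin_sub_mul_walsh_swapSet (η : Config d) (x y : Site d) (A : Finset (Site d)) :
    (spin η x - spin η y) * (walsh (swapSet x y A) η - walsh A η) =
      2 * walsh A η * (spin η y - spin η x) * (if x ∈ A ↔ y ∈ A then 0 else 1) := by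
  split_ifs with h
  · rw [swapSet_eq_self h]; ring
  · rw [swapSet_of_mem_of_notMem h, walsh_flip, walsh_flip]
    have h1 := spin_mul_self η x
    have h2 := spin_mul_self η y
    linear_combination (spin η y * walsh A η) * h1 - (spin η x * walsh A η) * h2

lemma isLocalFunction_walsh (A : Finset (Site d)) : IsLocalFunction (walsh A) :=
  ⟨A, fun η ξ h => Finset.prod_congr rfl fun x hx => by simp [spin, occ, h x hx]⟩

lemma continuous_walsh (A : Finset (Site d)) : Continuous (walsh A) := by
  refine continuous_finsetProd _ fun x _ => ?_
  exact (continuous_of_discreteTopology (f := fun b : Bool => 2 * (if b then (1 : ℝ) else 0) - 1)).comp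
    (continuous_apply x)

lemma measurable_walsh (A : Finset (Site d)) : Measurable (walsh A) := by
  refine Finset.measurable_fun_prod _ fun x _ => ?_
  exact (Measurable.of_discrete (f := fun b : Bool => 2 * (if b then (1 : ℝ) else 0) - 1)).comp
    (measurable_pi_apply x)

end WalshFunctions

section Generator

variable {d : ℕ} [NeZero d]

/-- Jump laws with rate `1` in the direction `e_0` and rates `1 / 2` in the directions `± e_i`,
`i ≠ 0`, written as the sum against an arbitrary function. -/
def IsDriftLaw (p : Site d → ℝ) : Prop :=
  ∀ F : Site d → ℝ, ∑' z, p z * F z =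
    F (unitVec 0) + ∑ i ∈ Finset.univ.erase (0 : Fin d), 1 / 2 * (F (unitVec i) + F (-unitVec i))

lemma summable_of_notMem {α : Type*} {f : α → ℝ} (s : Finset α) (h : ∀ x ∉ s, f x = 0) :
    Summable f := summable_of_ne_finset_zero h

/-- The generator acts on the Walsh functions by `row 1`. A jump along the drift is half an
exchange plus an antisymmetric term, and the sum of the latter over all bonds is rearranged by the
site at which the set `A` is changed. -/
lemma exclusionGenerator_walsh {p : Site d → ℝ} (hp : IsDriftLaw p) (A : Finset (Site d))
    (η : Config d) :
    exclusionGenerator p (walsh A) η = ev (fun B => walsh B η) (row 1 A) := by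
  set F : Site d → Site d → ℝ := fun v x =>
    occ η x * (1 - occ η (x + v)) * (walsh (swapSet x (x + v) A) η - walsh A η) with hF
  have hFs : ∀ v, Summable (F v) := fun v => by
    refine summable_of_notMem (A ∪ A.image (· - v)) fun x hx => ?_
    simp only [Finset.mem_union, Finset.mem_image, sub_eq_iff_eq_add, exists_eq_right, not_or] at hx
    simp only [hF]
    rw [swapSet_eq_self (by simp [hx.1, hx.2])]; ring
  have h1 : exclusionGenerator p (walsh A) η = ∑' x, (F (unitVec 0) x +
      ∑ i ∈ Finset.univ.erase (0 : Fin d), 1 / 2 * (F (unitVec i) x + F (-unitVec i) x)) := by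
    refine tsum_congr fun x => ?_
    rw [← hp (fun v => F v x), ← (Equiv.addLeft x).tsum_eq]
    refine tsum_congr fun v => ?_
    simp only [Equiv.coe_addLeft, add_sub_cancel_left, walsh_exchange, hF]
    ring
  have hsw : ∀ i : Fin d, Summable fun x =>
      (1 / 2 : ℝ) * (walsh (swapSet x (x + unitVec i) A) η - walsh A η) := fun i => by
    refine summable_of_notMem (bondSites i A) fun x hx => ?_
    rw [swapSet_of_notMem_bondSites hx]; simp
  have h2 : ∀ i, 1 / 2 * (∑' x, F (unitVec i) x + ∑' x, F (-unitVec i) x) =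
      ∑' x, (1 / 2 : ℝ) * (walsh (swapSet x (x + unitVec i) A) η - walsh A η) := fun i => by
    have hs' : Summable fun x => F (-unitVec i) (Equiv.addRight (unitVec i) x) :=
      ((Equiv.addRight (unitVec i)).summable_iff (f := F (-unitVec i))).2 (hFs _)
    rw [← (Equiv.addRight (unitVec i)).tsum_eq (F (-unitVec i)), ← (hFs _).tsum_add hs',
      ← tsum_mul_left]
    refine tsum_congr fun x => ?_
    have hs : swapSet (x + unitVec i) x A = swapSet x (x + unitVec i) A := by
      rw [swapSet, Equiv.swap_comm]; rfl
    simp only [hF, Equiv.coe_addRight, add_neg_cancel_right, hs]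
    by_cases hxy : occ η x = occ η (x + unitVec i)
    · rw [← walsh_exchange]
      have : exchange η x (x + unitVec i) = η := by
        have hb : η x = η (x + unitVec i) := by
          unfold occ at hxy
          cases h1 : η x <;> cases h2 : η (x + unitVec i) <;> simp [h1, h2] at hxy ⊢
        funext z
        simp only [exchange, Equiv.swap_apply_def]
        split_ifs with h1 h2
        · rw [h1, hb]
        · rw [h2, hb]
        · rfl
      rw [this]; ring
    · unfold occ at hxy ⊢
      cases h1 : η x <;> cases h2 : η (x + unitVec i) <;> simp [h1, h2] at hxy ⊢
  -- In the direction of the drift only one of the two jumps is allowed, which leaves half of the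
  -- symmetric term and the antisymmetric one, a difference of two translates.
  have h3 : ∑' x, F (unitVec 0) x =
      ∑' x, (1 / 2 : ℝ) * (walsh (swapSet x (x + unitVec 0) A) η - walsh A η) +
      ∑' y, (1 / 2 * drift y A) * walsh (flip y A) η := by
    set J : Site d → ℝ := fun x => if x ∈ A ↔ x + unitVec 0 ∈ A then 0 else 1 with hJ
    have hJs : ∀ g : Site d → ℝ, Summable fun x => 1 / 2 * walsh A η * g x * J x := fun g => by
      refine summable_of_notMem (bondSites 0 A) fun x hx => ?_
      rw [mem_bondSites, not_or] at hx
      simp [hJ, hx.1, hx.2]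
    have h4 : ∀ x, F (unitVec 0) x =
        (1 / 2 : ℝ) * (walsh (swapSet x (x + unitVec 0) A) η - walsh A η) +
        (1 / 2 * walsh A η * spin η (x + unitVec 0) * J x - 1 / 2 * walsh A η * spin η x * J x) := by
      intro x
      have h5 := spin_sub_mul_walsh_swapSet η x (x + unitVec 0) A
      have h6 : walsh (swapSet x (x + unitVec 0) A) η - walsh A η = 0 ∨
          spin η x = - spin η (x + unitVec 0) := by
        by_cases hxy : η x = η (x + unitVec 0)
        · left
          rw [← walsh_exchange]
          have : exchange η x (x + unitVec 0) = η := by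
            funext z
            simp only [exchange, Equiv.swap_apply_def]
            split_ifs with h1 h2
            · rw [h1, hxy]
            · rw [h2, hxy]
            · rfl
          rw [this, sub_self]
        · right
          unfold spin occ
          cases h1 : η x <;> cases h2 : η (x + unitVec 0) <;> simp [h1, h2] at hxy ⊢ <;> norm_num
      have h7 : occ η x = (1 + spin η x) / 2 := by unfold spin; ring
      have h8 : occ η (x + unitVec 0) = (1 + spin η (x + unitVec 0)) / 2 := by unfold spin; ring
      simp only [hF, h7, h8]
      change _ = _ + (1 / 2 * walsh A η * spin η (x + unitVec 0) * (if _ then 0 else 1) -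
        1 / 2 * walsh A η * spin η x * (if _ then 0 else 1))
      rcases h6 with h6 | h6
      · rw [h6] at h5 ⊢; linear_combination h5 / 4
      · have h9 := spin_mul_self η (x + unitVec 0)
        rw [h6] at h5 ⊢
        linear_combination h5 / 4 +
          (walsh (swapSet x (x + unitVec 0) A) η - walsh A η) / 4 * h9
    simp only [h4]
    rw [Summable.tsum_add (hsw 0) ((hJs _).sub (hJs _)), (hJs _).tsum_sub (hJs _)]
    congr 1
    rw [← (Equiv.subRight (unitVec 0)).tsum_eq
      (fun x => 1 / 2 * walsh A η * spin η (x + unitVec 0) * J x), ← Summable.tsum_sub ?_ (hJs _)]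
    · refine tsum_congr fun y => ?_
      rw [walsh_flip]
      simp only [Equiv.subRight_apply, sub_add_cancel, hJ, drift]
      by_cases h5 : y ∈ A <;> by_cases h6 : y - unitVec 0 ∈ A <;>
        by_cases h7 : y + unitVec 0 ∈ A <;> simp [h5, h6, h7] <;> ring
    · exact ((Equiv.subRight (unitVec 0)).summable_iff
        (f := fun x => 1 / 2 * walsh A η * spin η (x + unitVec 0) * J x)).2 (hJs _)
  rw [h1, (hFs _).tsum_add, Summable.tsum_finsetSum, h3, ev_row,
    ← Finset.add_sum_erase _ _ (Finset.mem_univ (0 : Fin d)), add_right_comm]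
  · congr 2
    refine Finset.sum_congr rfl fun i _ => ?_
    rw [tsum_mul_left, (hFs _).tsum_add (hFs _), h2]
  · exact fun i _ => ((hFs _).add (hFs _)).mul_left _
  · exact summable_sum fun i _ => ((hFs _).add (hFs _)).mul_left _

end Generator

/-! ### From the martingale problem to the evolution equation -/

section Bernoulli

variable {d : ℕ}

instance : IsProbabilityMeasure (bernoulliProduct d halfDensity) := by
  unfold bernoulliProduct; infer_instance

/-- The Walsh functions are orthonormal at density `1/2`: all but the constant one have mean `0`. -/
lemma integral_walsh (A : Finset (Site d)) :
    ∫ η, walsh A η ∂(bernoulliProduct d halfDensity) = if A = ∅ then 1 else 0 := by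
  have h1 : ∀ η : Config d, walsh A η =
      (fun ζ : (A → Bool) => ∏ x : A, (2 * (if ζ x then (1 : ℝ) else 0) - 1)) (A.restrict η) := by
    intro η
    simp only [walsh, Finset.restrict]
    rw [← Finset.prod_coe_sort]
    rfl
  have h2 := integral_restrict_infinitePi
    (μ := fun _ : Site d => bernoulliMeasure true false halfDensity) (s := A)
    (f := fun ζ : (A → Bool) => ∏ x : A, (2 * (if ζ x then (1 : ℝ) else 0) - 1))
    (Measurable.aestronglyMeasurable (by fun_prop))
  refine (integral_congr_ae (Eventually.of_forall h1)).trans (h2.trans ?_)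
  have h3 : ∫ b, (2 * (if b then (1 : ℝ) else 0) - 1) ∂(bernoulliMeasure true false halfDensity)
      = 0 := by
    rw [integral_bernoulliMeasure]
    simp [halfDensity]; norm_num
  refine (integral_fintype_prod_eq_prod
    (fun (_ : A) (b : Bool) => 2 * (if b then (1 : ℝ) else 0) - 1)).trans ?_
  split_ifs with h
  · subst h; simp
  · obtain ⟨x, hx⟩ := Finset.nonempty_iff_ne_empty.2 h
    exact Finset.prod_eq_zero (Finset.mem_univ ⟨x, hx⟩) h3

lemma integral_walsh_mul_walsh (A B : Finset (Site d)) :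
    ∫ η, walsh A η * walsh B η ∂(bernoulliProduct d halfDensity) = if A = B then 1 else 0 := by
  simp only [walsh_mul_walsh, integral_walsh]
  congr 1
  simp

lemma occ_eq_walsh (η : Config d) (x : Site d) : occ η x = (1 + walsh {x} η) / 2 := by
  simp [walsh, spin]

lemma integrable_walsh {Ω : Type*} [MeasurableSpace Ω] {P : Measure Ω} [IsFiniteMeasure P]
    {Y : Ω → Config d} (hY : Measurable Y) (A : Finset (Site d)) :
    Integrable (fun ω => walsh A (Y ω)) P :=
  Integrable.of_bound ((measurable_walsh A).comp hY).aestronglyMeasurable 1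
    (Eventually.of_forall fun ω => by simp [abs_walsh])

lemma compressibility_half : compressibility d halfDensity = 1 / 4 := by
  have hw : ∀ A : Finset (Site d), Integrable (walsh A) (bernoulliProduct d halfDensity) :=
    fun A => integrable_walsh measurable_id A
  have hm : ∀ x : Site d, ∫ η, occ η x ∂(bernoulliProduct d halfDensity) = 1 / 2 := fun x => by
    simp only [occ_eq_walsh]
    rw [integral_div, integral_add (integrable_const _) (hw _), integral_walsh]
    simp
  have h1 : ∀ x : Site d, cov[fun η => occ η x, fun η => occ η 0; bernoulliProduct d halfDensity] =
      if x = 0 then 1 / 4 else 0 := by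
    intro x
    rw [covariance, hm, hm]
    have h2 : ∀ η : Config d, (occ η x - 1 / 2) * (occ η 0 - 1 / 2) =
        (walsh {x} η * walsh {0} η) / 4 := fun η => by rw [occ_eq_walsh, occ_eq_walsh]; ring
    simp only [h2]
    rw [integral_div, integral_walsh_mul_walsh]
    simp only [Finset.singleton_inj]
    split_ifs <;> simp
  rw [compressibility]
  simp only [h1]
  rw [tsum_ite_eq]

end Bernoulli

section Evolution

variable {d : ℕ} [NeZero d]

/-- Solutions of the linear evolution equation which the generator induces on functions of finite
sets of sites: `∂_t u = 𝓛 u` for `t ≥ 0`, as a one-sided derivative at `0`. -/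
def IsSolution (u : ℝ → Finset (Site d) → ℝ) : Prop :=
  ∀ A t, 0 ≤ t → HasDerivWithinAt (fun s => u s A) (ev (u t) (row 1 A)) (Set.Ici 0) t

/-- A right-continuous real process is jointly measurable. -/
lemma measurable_of_rightContinuous {Ω : Type*} [MeasurableSpace Ω] {g : ℝ≥0 → Ω → ℝ}
    (hm : ∀ s, Measurable (g s))
    (hr : ∀ ω t, ContinuousWithinAt (fun s => g s ω) (Set.Ici t) t) :
    Measurable (Function.uncurry g) := by
  -- Evaluation at the next point of the grid of mesh `1 / (n + 1)` approximates from the right.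
  obtain ⟨c, hc⟩ : ∃ c : ℕ → ℕ → ℝ≥0, ∀ n k, c n k = ((k : ℝ≥0) + 1) / (n + 1) :=
    ⟨_, fun _ _ => rfl⟩
  have h1 : ∀ n : ℕ, Measurable fun p : ℝ≥0 × Ω => g (c n ⌊((n : ℝ≥0) + 1) * p.1⌋₊) p.2 := by
    intro n
    have h2 : Measurable fun q : ℕ × Ω => g (c n q.1) q.2 :=
      measurable_from_prod_countable_right fun k => hm (c n k)
    have h3 : Measurable fun p : ℝ≥0 × Ω => (⌊((n : ℝ≥0) + 1) * p.1⌋₊, p.2) := by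
      refine Measurable.prodMk ?_ measurable_snd
      exact Nat.measurable_floor.comp (measurable_const.mul measurable_fst)
    exact h2.comp h3
  refine measurable_of_tendsto_metrizable h1 (tendsto_pi_nhds.2 fun p => ?_)
  have h4 : ∀ n : ℕ, p.1 ≤ c n ⌊((n : ℝ≥0) + 1) * p.1⌋₊ := fun n => by
    rw [hc, le_div_iff₀ (by positivity), mul_comm]
    exact (Nat.lt_floor_add_one _).le
  have h5 : ∀ n : ℕ, c n ⌊((n : ℝ≥0) + 1) * p.1⌋₊ ≤ p.1 + 1 / ((n : ℝ≥0) + 1) := fun n => by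
    have h6 := Nat.floor_le (a := ((n : ℝ≥0) + 1) * p.1) (by positivity)
    have h7 : (p.1 + 1 / ((n : ℝ≥0) + 1)) * (n + 1) = (n + 1) * p.1 + 1 := by
      field_simp
    rw [hc, div_le_iff₀ (by positivity), h7]
    exact add_le_add_left h6 1
  have h8 : Tendsto (fun n : ℕ => c n ⌊((n : ℝ≥0) + 1) * p.1⌋₊) atTop (𝓝 p.1) := by
    refine tendsto_of_tendsto_of_tendsto_of_le_of_le tendsto_const_nhds ?_ h4 h5
    have : Tendsto (fun n : ℕ => p.1 + 1 / ((n : ℝ≥0) + 1)) atTop (𝓝 (p.1 + 0)) :=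
      tendsto_const_nhds.add tendsto_one_div_add_atTop_nhds_zero_nat
    simpa using this
  exact (hr p.2 p.1).tendsto.comp (tendsto_nhdsWithin_iff.2 ⟨h8, Eventually.of_forall h4⟩)

variable {Ω : Type*} [MeasurableSpace Ω]

/-- The correlation of the Walsh function of `A` at time `t` with that of `B` at time `0`. -/
def twoTime (P : Measure Ω) (X : ℝ≥0 → Ω → Config d) (B : Finset (Site d)) (t : ℝ)
    (A : Finset (Site d)) : ℝ :=
  ∫ ω, walsh A (X t.toNNReal ω) * walsh B (X 0 ω) ∂P

variable {P : Measure Ω} [IsProbabilityMeasure P] {𝓕 : Filtration ℝ≥0 ‹MeasurableSpace Ω›}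
  {X : ℝ≥0 → Ω → Config d} {p : Site d → ℝ}

lemma abs_twoTime_le (B : Finset (Site d)) (t : ℝ) (A : Finset (Site d)) :
    |twoTime P X B t A| ≤ 1 := by
  have := norm_integral_le_of_norm_le_const (μ := P) (C := 1)
    (f := fun ω => walsh A (X t.toNNReal ω) * walsh B (X 0 ω))
    (Eventually.of_forall fun ω => by simp [abs_walsh])
  simpa [twoTime] using this

lemma IsEquilibriumExclusion.measurable (hX : IsEquilibriumExclusion p halfDensity P 𝓕 X) (t : ℝ≥0) :
    Measurable (X t) := (hX.adapted t).mono (𝓕.le t) le_rfl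

lemma twoTime_zero (hX : IsEquilibriumExclusion p halfDensity P 𝓕 X) (A B : Finset (Site d)) :
    twoTime P X B 0 A = if A = B then 1 else 0 := by
  rw [← integral_walsh_mul_walsh, ← hX.initial_law, integral_map]
  · simp [twoTime]
  · exact (IsEquilibriumExclusion.measurable hX 0).aemeasurable
  · exact ((measurable_walsh A).mul (measurable_walsh B)).aestronglyMeasurable

/-- The martingale problem, tested against a function of the configuration at time `0`. -/
lemma twoTime_eq_add_integral (hp : IsDriftLaw p)
    (hX : IsEquilibriumExclusion p halfDensity P 𝓕 X) (A B : Finset (Site d)) {t : ℝ}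
    (ht : 0 ≤ t) :
    Measurable (fun s => ev (twoTime P X B s) (row 1 A)) ∧
    twoTime P X B t A = twoTime P X B 0 A + ∫ s in (0 : ℝ)..t, ev (twoTime P X B s) (row 1 A) := by
  have hXm := IsEquilibriumExclusion.measurable hX
  have hW : ∀ C : Finset (Site d), Measurable fun q : ℝ × Ω => walsh C (X q.1.toNNReal q.2) := by
    intro C
    have h1 := measurable_of_rightContinuous (g := fun s ω => walsh C (X s ω))
      (fun s => (measurable_walsh C).comp (hXm s))
      (fun ω s => (continuous_walsh C).continuousAt.comp_continuousWithinAt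
        (hX.right_continuous ω s))
    exact h1.comp ((measurable_real_toNNReal.comp measurable_fst).prodMk measurable_snd)
  have hG : Measurable fun ω => walsh B (X 0 ω) := (measurable_walsh B).comp (hXm 0)
  set g : ℝ → Ω → ℝ := fun s ω => ev (fun C => walsh C (X s.toNNReal ω)) (row 1 A) with hg
  have hgm : Measurable (Function.uncurry g) := by
    simp only [hg, ev, Finsupp.linearCombination_apply, Finsupp.sum, Function.uncurry_def]
    exact Finset.measurable_fun_sum _ fun C _ => (hW C).const_mul _
  have hgb : ∃ K, ∀ s ω, |g s ω| ≤ K := by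
    refine ⟨∑ C ∈ (row 1 A).support, |row 1 A C|, fun s ω => ?_⟩
    simp only [hg, ev, Finsupp.linearCombination_apply, Finsupp.sum]
    refine (Finset.abs_sum_le_sum_abs _ _).trans (Finset.sum_le_sum fun C _ => ?_)
    simp [abs_mul, abs_walsh]
  obtain ⟨K, hK⟩ := hgb
  have hev : ∀ s, ∫ ω, g s ω * walsh B (X 0 ω) ∂P = ev (twoTime P X B s) (row 1 A) := by
    intro s
    simp only [hg, ev, Finsupp.linearCombination_apply, Finsupp.sum, Finset.sum_mul, twoTime]
    rw [integral_finsetSum]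
    · simp only [smul_eq_mul, mul_assoc, integral_const_mul]
    · intro C _
      refine Integrable.of_bound (C := |row 1 A C|) ?_ (Eventually.of_forall fun ω => ?_)
      · exact ((((measurable_walsh C).comp (hXm _)).const_mul _).mul hG).aestronglyMeasurable
      · simp [abs_walsh]
  have hgB : Measurable (Function.uncurry fun s ω => g s ω * walsh B (X 0 ω)) :=
    hgm.mul (hG.comp measurable_snd)
  refine ⟨?_, ?_⟩
  · simp only [← hev]
    exact (StronglyMeasurable.integral_prod_right (ν := P) hgB.stronglyMeasurable).measurable
  have hM := hX.martingale (walsh A) (isLocalFunction_walsh A)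
  simp only [exclusionGenerator_walsh hp] at hM
  set M : ℝ≥0 → Ω → ℝ := fun t ω => walsh A (X t ω) - walsh A (X 0 ω) -
    ∫ s in (0 : ℝ)..t, g s ω with hMdef
  have hM' : Martingale M 𝓕 P := hM
  have hM0 : M 0 = 0 := by funext ω; simp [hMdef]
  have hc : P[M t.toNNReal | 𝓕 0] =ᵐ[P] 0 := by
    have := hM'.condExp_ae_eq (zero_le (a := t.toNNReal))
    rwa [hM0] at this
  have hGM : Integrable ((fun ω => walsh B (X 0 ω)) * M t.toNNReal) P :=
    (hM'.integrable _).bdd_mul (c := 1) hG.aestronglyMeasurable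
      (Eventually.of_forall fun ω => by simp [abs_walsh])
  -- The martingale starts from `0`, so it is orthogonal to everything known at time `0`.
  have h0 : ∫ ω, walsh B (X 0 ω) * M t.toNNReal ω ∂P = 0 := by
    have h1 := condExp_mul_of_stronglyMeasurable_left (m := 𝓕 0) (μ := P)
      (f := fun ω => walsh B (X 0 ω)) (g := M t.toNNReal)
      ((measurable_walsh B).comp (hX.adapted 0)).stronglyMeasurable hGM (hM'.integrable _)
    have h2 := integral_condExp (μ := P) (𝓕.le 0) (f := (fun ω => walsh B (X 0 ω)) * M t.toNNReal)
    change ∫ ω, ((fun ω => walsh B (X 0 ω)) * M t.toNNReal) ω ∂P = 0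
    rw [← h2]
    refine integral_eq_zero_of_ae (h1.trans ?_)
    filter_upwards [hc] with ω hω
    simp [hω]
  have hIm : Measurable fun ω => ∫ s in (0 : ℝ)..t, g s ω := by
    simp only [intervalIntegral.integral_of_le ht]
    exact (StronglyMeasurable.integral_prod_right' (ν := volume.restrict (Set.Ioc 0 t))
      (hgm.comp measurable_swap).stronglyMeasurable).measurable
  have hIb : Integrable (fun ω => walsh B (X 0 ω) * ∫ s in (0 : ℝ)..t, g s ω) P := by
    refine Integrable.of_bound (C := K * |t - 0|) (hG.mul hIm).aestronglyMeasurable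
      (Eventually.of_forall fun ω => ?_)
    rw [norm_mul, Real.norm_eq_abs, abs_walsh, one_mul]
    exact intervalIntegral.norm_integral_le_of_norm_le_const fun s _ => hK s ω
  have hfub : ∫ ω, walsh B (X 0 ω) * (∫ s in (0 : ℝ)..t, g s ω) ∂P =
      ∫ s in (0 : ℝ)..t, ev (twoTime P X B s) (row 1 A) := by
    simp only [← hev]
    rw [intervalIntegral_integral_swap]
    · refine integral_congr_ae (Eventually.of_forall fun ω => ?_)
      simp only [intervalIntegral.integral_mul_const]
      ring
    · have : IsFiniteMeasure ((volume : Measure ℝ).restrict (Set.uIoc 0 t)) :=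
        ⟨by rw [Measure.restrict_apply_univ, Set.uIoc]; exact measure_Ioc_lt_top⟩
      refine Integrable.of_bound (C := K) hgB.aestronglyMeasurable (Eventually.of_forall fun q => ?_)
      simp only [Function.uncurry, norm_mul, Real.norm_eq_abs, abs_walsh, mul_one]
      exact hK _ _
  have hi : ∀ s : ℝ≥0, Integrable (fun ω => walsh A (X s ω) * walsh B (X 0 ω)) P := fun s =>
    Integrable.of_bound (C := 1) (((measurable_walsh A).comp (hXm s)).mul hG).aestronglyMeasurable
      (Eventually.of_forall fun ω => by simp [abs_walsh])
  have h3 : ∫ ω, walsh B (X 0 ω) * M t.toNNReal ω ∂P =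
      twoTime P X B t A - twoTime P X B 0 A - ∫ s in (0 : ℝ)..t, ev (twoTime P X B s) (row 1 A) := by
    have h4 : ∀ ω, walsh B (X 0 ω) * M t.toNNReal ω =
        (walsh A (X t.toNNReal ω) * walsh B (X 0 ω) - walsh A (X 0 ω) * walsh B (X 0 ω)) -
          walsh B (X 0 ω) * (∫ s in (0 : ℝ)..t, g s ω) := fun ω => by
      simp only [hMdef, Real.coe_toNNReal _ ht]; ring
    simp only [h4]
    rw [integral_sub (f := fun ω => walsh A (X t.toNNReal ω) * walsh B (X 0 ω) -
      walsh A (X 0 ω) * walsh B (X 0 ω)) ((hi _).sub (hi _)) hIb, integral_sub (hi _) (hi _), hfub]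
    simp [twoTime]
  linarith

lemma isSolution_twoTime (hp : IsDriftLaw p) (hX : IsEquilibriumExclusion p halfDensity P 𝓕 X)
    (B : Finset (Site d)) : IsSolution (twoTime P X B) := by
  have hint : ∀ A a b, IntervalIntegrable (fun s => ev (twoTime P X B s) (row 1 A)) volume a b := by
    intro A a b
    have h1 : ∀ s, ‖ev (twoTime P X B s) (row 1 A)‖ ≤ ∑ C ∈ (row 1 A).support, |row 1 A C| := by
      intro s
      simp only [ev, Finsupp.linearCombination_apply, Finsupp.sum, Real.norm_eq_abs]
      refine (Finset.abs_sum_le_sum_abs _ _).trans (Finset.sum_le_sum fun C _ => ?_)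
      rw [smul_eq_mul, abs_mul]
      exact mul_le_of_le_one_right (abs_nonneg _) (abs_twoTime_le _ _ _)
    rw [intervalIntegrable_iff]
    have : IsFiniteMeasure ((volume : Measure ℝ).restrict (Set.uIoc a b)) :=
      ⟨by rw [Measure.restrict_apply_univ, Set.uIoc]; exact measure_Ioc_lt_top⟩
    exact Integrable.of_bound
      (twoTime_eq_add_integral hp hX A B le_rfl).1.aestronglyMeasurable _
      (Eventually.of_forall h1)
  have hcont : ∀ A, ContinuousOn (fun s => twoTime P X B s A) (Set.Ici 0) := by
    intro A
    refine ContinuousOn.congr (f := fun t => twoTime P X B 0 A +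
      ∫ s in (0 : ℝ)..t, ev (twoTime P X B s) (row 1 A)) ?_ fun t ht =>
      (twoTime_eq_add_integral hp hX A B ht).2
    exact (continuous_const.add
      (intervalIntegral.continuous_primitive (hint A) 0)).continuousOn
  intro A t ht
  -- Replacing `s` by `max s 0` makes the integrand continuous on the whole line.
  set I : ℝ → ℝ := fun s => ev (twoTime P X B (max s 0)) (row 1 A) with hI
  have hIc : Continuous I := by
    simp only [hI, ev, Finsupp.linearCombination_apply, Finsupp.sum]
    refine continuous_finsetSum _ fun C _ => continuous_const.mul ?_
    exact (hcont C).comp_continuous (continuous_id.max continuous_const) fun s => Set.mem_Ici.2 (le_max_right _ _)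
  have h1 : HasDerivAt (fun t => twoTime P X B 0 A + ∫ s in (0 : ℝ)..t, I s) (I t) t :=
    ((hIc.integral_hasStrictDerivAt 0 t).hasDerivAt).const_add _
  have h2 : I t = ev (twoTime P X B t) (row 1 A) := by simp [hI, ht]
  rw [← h2]
  refine h1.hasDerivWithinAt.congr (fun s hs => ?_) ?_
  all_goals
    rw [(twoTime_eq_add_integral hp hX A B (by assumption)).2]
    congr 1
    refine intervalIntegral.integral_congr fun r hr => ?_
    rw [Set.uIcc_of_le (by assumption)] at hr
    simp [hI, hr.1]

end Evolution

/-! ### Analyticity of the evolution -/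

section Taylor

variable {V : Type*} [AddCommGroup V] [Module ℝ V]

/-- Taylor's formula with remainder for a family of functionals with `∂_t y_t = y_t ∘ L`. -/
lemma abs_sub_taylor_le {y : ℝ → V →ₗ[ℝ] ℝ} {L : Module.End ℝ V}
    (hy : ∀ f t, 0 ≤ t → HasDerivWithinAt (fun s => y s f) (y t (L f)) (Set.Ici 0) t)
    {s : ℝ} (hs : 0 ≤ s) (n : ℕ) (f : V) {r B : ℝ} (hr : 0 ≤ r)
    (hB : ∀ q ∈ Set.Icc s (s + r), |y q ((L ^ n) f)| ≤ B) :
    |y (s + r) f - ∑ k ∈ Finset.range n, r ^ k / (k.factorial : ℝ) * y s ((L ^ k) f)| ≤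
      B * (r ^ n / (n.factorial : ℝ)) := by
  induction n generalizing f r with
  | zero => simpa using hB (s + r) ⟨by linarith, le_rfl⟩
  | succ n ih =>
    have hder : ∀ q, 0 ≤ q → HasDerivWithinAt (fun q => y (s + q) f -
        ∑ k ∈ Finset.range (n + 1), q ^ k / (k.factorial : ℝ) * y s ((L ^ k) f))
        (y (s + q) (L f) - ∑ k ∈ Finset.range n, q ^ k / (k.factorial : ℝ) * y s ((L ^ k) (L f)))
        (Set.Ici 0) q := by
      intro q hq
      refine HasDerivWithinAt.sub ?_ ?_
      · have h1 := (hy f (s + q) (by linarith)).comp q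
          (h := fun q => s + q) (h' := 1) (s := Set.Ici 0)
          (((hasDerivAt_id q).const_add s).hasDerivWithinAt)
          (fun q hq => Set.mem_Ici.2 (add_nonneg hs hq))
        exact h1.congr_deriv (mul_one _)
      · have h2 : HasDerivAt (fun q : ℝ => ∑ k ∈ Finset.range n,
            q ^ (k + 1) / ((k + 1).factorial : ℝ) * y s ((L ^ (k + 1)) f) +
            q ^ 0 / (Nat.factorial 0 : ℝ) * y s ((L ^ 0) f))
            (∑ k ∈ Finset.range n, q ^ k / (k.factorial : ℝ) * y s ((L ^ k) (L f)) + 0) q := by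
          refine HasDerivAt.add (HasDerivAt.fun_sum fun k _ => ?_) ?_
          · have h3 := ((hasDerivAt_pow (k + 1) q).div_const ((k + 1).factorial : ℝ)).mul_const
              (y s ((L ^ (k + 1)) f))
            refine h3.congr_deriv ?_
            rw [pow_succ L k, Module.End.mul_apply, Nat.factorial_succ]
            have : (k.factorial : ℝ) ≠ 0 := by positivity
            have : ((k : ℝ) + 1) ≠ 0 := by positivity
            push_cast
            field_simp
          · simpa using hasDerivAt_const q _
        rw [add_zero] at h2
        refine h2.hasDerivWithinAt.congr_of_mem (fun x _ => ?_) hq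
        exact Finset.sum_range_succ' (fun k => x ^ k / (k.factorial : ℝ) * y s ((L ^ k) f)) n
    have hB' : ∀ x : ℝ, HasDerivAt (fun q : ℝ => B * (q ^ (n + 1) / ((n + 1).factorial : ℝ)))
        (B * (x ^ n / (n.factorial : ℝ))) x := by
      intro x
      refine (((hasDerivAt_pow (n + 1) x).div_const ((n + 1).factorial : ℝ)).const_mul B).congr_deriv ?_
      rw [Nat.factorial_succ]
      have : (n.factorial : ℝ) ≠ 0 := by positivity
      have : ((n : ℝ) + 1) ≠ 0 := by positivity
      push_cast
      field_simp
    refine image_norm_le_of_norm_deriv_right_le_deriv_boundary (a := 0) (b := r)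
      (fun q hq => ((hder q hq.1).continuousWithinAt.mono Set.Icc_subset_Ici_self))
      (fun q hq => (hder q hq.1).mono (Set.Ici_subset_Ici.2 hq.1)) ?_ hB' ?_ ⟨hr, le_rfl⟩
    · have h0 : ∑ k ∈ Finset.range (n + 1), (0 : ℝ) ^ k / (k.factorial : ℝ) * y s ((L ^ k) f) =
          y s f := by
        rw [Finset.sum_range_succ']
        simp
      rw [h0]
      simp
    · intro q hq
      refine ih (L f) hq.1 fun q' hq' => ?_
      have := hB q' ⟨hq'.1, hq'.2.trans (by linarith [hq.2])⟩
      rwa [pow_succ, Module.End.mul_apply] at this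

end Taylor

section Seminorm

variable {d : ℕ}

/-- The seminorm `f ↦ |y f|` of a functional. -/
def absSeminorm (y : WalshSpace d →ₗ[ℝ] ℝ) : Seminorm ℝ (WalshSpace d) :=
  (normSeminorm ℝ ℝ).comp y

lemma absSeminorm_apply (y : WalshSpace d →ₗ[ℝ] ℝ) (f : WalshSpace d) :
    absSeminorm y f = |y f| := rfl

end Seminorm

section Weights

variable {d : ℕ} [NeZero d]

/-- A nonnegative weight on finite sets which grows at most by the factor `κ` under the moves made
by the generator. -/
structure IsWeight (W : Finset (Site d) → ℝ) (κ : ℝ) : Prop where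
  nonneg : ∀ A, 0 ≤ W A
  le_self : ∀ A, W A ≤ κ * W A
  swap_le : ∀ A (i : Fin d), ∀ x ∈ bondSites i A, W (swapSet x (x + unitVec i) A) ≤ κ * W A
  flip_le : ∀ A, ∀ y ∈ driftSites A, W (flip y A) ≤ κ * W A

/-- A row has at most `(2 d + 1) |A|` terms, up to the coefficients, and each of them adds at most one
site. -/
lemma seminorm_row_le {W : Finset (Site d) → ℝ} {κ G : ℝ} (hW : IsWeight W κ) (hG : 0 ≤ G)
    (N : Seminorm ℝ (WalshSpace d)) (A : Finset (Site d))
    (hN : ∀ B : Finset (Site d), B.card ≤ A.card + 1 → N (Finsupp.single B 1) ≤ W B * G) :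
    N (row 1 A) ≤ (2 * d + 1) * κ * W A * (A.card * G) := by
  have hb : ∀ B : Finset (Site d), B.card ≤ A.card + 1 → W B ≤ κ * W A →
      N (Finsupp.single B 1) ≤ κ * W A * G := fun B h1 h2 =>
    (hN B h1).trans (mul_le_mul_of_nonneg_right h2 hG)
  have hE : 0 ≤ κ * W A * G :=
    mul_nonneg ((hW.nonneg A).trans (hW.le_self A)) hG
  set E := κ * W A * G with hEdef
  have h1 : N (∑ i : Fin d, ∑ x ∈ bondSites i A, (1 / 2 : ℝ) •
      (Finsupp.single (swapSet x (x + unitVec i) A) 1 - Finsupp.single A 1)) ≤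
      d * (2 * A.card * E) := by
    refine (Finset.le_sum_of_subadditive N (map_zero N).le (map_add_le_add N) _ _).trans ?_
    have : ∀ i ∈ (Finset.univ : Finset (Fin d)), N (∑ x ∈ bondSites i A, (1 / 2 : ℝ) •
        (Finsupp.single (swapSet x (x + unitVec i) A) 1 - Finsupp.single A 1)) ≤
        2 * A.card * E := by
      intro i _
      refine (Finset.le_sum_of_subadditive N (map_zero N).le (map_add_le_add N) _ _).trans ?_
      have : ∀ x ∈ bondSites i A, N ((1 / 2 : ℝ) •
        (Finsupp.single (swapSet x (x + unitVec i) A) 1 - Finsupp.single A 1)) ≤ E := by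
        intro x hx
        rw [map_smul_eq_mul, Real.norm_eq_abs, abs_of_pos (by norm_num)]
        have h2 := map_sub_le_add N (Finsupp.single (swapSet x (x + unitVec i) A) 1)
          (Finsupp.single A 1)
        have h3 := hb _ (by simp) (hW.swap_le A i x hx)
        have h4 := hb A (by simp) (hW.le_self A)
        linarith
      refine (Finset.sum_le_sum this).trans ?_
      rw [Finset.sum_const, nsmul_eq_mul]
      refine mul_le_mul_of_nonneg_right ?_ hE
      exact_mod_cast card_bondSites_le i A
    refine (Finset.sum_le_sum this).trans ?_
    simp
  have h2 : N (∑ y ∈ driftSites A, ((1 : ℝ) / 2 * drift y A) • Finsupp.single (flip y A) 1) ≤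
      A.card * E := by
    refine (Finset.le_sum_of_subadditive N (map_zero N).le (map_add_le_add N) _ _).trans ?_
    have : ∀ y ∈ driftSites A, N (((1 : ℝ) / 2 * drift y A) • Finsupp.single (flip y A) 1) ≤
        1 / 2 * E := by
      intro y hy
      rw [map_smul_eq_mul, Real.norm_eq_abs, abs_mul, abs_of_pos (by norm_num : (0 : ℝ) < 1 / 2)]
      have h3 := hb _ (card_flip_le y A) (hW.flip_le A y hy)
      have h4 := abs_drift_le y A
      have h5 := apply_nonneg N (Finsupp.single (flip y A) (1 : ℝ))
      rw [mul_assoc]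
      have : |drift y A| * N (Finsupp.single (flip y A) 1) ≤ 1 * E :=
        mul_le_mul h4 h3 h5 zero_le_one
      linarith
    refine (Finset.sum_le_sum this).trans ?_
    rw [Finset.sum_const, nsmul_eq_mul]
    have h6 : ((driftSites A).card : ℝ) ≤ 2 * A.card := by exact_mod_cast card_driftSites_le A
    nlinarith
  have h3 := map_add_le_add N (∑ i : Fin d, ∑ x ∈ bondSites i A, (1 / 2 : ℝ) •
      (Finsupp.single (swapSet x (x + unitVec i) A) 1 - Finsupp.single A 1))
      (∑ y ∈ driftSites A, ((1 : ℝ) / 2 * drift y A) • Finsupp.single (flip y A) 1)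
  rw [row]
  refine h3.trans ((add_le_add h1 h2).trans (le_of_eq ?_))
  rw [hEdef]; ring

/-- The `n`-th application of the generator meets sets of up to `|A| + n - 1` sites, whence the rising
factorial: the powers grow only like `n!`, although the generator is unbounded. -/
lemma seminorm_gen_pow_le {W : Finset (Site d) → ℝ} {κ : ℝ} (hκ : 0 ≤ κ) (hW : IsWeight W κ)
    (N : Seminorm ℝ (WalshSpace d)) (hN : ∀ A, N (Finsupp.single A 1) ≤ W A) (n : ℕ)
    (A : Finset (Site d)) :
    N ((gen ^ n) (Finsupp.single A 1)) ≤
      W A * ((2 * d + 1) * κ) ^ n * (A.card.ascFactorial n : ℝ) := by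
  induction n generalizing A with
  | zero => simpa using hN A
  | succ n ih =>
    rw [pow_succ, Module.End.mul_apply, gen_single]
    have hG : (0 : ℝ) ≤ ((2 * d + 1) * κ) ^ n * ((A.card + 1).ascFactorial n : ℝ) := by positivity
    have h1 := seminorm_row_le hW hG (N.comp (gen ^ n : Module.End ℝ (WalshSpace d))) A
      fun B hB => by
        rw [Seminorm.comp_apply]
        refine (ih B).trans ?_
        rw [mul_assoc]
        have : (B.card.ascFactorial n : ℝ) ≤ ((A.card + 1).ascFactorial n : ℝ) := by
          exact_mod_cast Nat.ascFactorial_le n hB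
        have := hW.nonneg B
        gcongr
    rw [Seminorm.comp_apply] at h1
    refine h1.trans (le_of_eq ?_)
    have h2 : (A.card.ascFactorial (n + 1) : ℝ) = A.card * ((A.card + 1).ascFactorial n : ℝ) := by
      have := Nat.succ_ascFactorial A.card n
      rw [Nat.ascFactorial_succ]
      exact_mod_cast this.symm
    rw [h2, pow_succ]
    ring

lemma ascFactorial_le_factorial_mul (m n : ℕ) :
    (m.ascFactorial n : ℝ) ≤ n.factorial * (2 ^ m * 2 ^ n) := by
  rw [Nat.ascFactorial_eq_factorial_mul_choose', ← pow_add]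
  have : (m + n - 1).choose n ≤ 2 ^ (m + n) :=
    (Nat.choose_le_two_pow _ _).trans (Nat.pow_le_pow_right (by norm_num) (Nat.sub_le _ _))
  push_cast
  gcongr
  exact_mod_cast this

lemma seminorm_gen_pow_le' {W : Finset (Site d) → ℝ} {κ : ℝ} (hκ : 0 ≤ κ) (hW : IsWeight W κ)
    (N : Seminorm ℝ (WalshSpace d)) (hN : ∀ A, N (Finsupp.single A 1) ≤ W A) (n : ℕ)
    (A : Finset (Site d)) :
    N ((gen ^ n) (Finsupp.single A 1)) ≤
      2 ^ A.card * W A * (2 * (2 * d + 1) * κ) ^ n * n.factorial := by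
  refine (seminorm_gen_pow_le hκ hW N hN n A).trans ?_
  have h1 := ascFactorial_le_factorial_mul A.card n
  have h2 := hW.nonneg A
  calc W A * ((2 * d + 1) * κ) ^ n * (A.card.ascFactorial n : ℝ)
      ≤ W A * ((2 * d + 1) * κ) ^ n * (n.factorial * (2 ^ A.card * 2 ^ n)) := by gcongr
    _ = _ := by rw [mul_assoc 2, mul_pow 2]; ring

/-- All formal combinations of Walsh functions are analytic vectors of the generator, with a
radius of convergence that depends on the growth of the seminorm only. -/
lemma exists_seminorm_gen_pow_le {ι : Type*} {W : Finset (Site d) → ℝ} {κ : ℝ} (hκ : 0 ≤ κ)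
    (hW : IsWeight W κ) (N : ι → Seminorm ℝ (WalshSpace d))
    (hN : ∀ i A, N i (Finsupp.single A 1) ≤ W A)
    (f : WalshSpace d) :
    ∃ C, 0 ≤ C ∧ ∀ i n, N i ((gen ^ n) f) ≤ C * (2 * (2 * d + 1) * κ) ^ n * n.factorial := by
  induction f using Finsupp.induction_linear with
  | zero => exact ⟨0, le_rfl, by simp⟩
  | add f g hf hg =>
    obtain ⟨C, hC, hf⟩ := hf
    obtain ⟨D, hD, hg⟩ := hg
    refine ⟨C + D, by positivity, fun i n => ?_⟩
    rw [map_add]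
    refine (map_add_le_add (N i) _ _).trans ((add_le_add (hf i n) (hg i n)).trans (le_of_eq ?_))
    ring
  | single A c =>
    refine ⟨|c| * (2 ^ A.card * W A), by have := hW.nonneg A; positivity, fun i n => ?_⟩
    have h1 : Finsupp.single A c = c • Finsupp.single A (1 : ℝ) := by simp
    rw [h1, map_smul, map_smul_eq_mul, Real.norm_eq_abs]
    calc |c| * N i ((gen ^ n) (Finsupp.single A 1))
        ≤ |c| * (2 ^ A.card * W A * (2 * (2 * d + 1) * κ) ^ n * n.factorial) :=
          mul_le_mul_of_nonneg_left (seminorm_gen_pow_le' hκ hW (N i) (hN i) n A) (abs_nonneg _)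
      _ = _ := by ring

lemma isWeight_pow {C K : ℝ} (hC : 0 ≤ C) (hK : 1 ≤ K) :
    IsWeight (fun A : Finset (Site d) => C * K ^ A.card) K where
  nonneg A := by positivity
  le_self A := le_mul_of_one_le_left (by positivity) hK
  swap_le A i x _ := by
    rw [card_swapSet]
    exact le_mul_of_one_le_left (by positivity) hK
  flip_le A y _ := by
    calc C * K ^ (flip y A).card ≤ C * K ^ (A.card + 1) := by
          gcongr
          exact card_flip_le y A
      _ = K * (C * K ^ A.card) := by ring

lemma IsSolution.hasDerivWithinAt_ev {u : ℝ → Finset (Site d) → ℝ} (hu : IsSolution u)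
    (f : WalshSpace d) (t : ℝ) (ht : 0 ≤ t) :
    HasDerivWithinAt (fun s => ev (u s) f) (ev (u t) (gen f)) (Set.Ici 0) t := by
  rw [ev_gen]
  simp only [ev, Finsupp.linearCombination_apply, Finsupp.sum, smul_eq_mul]
  refine HasDerivWithinAt.fun_sum fun A _ => ((hu A t ht).const_mul _).congr_deriv ?_
  simp [ev, Finsupp.linearCombination_apply, Finsupp.sum]

/-- To prove a property for all times it is enough to propagate it over steps of a fixed length. -/
lemma step_induction {p : ℝ → Prop} {T r₀ : ℝ} (hr₀ : 0 < r₀) (h0 : p 0)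
    (hstep : ∀ s r, 0 ≤ s → 0 ≤ r → r ≤ r₀ → s + r ≤ T → p s → p (s + r)) {t : ℝ} (ht : 0 ≤ t)
    (htT : t ≤ T) : p t := by
  have key : ∀ n : ℕ, ∀ t, 0 ≤ t → t ≤ T → t ≤ n * r₀ → p t := by
    intro n
    induction n with
    | zero =>
      intro t h1 _ h2
      have : t = 0 := le_antisymm (by simpa using h2) h1
      rwa [this]
    | succ n ih =>
      intro t h1 h2 h3
      push_cast at h3
      rcases le_total t r₀ with h | h
      · have := hstep 0 t le_rfl h1 h (by linarith) h0
        rwa [zero_add] at this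
      · have := hstep (t - r₀) r₀ (by linarith) hr₀.le le_rfl (by linarith)
          (ih _ (by linarith) (by linarith) (by linarith))
        rwa [sub_add_cancel] at this
  obtain ⟨n, hn⟩ := exists_nat_ge (t / r₀)
  exact key n t ht htT ((div_le_iff₀ hr₀).1 hn)

/-- Solutions of at most exponential growth in the cardinality are determined by their initial
values. -/
lemma IsSolution.eq_zero {u : ℝ → Finset (Site d) → ℝ} (hu : IsSolution u) (h0 : ∀ A, u 0 A = 0)
    {C K : ℝ} (hC : 0 ≤ C) (hK : 1 ≤ K) {T : ℝ}
    (hb : ∀ t, 0 ≤ t → t ≤ T → ∀ A, |u t A| ≤ C * K ^ A.card)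
    {t : ℝ} (ht : 0 ≤ t) (htT : t ≤ T) (A : Finset (Site d)) : u t A = 0 := by
  set ρ : ℝ := 2 * (2 * d + 1) * K with hρ
  have hρ0 : 0 < ρ := by positivity
  refine step_induction (p := fun t => ∀ A, u t A = 0) (T := T) (r₀ := 1 / (2 * ρ)) (by positivity)
    h0 (fun s r hs hr hr0 hsr h => ?_) ht htT A
  intro A
  -- Over a step shorter than the radius of convergence the solution is the limit of its Taylor
  -- polynomials, which vanish.
  have h1 : ∀ n : ℕ, |u (s + r) A| ≤ 2 ^ A.card * (C * K ^ A.card) * (1 / 2) ^ n := by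
    intro n
    have h2 := abs_sub_taylor_le (y := fun t => ev (u t)) (L := gen)
      hu.hasDerivWithinAt_ev hs n (Finsupp.single A 1) hr (fun q hq =>
        seminorm_gen_pow_le' (by linarith) (isWeight_pow hC hK) (absSeminorm (ev (u q)))
          (fun B => by
            rw [absSeminorm_apply, ev_single, one_mul]
            exact hb q (hs.trans hq.1) (hq.2.trans hsr) B) n A)
    have h3 : ev (u s) = 0 := by
      ext B; simp [h B]
    simp only [h3, LinearMap.zero_apply, mul_zero, Finset.sum_const_zero, sub_zero, ev_single,
      one_mul] at h2
    refine h2.trans ?_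
    rw [← hρ]
    have h4 : ρ * r ≤ 1 / 2 := by
      have := mul_le_mul_of_nonneg_left hr0 hρ0.le
      rwa [mul_one_div, mul_comm 2, div_mul_cancel_left₀ hρ0.ne', inv_eq_one_div] at this
    have h5 : (0 : ℝ) < n.factorial := by positivity
    clear_value ρ
    calc 2 ^ A.card * (C * K ^ A.card) * ρ ^ n * n.factorial * (r ^ n / n.factorial)
        = 2 ^ A.card * (C * K ^ A.card) * (ρ * r) ^ n := by rw [mul_pow]; field_simp
      _ ≤ _ := by gcongr
  have h2 : Tendsto (fun n : ℕ => 2 ^ A.card * (C * K ^ A.card) * (1 / 2 : ℝ) ^ n) atTop (𝓝 0) := by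
    have := (tendsto_pow_atTop_nhds_zero_of_lt_one (r := (1 / 2 : ℝ)) (by norm_num)
      (by norm_num)).const_mul (2 ^ A.card * (C * K ^ A.card))
    simpa using this
  exact abs_nonpos_iff.1 (ge_of_tendsto' h2 h1)

end Weights

/-! ### Spatial decay of correlations -/

section DecayWeight

variable {d : ℕ}

/-- The `ℓ¹` length of a lattice vector. -/
def len (x : Site d) : ℕ := ∑ i, (x i).natAbs

lemma len_add_le (x y : Site d) : len (x + y) ≤ len x + len y := by
  unfold len
  rw [← Finset.sum_add_distrib]
  exact Finset.sum_le_sum fun i _ => Int.natAbs_add_le _ _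

lemma len_neg (x : Site d) : len (-x) = len x := by simp [len]

lemma len_unitVec (i : Fin d) : len (unitVec i : Site d) = 1 := by
  unfold len unitVec
  rw [Finset.sum_eq_single i]
  · simp
  · intro j _ hj; simp [hj]
  · simp

/-- A weight on finite sets which decays exponentially in the distance from the origin. -/
def decayWeight (M a : ℝ) (A : Finset (Site d)) : ℝ := M ^ A.card * ∑ z ∈ A, a ^ len z

lemma decayWeight_nonneg {M a : ℝ} (hM : 0 ≤ M) (ha : 0 ≤ a) (A : Finset (Site d)) :
    0 ≤ decayWeight M a A := by
  unfold decayWeight; positivity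

lemma pow_len_le {a : ℝ} (ha : 0 < a) (ha1 : a ≤ 1) {x y : Site d} (h : len y ≤ len x + 1) :
    a ^ len x ≤ a⁻¹ * a ^ len y := by
  have h1 : a ^ (len x + 1) ≤ a ^ len y := pow_le_pow_of_le_one ha.le ha1 h
  rw [inv_mul_eq_div, le_div_iff₀ ha, ← pow_succ]
  exact h1

lemma rpow_sum_le_sum_rpow {ι : Type*} (s : Finset ι) (f : ι → ℝ) (hf : ∀ i ∈ s, 0 ≤ f i) {θ : ℝ}
    (h0 : 0 < θ) (h1 : θ ≤ 1) : (∑ i ∈ s, f i) ^ θ ≤ ∑ i ∈ s, f i ^ θ := by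
  classical
  induction s using Finset.induction_on with
  | empty => simp [h0.ne']
  | insert a s ha ih =>
    rw [Finset.sum_insert ha, Finset.sum_insert ha]
    have h2 : 0 ≤ ∑ i ∈ s, f i :=
      Finset.sum_nonneg fun i hi => hf i (Finset.mem_insert_of_mem hi)
    refine (Real.rpow_add_le_add_rpow (hf a (Finset.mem_insert_self _ _)) h2 h0.le h1).trans ?_
    gcongr
    exact ih fun i hi => hf i (Finset.mem_insert_of_mem hi)

/-- A bounded quantity with exponential decay also has a slower exponential decay with a weight
that varies by a factor at most `3` between neighbouring sets: `min 1 W ≤ W ^ θ`, and for small `θ`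
the constants of `W ^ θ` are close to those of the trivial weight. -/
lemma exists_le_decayWeight_of_le_one {M a : ℝ} (hM : 1 ≤ M) (ha : 0 < a) (ha1 : a < 1) :
    ∃ M' a' : ℝ, 1 ≤ M' ∧ 0 < a' ∧ a' < 1 ∧ M' * (1 + a'⁻¹) ≤ 3 ∧
      ∀ (x : ℝ) (A : Finset (Site d)), |x| ≤ 1 → |x| ≤ decayWeight M a A →
        |x| ≤ decayWeight M' a' A := by
  have hlim : Tendsto (fun θ : ℝ => M ^ θ * (1 + (a ^ θ)⁻¹)) (𝓝[>] 0) (𝓝 2) := by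
    have h1 : ContinuousAt (fun θ : ℝ => M ^ θ * (1 + (a ^ θ)⁻¹)) 0 := by
      have h2 : ContinuousAt (fun θ : ℝ => M ^ θ) 0 :=
        Real.continuousAt_const_rpow (by linarith)
      have h3 : ContinuousAt (fun θ : ℝ => a ^ θ) 0 := Real.continuousAt_const_rpow ha.ne'
      exact h2.mul (continuousAt_const.add (h3.inv₀ (by simp)))
    have h4 := h1.tendsto
    simp only [Real.rpow_zero, inv_one, one_mul] at h4
    norm_num at h4
    exact h4.mono_left nhdsWithin_le_nhds
  have hev : ∀ᶠ θ : ℝ in 𝓝[>] 0, M ^ θ * (1 + (a ^ θ)⁻¹) < 3 :=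
    hlim.eventually_lt_const (by norm_num)
  have hev2 : ∀ᶠ θ : ℝ in 𝓝[>] 0, θ < 1 :=
    (tendsto_nhdsWithin_of_tendsto_nhds tendsto_id).eventually_lt_const (by norm_num)
  obtain ⟨θ, ⟨h3, h1⟩, h0⟩ := ((hev.and hev2).and self_mem_nhdsWithin).exists
  have h0 : 0 < θ := h0
  refine ⟨M ^ θ, a ^ θ, Real.one_le_rpow hM h0.le, Real.rpow_pos_of_pos ha _,
    Real.rpow_lt_one ha.le ha1 h0, h3.le, fun x A hx hxA => ?_⟩
  calc |x| ≤ |x| ^ θ := by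
        have := Real.rpow_le_rpow_of_exponent_ge' (abs_nonneg x) hx h0.le h1.le
        rwa [Real.rpow_one] at this
    _ ≤ decayWeight M a A ^ θ := Real.rpow_le_rpow (abs_nonneg x) hxA h0.le
    _ ≤ decayWeight (M ^ θ) (a ^ θ) A := by
        unfold decayWeight
        rw [Real.mul_rpow (by positivity) (Finset.sum_nonneg fun _ _ => by positivity),
          ← Real.rpow_natCast, ← Real.rpow_mul (by linarith), mul_comm (A.card : ℝ), Real.rpow_mul
          (by linarith), Real.rpow_natCast]
        gcongr
        refine (rpow_sum_le_sum_rpow A _ (fun _ _ => by positivity) h0 h1.le).trans (le_of_eq ?_)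
        refine Finset.sum_congr rfl fun z _ => ?_
        rw [← Real.rpow_natCast, ← Real.rpow_natCast, ← Real.rpow_mul ha.le, ← Real.rpow_mul ha.le,
          mul_comm]

end DecayWeight

section Decay

variable {d : ℕ} [NeZero d]

lemma isWeight_decayWeight {M a : ℝ} (hM : 1 ≤ M) (ha : 0 < a) (ha1 : a ≤ 1) :
    IsWeight (decayWeight M a : Finset (Site d) → ℝ) (M * (1 + a⁻¹)) := by
  have h1 : 1 ≤ a⁻¹ := (one_le_inv₀ ha).2 ha1
  have hself : ∀ A : Finset (Site d), decayWeight M a A ≤ M * (1 + a⁻¹) * decayWeight M a A :=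
    fun A => by
      refine le_mul_of_one_le_left (decayWeight_nonneg (by linarith) ha.le A) ?_
      nlinarith
  refine ⟨fun A => decayWeight_nonneg (by linarith) ha.le A, hself, fun A i x _ => ?_,
    fun A y hy => ?_⟩
  · have h2 : ∑ z ∈ swapSet x (x + unitVec i) A, a ^ len z ≤ a⁻¹ * ∑ z ∈ A, a ^ len z := by
      rw [swapSet, Finset.sum_map, Finset.mul_sum]
      refine Finset.sum_le_sum fun z _ => pow_len_le ha ha1 ?_
      simp only [Equiv.coe_toEmbedding, Equiv.swap_apply_def]
      split_ifs with h3 h4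
      · rw [h3]
        have := len_add_le (x + unitVec i) (-unitVec i)
        rwa [len_neg, len_unitVec, add_neg_cancel_right] at this
      · rw [h4]
        have := len_add_le x (unitVec i)
        rwa [len_unitVec] at this
      · omega
    have h5 : 0 ≤ ∑ z ∈ A, a ^ len z := by positivity
    unfold decayWeight
    rw [card_swapSet]
    calc M ^ A.card * ∑ z ∈ swapSet x (x + unitVec i) A, a ^ len z
        ≤ M ^ A.card * (a⁻¹ * ∑ z ∈ A, a ^ len z) := by gcongr
      _ = (1 * a⁻¹) * (M ^ A.card * ∑ z ∈ A, a ^ len z) := by ring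
      _ ≤ _ := by
        refine mul_le_mul_of_nonneg_right ?_ (by positivity)
        exact mul_le_mul hM (by linarith) (by positivity) (by linarith)
  · have h5 : 0 ≤ ∑ z ∈ A, a ^ len z := by positivity
    have h2 : ∑ z ∈ flip y A, a ^ len z ≤ (1 + a⁻¹) * ∑ z ∈ A, a ^ len z := by
      by_cases h : y ∈ A
      · rw [flip_of_mem h]
        refine (Finset.sum_le_sum_of_subset_of_nonneg (Finset.erase_subset _ _)
          fun _ _ _ => by positivity).trans ?_
        exact le_mul_of_one_le_left h5 (by linarith)
      · rw [flip_of_notMem h, Finset.sum_insert h, add_mul, one_mul, add_comm]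
        have h6 : ∀ w ∈ A, len w ≤ len y + 1 → a ^ len y ≤ a⁻¹ * ∑ z ∈ A, a ^ len z :=
          fun w hw hl => (pow_len_le ha ha1 hl).trans (by
            gcongr
            exact Finset.single_le_sum (f := fun z => a ^ len z) (fun _ _ => by positivity) hw)
        have h7 : a ^ len y ≤ a⁻¹ * ∑ z ∈ A, a ^ len z := by
          rcases mem_driftSites.1 hy with h8 | h8
          · refine h6 _ h8 ?_
            have := len_add_le y (-unitVec 0)
            rwa [len_neg, len_unitVec, ← sub_eq_add_neg] at this
          · refine h6 _ h8 ?_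
            have := len_add_le y (unitVec 0)
            rwa [len_unitVec] at this
        linarith
    unfold decayWeight
    calc M ^ (flip y A).card * ∑ z ∈ flip y A, a ^ len z
        ≤ M ^ (A.card + 1) * ((1 + a⁻¹) * ∑ z ∈ A, a ^ len z) := by
          gcongr
          · exact card_flip_le y A
      _ = _ := by ring

/-- Exponential spatial decay is propagated by the evolution, locally uniformly in time. The rate
deteriorates from step to step, but the steps have a fixed length: the bound `|u| ≤ 1` allows to
return to a weight of growth `3` before each of them. -/
lemma IsSolution.exists_decay {u : ℝ → Finset (Site d) → ℝ} (hu : IsSolution u)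
    (hb : ∀ t A, |u t A| ≤ 1) {M₀ a₀ : ℝ} (hM₀ : 1 ≤ M₀) (ha₀ : 0 < a₀) (ha₀' : a₀ < 1)
    (h0 : ∀ A, |u 0 A| ≤ decayWeight M₀ a₀ A) {T : ℝ} (hT : 0 ≤ T) :
    ∃ M a : ℝ, 1 ≤ M ∧ 0 < a ∧ a < 1 ∧
      ∀ t, 0 ≤ t → t ≤ T → ∀ A, |u t A| ≤ decayWeight M a A := by
  set ρ : ℝ := 2 * (2 * d + 1) * 3 with hρ
  have hρ0 : 0 < ρ := by positivity
  refine step_induction (p := fun T => ∃ M a : ℝ, 1 ≤ M ∧ 0 < a ∧ a < 1 ∧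
      ∀ t, 0 ≤ t → t ≤ T → ∀ A, |u t A| ≤ decayWeight M a A) (T := T) (r₀ := 1 / (2 * ρ))
    (by positivity) ⟨M₀, a₀, hM₀, ha₀, ha₀', fun t h1 h2 A => ?_⟩ (fun s r hs hr hr0 _ h => ?_) hT le_rfl
  · rw [le_antisymm h2 h1]; exact h0 A
  obtain ⟨M, a, hM, ha, ha1, h⟩ := h
  obtain ⟨M', a', hM', ha', ha1', hκ, hle⟩ := exists_le_decayWeight_of_le_one (d := d) hM ha ha1
  have hW : IsWeight (decayWeight M' a' : Finset (Site d) → ℝ) 3 := by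
    have := isWeight_decayWeight (d := d) hM' ha' ha1'.le
    refine ⟨this.nonneg, fun A => ?_, fun A i x hx => ?_, fun A y hy => ?_⟩
    · exact (this.le_self A).trans (mul_le_mul_of_nonneg_right hκ (this.nonneg A))
    · exact (this.swap_le A i x hx).trans (mul_le_mul_of_nonneg_right hκ (this.nonneg A))
    · exact (this.flip_le A y hy).trans (mul_le_mul_of_nonneg_right hκ (this.nonneg A))
  have hWle : ∀ A : Finset (Site d), 2 * (2 ^ A.card * decayWeight M' a' A) ≤
      decayWeight (4 * M') a' A := by
    intro A
    unfold decayWeight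
    rcases A.eq_empty_or_nonempty with rfl | hA
    · simp
    · have h1 : (2 : ℝ) ≤ 2 ^ A.card := by
        have : 1 ≤ A.card := hA.card_pos
        calc (2 : ℝ) = 2 ^ 1 := by norm_num
          _ ≤ 2 ^ A.card := by gcongr; norm_num
      have h2 : 0 ≤ ∑ z ∈ A, a' ^ len z := by positivity
      have h3 : (4 * M') ^ A.card = 2 ^ A.card * (2 ^ A.card * M' ^ A.card) := by
        rw [← mul_assoc, ← mul_pow, ← mul_pow]; norm_num
      rw [h3]
      have h4 : 0 ≤ 2 ^ A.card * (M' ^ A.card * ∑ z ∈ A, a' ^ len z) := by positivity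
      nlinarith
  refine ⟨4 * M', a', by linarith, ha', ha1', fun t ht htr A => ?_⟩
  rcases le_total t s with hts | hts
  · refine (hle _ A (hb t A) (h t ht hts A)).trans (le_trans ?_ (hWle A))
    have h1 := decayWeight_nonneg (by linarith : 0 ≤ M') ha'.le A
    have h2 : (1 : ℝ) ≤ 2 ^ A.card := one_le_pow₀ (by norm_num)
    nlinarith
  · obtain ⟨q, rfl⟩ : ∃ q, t = s + q := ⟨t - s, by ring⟩
    have hq : 0 ≤ q := by linarith
    have hq0 : ρ * q ≤ 1 / 2 := by
      have h1 : q ≤ 1 / (2 * ρ) := by linarith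
      have := mul_le_mul_of_nonneg_left h1 hρ0.le
      rwa [mul_one_div, mul_comm 2, div_mul_cancel_left₀ hρ0.ne', inv_eq_one_div] at this
    -- The Taylor polynomial is bounded with the decaying weight, the remainder with the weight `1`.
    have h1 : ∀ n : ℕ, |u (s + q) A| ≤ 2 * (2 ^ A.card * decayWeight M' a' A) +
        2 ^ A.card * (1 / 2) ^ n := by
      intro n
      have h2 := abs_sub_taylor_le (y := fun t => ev (u t)) (L := gen)
        hu.hasDerivWithinAt_ev hs n (Finsupp.single A 1) hq (fun q' _ =>
          seminorm_gen_pow_le' (κ := 1) (by norm_num)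
            (isWeight_pow (C := 1) (K := 1) (by norm_num) le_rfl)
            (absSeminorm (ev (u q')))
            (fun B => by
              rw [absSeminorm_apply, ev_single, one_mul]
              simpa using hb q' B) n A)
      have h3 : |∑ k ∈ Finset.range n, q ^ k / (k.factorial : ℝ) *
          ev (u s) ((gen ^ k) (Finsupp.single A 1))| ≤
          2 ^ A.card * decayWeight M' a' A * ∑ k ∈ Finset.range n, (1 / 2 : ℝ) ^ k := by
        rw [Finset.mul_sum]
        refine (Finset.abs_sum_le_sum_abs _ _).trans (Finset.sum_le_sum fun k _ => ?_)
        have h4 := seminorm_gen_pow_le' (by norm_num) hW (absSeminorm (ev (u s)))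
          (fun B => by
              rw [absSeminorm_apply, ev_single, one_mul]
              exact hle _ B (hb s B) (h s hs le_rfl B)) k A
        rw [absSeminorm_apply, ← hρ] at h4
        have h5 : (0 : ℝ) < k.factorial := by positivity
        have h6 := decayWeight_nonneg (by linarith : 0 ≤ M') ha'.le A
        rw [abs_mul, abs_of_nonneg (by positivity)]
        clear_value ρ
        calc q ^ k / k.factorial * |ev (u s) ((gen ^ k) (Finsupp.single A 1))|
            ≤ q ^ k / k.factorial *
              (2 ^ A.card * decayWeight M' a' A * ρ ^ k * k.factorial) := by gcongr
          _ = 2 ^ A.card * decayWeight M' a' A * (ρ * q) ^ k := by rw [mul_pow]; field_simp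
          _ ≤ _ := by gcongr
      have h4 : ∑ k ∈ Finset.range n, (1 / 2 : ℝ) ^ k ≤ 2 := by
        have := geom_sum_eq (x := (1 / 2 : ℝ)) (by norm_num) n
        rw [this]
        have : (0 : ℝ) < (1 / 2) ^ n := by positivity
        rw [div_le_iff_of_neg (by norm_num)]
        linarith
      have h5 : 2 ^ A.card * (1 * (1 : ℝ) ^ A.card) * (2 * (2 * d + 1) * 1) ^ n * n.factorial *
          (q ^ n / n.factorial) ≤ 2 ^ A.card * (1 / 2) ^ n := by
        have h7 : (0 : ℝ) < n.factorial := by positivity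
        have h8 : (2 * (2 * (d : ℝ) + 1) * 1) * q ≤ 1 / 2 := by
          refine le_trans ?_ hq0
          rw [hρ]
          gcongr
          norm_num
        calc _ = 2 ^ A.card * ((2 * (2 * (d : ℝ) + 1) * 1) * q) ^ n := by
              rw [mul_pow _ q]; field_simp; simp
          _ ≤ _ := by gcongr
      have h6 := decayWeight_nonneg (by linarith : 0 ≤ M') ha'.le A
      have h7 : 2 ^ A.card * decayWeight M' a' A * ∑ k ∈ Finset.range n, (1 / 2 : ℝ) ^ k ≤
          2 ^ A.card * decayWeight M' a' A * 2 := by gcongr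
      simp only [ev_single, one_mul] at h2 h5
      have h8 := abs_sub_abs_le_abs_sub (u (s + q) A) (∑ k ∈ Finset.range n,
        q ^ k / (k.factorial : ℝ) * ev (u s) ((gen ^ k) (Finsupp.single A 1)))
      linarith
    have h2 : Tendsto (fun n : ℕ => 2 * (2 ^ A.card * decayWeight M' a' A) +
        2 ^ A.card * (1 / 2 : ℝ) ^ n) atTop (𝓝 (2 * (2 ^ A.card * decayWeight M' a' A))) := by
      have := ((tendsto_pow_atTop_nhds_zero_of_lt_one (r := (1 / 2 : ℝ)) (by norm_num)
        (by norm_num)).const_mul (2 ^ A.card)).const_add (2 * (2 ^ A.card * decayWeight M' a' A))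
      simpa using this
    exact (ge_of_tendsto' h2 h1).trans (hWle A)

end Decay

/-! ### A variational lower bound for the resolvent -/

section Resolvent

variable {V : Type*} [AddCommGroup V] [Module ℝ V]
variable {H : Type*} [NormedAddCommGroup H] [InnerProductSpace ℝ H]

/-- The Taylor polynomial `∑_{k < n} r^k / k! L^k f` of `e^{r L} f`. -/
def expPoly (L : Module.End ℝ V) (n : ℕ) (r : ℝ) (f : V) : V :=
  ∑ k ∈ Finset.range n, (r ^ k / (k.factorial : ℝ)) • (L ^ k) f

lemma map_expPoly {W : Type*} [AddCommGroup W] [Module ℝ W] (y : V →ₗ[ℝ] W) (L : Module.End ℝ V)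
    (n : ℕ) (r : ℝ) (f : V) :
    y (expPoly L n r f) = ∑ k ∈ Finset.range n, (r ^ k / (k.factorial : ℝ)) • y ((L ^ k) f) := by
  simp [expPoly]

/-- If `L` is dissipative and `f` an analytic vector, then for small `r` the Taylor polynomials of
`e^{r L} f` are no longer than `f`, up to errors that tend to `0`. -/
lemma exists_norm_expPoly_le {ι : V →ₗ[ℝ] H} {L : Module.End ℝ V}
    (hdiss : ∀ f, inner ℝ (ι f) (ι (L f)) ≤ 0) {ρ : ℝ} (hρ : 0 < ρ) {f : V} {C : ℝ} (hC : 0 ≤ C)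
    (han : ∀ n, ‖ι ((L ^ n) f)‖ ≤ C * ρ ^ n * n.factorial) :
    ∃ e : ℕ → ℝ, Tendsto e atTop (𝓝 0) ∧ ∀ n r, 0 ≤ r → ρ * r ≤ 1 / 2 →
      ‖ι (expPoly L (n + 1) r f)‖ ^ 2 ≤ ‖ι f‖ ^ 2 + e n := by
  refine ⟨fun n => 2 * C ^ 2 * ((n + 1 : ℕ) * (1 / 2) ^ n), ?_, fun n r hr hρr => ?_⟩
  · have h1 := (tendsto_self_mul_const_pow_of_lt_one (r := (1 / 2 : ℝ)) (by norm_num)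
      (by norm_num)).comp (tendsto_add_atTop_nat 1)
    have h2 := h1.const_mul (4 * C ^ 2)
    rw [mul_zero] at h2
    refine h2.congr fun n => ?_
    simp only [Function.comp_apply, pow_succ]
    ring
  set v : ℕ → H := fun k => ι ((L ^ k) f) with hv
  set φ : ℝ → H := fun q => ∑ k ∈ Finset.range (n + 1), (q ^ k / (k.factorial : ℝ)) • v k with hφ
  have hφe : ∀ q, φ q = ι (expPoly L (n + 1) q f) := fun q => (map_expPoly ι L _ q f).symm
  have hder : ∀ q, HasDerivAt φ (ι (L (expPoly L n q f))) q := by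
    intro q
    have h2 : HasDerivAt (fun q : ℝ => ∑ k ∈ Finset.range n,
        (q ^ (k + 1) / ((k + 1).factorial : ℝ)) • v (k + 1) +
        (q ^ 0 / (Nat.factorial 0 : ℝ)) • v 0)
        (∑ k ∈ Finset.range n, (q ^ k / (k.factorial : ℝ)) • v (k + 1) + 0) q := by
      refine HasDerivAt.add (HasDerivAt.fun_sum fun k _ => ?_) ?_
      · have h3 := ((hasDerivAt_pow (k + 1) q).div_const ((k + 1).factorial : ℝ)).smul_const
          (v (k + 1))
        refine h3.congr_deriv ?_
        congr 1
        rw [Nat.factorial_succ]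
        have : (k.factorial : ℝ) ≠ 0 := by positivity
        have : ((k : ℝ) + 1) ≠ 0 := by positivity
        push_cast
        field_simp
      · simpa using hasDerivAt_const q _
    have h4 : ι (L (expPoly L n q f)) =
        ∑ k ∈ Finset.range n, (q ^ k / (k.factorial : ℝ)) • v (k + 1) := by
      rw [map_expPoly, map_sum]
      simp only [map_smul, hv]
      refine Finset.sum_congr rfl fun k _ => ?_
      rw [pow_succ', Module.End.mul_apply]
    rw [h4, ← add_zero (∑ k ∈ Finset.range n, (q ^ k / (k.factorial : ℝ)) • v (k + 1))]
    refine h2.congr_of_eventuallyEq (Eventually.of_forall fun x => ?_)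
    exact Finset.sum_range_succ' (fun k => (x ^ k / (k.factorial : ℝ)) • v k) n
  -- The derivative of `‖φ‖ ^ 2` would be negative if it were `⟨φ, L φ⟩`; the polynomial misses the
  -- last term of `L φ`, which is small.
  have hbound : ∀ q, 0 ≤ q → q ≤ r → 2 * inner ℝ (φ q) (ι (L (expPoly L n q f))) ≤
      4 * C ^ 2 * ρ * ((n + 1 : ℕ) * (1 / 2) ^ n) := by
    intro q hq hqr
    have hρq : ρ * q ≤ 1 / 2 := (mul_le_mul_of_nonneg_left hqr hρ.le).trans hρr
    have h1 : ι (L (expPoly L n q f)) = ι (L (expPoly L (n + 1) q f)) -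
        (q ^ n / (n.factorial : ℝ)) • v (n + 1) := by
      have : expPoly L (n + 1) q f = expPoly L n q f + (q ^ n / (n.factorial : ℝ)) • (L ^ n) f := by
        simp [expPoly, Finset.sum_range_succ]
      rw [this, map_add, map_add, map_smul, map_smul, hv]
      simp only [pow_succ', Module.End.mul_apply]
      abel
    have h2 : ‖φ q‖ ≤ 2 * C := by
      refine (norm_sum_le _ _).trans ?_
      have : ∀ k ∈ Finset.range (n + 1), ‖(q ^ k / (k.factorial : ℝ)) • v k‖ ≤
          C * (1 / 2) ^ k := by
        intro k _
        have h5 : (0 : ℝ) < k.factorial := by positivity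
        rw [norm_smul, Real.norm_eq_abs, abs_of_nonneg (by positivity)]
        calc q ^ k / k.factorial * ‖v k‖ ≤ q ^ k / k.factorial * (C * ρ ^ k * k.factorial) := by
              gcongr; exact han k
          _ = C * (ρ * q) ^ k := by rw [mul_pow]; field_simp
          _ ≤ _ := by gcongr
      refine (Finset.sum_le_sum this).trans ?_
      rw [← Finset.mul_sum, mul_comm 2]
      refine mul_le_mul_of_nonneg_left ?_ hC
      rw [geom_sum_eq (by norm_num)]
      have : (0 : ℝ) < (1 / 2) ^ (n + 1) := by positivity
      rw [div_le_iff_of_neg (by norm_num)]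
      linarith
    have h3 : ‖(q ^ n / (n.factorial : ℝ)) • v (n + 1)‖ ≤ C * ρ * ((n + 1 : ℕ) * (1 / 2) ^ n) := by
      have h5 : (0 : ℝ) < n.factorial := by positivity
      rw [norm_smul, Real.norm_eq_abs, abs_of_nonneg (by positivity)]
      calc q ^ n / n.factorial * ‖v (n + 1)‖
          ≤ q ^ n / n.factorial * (C * ρ ^ (n + 1) * (n + 1).factorial) := by
            gcongr; exact han (n + 1)
        _ = C * ρ * ((n + 1 : ℕ) * (ρ * q) ^ n) := by
            rw [mul_pow, Nat.factorial_succ]; push_cast; field_simp; ring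
        _ ≤ _ := by gcongr
    rw [h1, inner_sub_right]
    have h4 := hdiss (expPoly L (n + 1) q f)
    rw [← hφe] at h4
    have h5 := neg_le_of_abs_le (abs_real_inner_le_norm (φ q) ((q ^ n / (n.factorial : ℝ)) • v (n + 1)))
    have h6 : ‖φ q‖ * ‖(q ^ n / (n.factorial : ℝ)) • v (n + 1)‖ ≤
        2 * C * (C * ρ * ((n + 1 : ℕ) * (1 / 2) ^ n)) :=
      mul_le_mul h2 h3 (norm_nonneg _) (by positivity)
    nlinarith
  have h0 : φ 0 = ι f := by
    simp only [hφ]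
    rw [Finset.sum_range_succ']
    simp [hv]
  have hmain := image_le_of_deriv_right_le_deriv_boundary (a := 0) (b := r)
    (f := fun q => ‖φ q‖ ^ 2) (f' := fun q => 2 * inner ℝ (φ q) (ι (L (expPoly L n q f))))
    (B := fun q => ‖ι f‖ ^ 2 + 4 * C ^ 2 * ρ * ((n + 1 : ℕ) * (1 / 2) ^ n) * q)
    (B' := fun _ => 4 * C ^ 2 * ρ * ((n + 1 : ℕ) * (1 / 2) ^ n))
    (fun q _ => ((hder q).norm_sq).continuousAt.continuousWithinAt)
    (fun q _ => ((hder q).norm_sq).hasDerivWithinAt) (by simp [h0]) (by fun_prop)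
    (fun q _ => by
      have := (((hasDerivAt_id q).const_mul (4 * C ^ 2 * ρ * ((n + 1 : ℕ) * (1 / 2) ^ n))).const_add
        (‖ι f‖ ^ 2)).hasDerivWithinAt (s := Set.Ici q)
      simpa using this)
    (fun q hq => hbound q hq.1 hq.2.le) (Set.right_mem_Icc.2 hr)
  simp only [hφe] at hmain
  refine hmain.trans ?_
  have : 4 * C ^ 2 * ρ * ((n + 1 : ℕ) * (1 / 2) ^ n) * r =
      4 * C ^ 2 * ((n + 1 : ℕ) * (1 / 2) ^ n) * (ρ * r) := by ring
  rw [this]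
  have h7 : 4 * C ^ 2 * ((n + 1 : ℕ) * (1 / 2 : ℝ) ^ n) * (ρ * r) ≤
      4 * C ^ 2 * ((n + 1 : ℕ) * (1 / 2) ^ n) * (1 / 2) :=
    mul_le_mul_of_nonneg_left hρr (by positivity)
  linarith

/-- The evolution of functionals which starts from an inner product is a contraction for all
times. -/
lemma abs_functional_le {ι : V →ₗ[ℝ] H} {L : Module.End ℝ V}
    (hdiss : ∀ f, inner ℝ (ι f) (ι (L f)) ≤ 0) {ρ : ℝ} (hρ : 0 < ρ)
    (han : ∀ f, ∃ C, 0 ≤ C ∧ ∀ n, ‖ι ((L ^ n) f)‖ ≤ C * ρ ^ n * n.factorial)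
    {y : ℝ → V →ₗ[ℝ] ℝ}
    (hy : ∀ f t, 0 ≤ t → HasDerivWithinAt (fun s => y s f) (y t (L f)) (Set.Ici 0) t)
    (hyan : ∀ T, 0 ≤ T → ∃ ρ', 0 < ρ' ∧ ∀ f, ∃ C, 0 ≤ C ∧ ∀ t, 0 ≤ t → t ≤ T → ∀ n : ℕ,
      |y t ((L ^ n) f)| ≤ C * ρ' ^ n * n.factorial)
    {ω : H} (hy0 : ∀ f, y 0 f = inner ℝ (ι f) ω) {t : ℝ} (ht : 0 ≤ t) (f : V) :
    |y t f| ≤ ‖ι f‖ * ‖ω‖ := by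
  obtain ⟨ρ', hρ', hyan⟩ := hyan t ht
  refine step_induction (p := fun s => ∀ f, |y s f| ≤ ‖ι f‖ * ‖ω‖) (T := t)
    (r₀ := min (1 / (2 * ρ)) (1 / (2 * ρ'))) (lt_min (by positivity) (by positivity))
    (fun f => by rw [hy0]; exact abs_real_inner_le_norm _ _) (fun s r hs hr hr0 hsr h f => ?_)
    ht le_rfl f
  have hstep : ∀ a : ℝ, 0 < a → r ≤ 1 / (2 * a) → a * r ≤ 1 / 2 := fun a ha h1 => by
    have := mul_le_mul_of_nonneg_left h1 ha.le
    rwa [mul_one_div, mul_comm 2, div_mul_cancel_left₀ ha.ne', inv_eq_one_div] at this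
  have hr1 := hstep ρ hρ (hr0.trans (min_le_left _ _))
  have hr2 := hstep ρ' hρ' (hr0.trans (min_le_right _ _))
  obtain ⟨C, hC, han⟩ := han f
  obtain ⟨D, hD, hyan⟩ := hyan f
  obtain ⟨e, he, hle⟩ := exists_norm_expPoly_le hdiss hρ hC han
  have h1 : ∀ n : ℕ, |y (s + r) f| ≤ Real.sqrt (‖ι f‖ ^ 2 + e n) * ‖ω‖ + D * (1 / 2) ^ (n + 1) := by
    intro n
    have h2 := abs_sub_taylor_le hy hs (n + 1) f hr (B := D * ρ' ^ (n + 1) * (n + 1).factorial)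
      fun q hq => hyan q (hs.trans hq.1) (hq.2.trans hsr) (n + 1)
    have h3 : ∑ k ∈ Finset.range (n + 1), r ^ k / (k.factorial : ℝ) * y s ((L ^ k) f) =
        y s (expPoly L (n + 1) r f) := by
      rw [map_expPoly]; rfl
    rw [h3] at h2
    have h4 : D * ρ' ^ (n + 1) * (n + 1).factorial * (r ^ (n + 1) / ((n + 1).factorial : ℝ)) ≤
        D * (1 / 2) ^ (n + 1) := by
      have h5 : (0 : ℝ) < (n + 1).factorial := by positivity
      calc _ = D * (ρ' * r) ^ (n + 1) := by rw [mul_pow]; field_simp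
        _ ≤ _ := by gcongr
    have h5 : |y s (expPoly L (n + 1) r f)| ≤ Real.sqrt (‖ι f‖ ^ 2 + e n) * ‖ω‖ := by
      refine (h _).trans ?_
      gcongr
      exact Real.le_sqrt_of_sq_le (hle n r hr hr1)
    have h6 := abs_sub_abs_le_abs_sub (y (s + r) f) (y s (expPoly L (n + 1) r f))
    linarith
  have h2 : Tendsto (fun n : ℕ => Real.sqrt (‖ι f‖ ^ 2 + e n) * ‖ω‖ + D * (1 / 2) ^ (n + 1)) atTop
      (𝓝 (Real.sqrt (‖ι f‖ ^ 2 + 0) * ‖ω‖ + D * 0)) := by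
    refine Tendsto.add (Tendsto.mul_const _ ?_) (Tendsto.const_mul _ ?_)
    · exact (Real.continuous_sqrt.tendsto _).comp (he.const_add _)
    · exact (tendsto_pow_atTop_nhds_zero_of_lt_one (by norm_num) (by norm_num)).comp
        (tendsto_add_atTop_nat 1)
  have h3 := ge_of_tendsto' h2 h1
  rwa [add_zero, mul_zero, add_zero, Real.sqrt_sq (norm_nonneg _)] at h3

/-- Analytic vectors form a core: the closure of the range of `λ - L` on them contains them. A vector
`g` orthogonal to the range satisfies `⟨g, e^{r L} f⟩ = e^{λ r} ⟨g, f⟩`, which contradicts the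
contraction property of `e^{r L}` unless `g` vanishes on the analytic vectors. -/
lemma exists_norm_resolvent_sub_lt [CompleteSpace H] {ι : V →ₗ[ℝ] H} {L : Module.End ℝ V}
    (hdiss : ∀ f, inner ℝ (ι f) (ι (L f)) ≤ 0) {ρ : ℝ} (hρ : 0 < ρ)
    (han : ∀ f, ∃ C, 0 ≤ C ∧ ∀ n, ‖ι ((L ^ n) f)‖ ≤ C * ρ ^ n * n.factorial)
    {lam : ℝ} (hlam : 0 < lam) (w : V) {ε : ℝ} (hε : 0 < ε) :
    ∃ f, ‖ι (lam • f - L f) - ι w‖ < ε := by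
  set R : Submodule ℝ H := (LinearMap.range (ι ∘ₗ (lam • LinearMap.id - L))) with hR
  set K : Submodule ℝ H := R.topologicalClosure with hK
  have hKc : IsClosed (K : Set H) := R.isClosed_topologicalClosure
  have : CompleteSpace K := hKc.completeSpace_coe
  have hmem : ∀ f, ι (lam • f - L f) ∈ K := fun f => R.le_topologicalClosure ⟨f, by simp⟩
  set g : H := ι w - K.starProjection (ι w) with hg
  have hgorth : ∀ x ∈ K, inner ℝ g x = 0 := fun x hx => by
    have := K.sub_starProjection_mem_orthogonal (ι w)
    rw [Submodule.mem_orthogonal'] at this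
    exact this x hx
  have hgL : ∀ f, inner ℝ g (ι (L f)) = lam * inner ℝ g (ι f) := fun f => by
    have := hgorth _ (hmem f)
    rw [map_sub, map_smul, inner_sub_right, inner_smul_right] at this
    linarith
  have hgLn : ∀ n f, inner ℝ g (ι ((L ^ n) f)) = lam ^ n * inner ℝ g (ι f) := by
    intro n
    induction n with
    | zero => simp
    | succ n ih => intro f; rw [pow_succ', Module.End.mul_apply, hgL, ih]; ring
  have hcl : g ∈ closure (Set.range ι) := by
    have h1 : (K : Set H) ⊆ ((LinearMap.range ι).topologicalClosure : Submodule ℝ H) := by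
      refine Submodule.topologicalClosure_mono ?_
      rintro _ ⟨f, rfl⟩
      exact ⟨_, rfl⟩
    have h2 : g ∈ (LinearMap.range ι).topologicalClosure :=
      Submodule.sub_mem _ ((LinearMap.range ι).le_topologicalClosure ⟨w, rfl⟩)
        (h1 (K.starProjection_apply_mem (ι w)))
    rw [← SetLike.mem_coe, Submodule.topologicalClosure_coe] at h2
    rwa [LinearMap.coe_range] at h2
  set r : ℝ := 1 / (2 * ρ) with hr
  have hr0 : 0 < r := by positivity
  have hρr : ρ * r ≤ 1 / 2 := by
    rw [hr, mul_one_div, mul_comm 2, div_mul_cancel_left₀ hρ.ne', inv_eq_one_div]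
  have hineq : ∀ f, (1 + lam * r) * |inner ℝ g (ι f)| ≤ ‖g‖ * ‖ι f‖ := by
    intro f
    obtain ⟨C, hC, han⟩ := han f
    obtain ⟨e, he, hle⟩ := exists_norm_expPoly_le hdiss hρ hC han
    have h1 : ∀ n : ℕ, (1 + lam * r) * |inner ℝ g (ι f)| ≤ ‖g‖ * Real.sqrt (‖ι f‖ ^ 2 + e (n + 1)) := by
      intro n
      have h2 : inner ℝ g (ι (expPoly L (n + 1 + 1) r f)) =
          (∑ k ∈ Finset.range (n + 1 + 1), (lam * r) ^ k / (k.factorial : ℝ)) * inner ℝ g (ι f) := by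
        rw [map_expPoly, inner_sum, Finset.sum_mul]
        refine Finset.sum_congr rfl fun k _ => ?_
        rw [inner_smul_right, hgLn, mul_pow]
        ring
      have h3 : 1 + lam * r ≤ ∑ k ∈ Finset.range (n + 1 + 1), (lam * r) ^ k / (k.factorial : ℝ) := by
        rw [Finset.sum_range_succ', Finset.sum_range_succ']
        have : 0 ≤ ∑ k ∈ Finset.range n, (lam * r) ^ (k + 1 + 1) / ((k + 1 + 1).factorial : ℝ) :=
          Finset.sum_nonneg fun k _ => by positivity
        simp
        linarith
      calc (1 + lam * r) * |inner ℝ g (ι f)|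
          ≤ (∑ k ∈ Finset.range (n + 1 + 1), (lam * r) ^ k / (k.factorial : ℝ)) *
            |inner ℝ g (ι f)| := by gcongr
        _ = |inner ℝ g (ι (expPoly L (n + 1 + 1) r f))| := by
            rw [h2, abs_mul]
            congr 1
            exact (abs_of_nonneg (Finset.sum_nonneg fun k _ => by positivity)).symm
        _ ≤ ‖g‖ * ‖ι (expPoly L (n + 1 + 1) r f)‖ := abs_real_inner_le_norm _ _
        _ ≤ _ := by
            gcongr
            exact Real.le_sqrt_of_sq_le (hle (n + 1) r hr0.le hρr)
    have h2 : Tendsto (fun n : ℕ => ‖g‖ * Real.sqrt (‖ι f‖ ^ 2 + e (n + 1))) atTop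
        (𝓝 (‖g‖ * Real.sqrt (‖ι f‖ ^ 2 + 0))) := by
      refine Tendsto.const_mul _ ?_
      exact (Real.continuous_sqrt.tendsto _).comp
        ((he.comp (tendsto_add_atTop_nat 1)).const_add _)
    have h3 := ge_of_tendsto' h2 h1
    rwa [add_zero, Real.sqrt_sq (norm_nonneg _)] at h3
  have hgg : (1 + lam * r) * |inner ℝ g g| ≤ ‖g‖ * ‖g‖ := by
    have hclosed : IsClosed {x : H | (1 + lam * r) * |inner ℝ g x| ≤ ‖g‖ * ‖x‖} :=
      isClosed_le (by fun_prop) (by fun_prop)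
    exact closure_minimal (by rintro _ ⟨f, rfl⟩; exact hineq f) hclosed hcl
  have hg0 : ‖g‖ = 0 := by
    rw [real_inner_self_eq_norm_mul_norm, abs_of_nonneg (by positivity)] at hgg
    have : 0 < lam * r := by positivity
    have h1 : ‖g‖ * ‖g‖ ≤ 0 := by nlinarith [mul_self_nonneg ‖g‖]
    exact mul_self_eq_zero.1 (le_antisymm h1 (mul_self_nonneg _))
  have hwK : ι w ∈ K := by
    have : ι w = K.starProjection (ι w) := sub_eq_zero.1 (norm_eq_zero.1 hg0)
    rw [this]
    exact K.starProjection_apply_mem (ι w)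
  have hwcl : ι w ∈ closure (R : Set H) := by
    rwa [hK, ← SetLike.mem_coe, Submodule.topologicalClosure_coe] at hwK
  obtain ⟨_, ⟨f, rfl⟩, hf⟩ := Metric.mem_closure_iff.1 hwcl ε hε
  refine ⟨f, ?_⟩
  rw [dist_comm, dist_eq_norm] at hf
  simpa using hf

/-- A test vector `h` bounds the Laplace transform `∫ e^{-λ s} y_s(w) ds` of the
autocorrelation of `w` from below: `⟨w, h⟩² ≤ K ∫ e^{-λ s} y_s(w) ds` whenever
`⟨(λ - L) f, h⟩² ≤ K ⟨f, (λ - L) f⟩` for all `f`. For `f = (λ - L)⁻¹ w` the integral is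
`⟨f, w⟩` and this is the hypothesis; in general `w` is approximated by `(λ - L) f`. -/
theorem sq_inner_le_laplace [CompleteSpace H] {ι : V →ₗ[ℝ] H} {L : Module.End ℝ V}
    (hdiss : ∀ f, inner ℝ (ι f) (ι (L f)) ≤ 0) {ρ : ℝ} (hρ : 0 < ρ)
    (han : ∀ f, ∃ C, 0 ≤ C ∧ ∀ n, ‖ι ((L ^ n) f)‖ ≤ C * ρ ^ n * n.factorial)
    {y : ℝ → V →ₗ[ℝ] ℝ}
    (hy : ∀ f t, 0 ≤ t → HasDerivWithinAt (fun s => y s f) (y t (L f)) (Set.Ici 0) t)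
    (hyan : ∀ T, 0 ≤ T → ∃ ρ', 0 < ρ' ∧ ∀ f, ∃ C, 0 ≤ C ∧ ∀ t, 0 ≤ t → t ≤ T → ∀ n : ℕ,
      |y t ((L ^ n) f)| ≤ C * ρ' ^ n * n.factorial)
    {w : V} (hy0 : ∀ f, y 0 f = inner ℝ (ι f) (ι w))
    {lam : ℝ} (hlam : 0 < lam) {h : H} {K : ℝ}
    (hK : ∀ f, inner ℝ (ι (lam • f - L f)) h ^ 2 ≤ K * inner ℝ (ι f) (ι (lam • f - L f))) :
    inner ℝ (ι w) h ^ 2 ≤ K * ∫ s in Set.Ioi (0 : ℝ), Real.exp (-lam * s) * y s w := by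
  have hcontr : ∀ t, 0 ≤ t → ∀ f, |y t f| ≤ ‖ι f‖ * ‖ι w‖ := fun t ht f =>
    abs_functional_le hdiss hρ han hy hyan hy0 ht f
  have hcont : ∀ f, ContinuousOn (fun s => y s f) (Set.Ici 0) := fun f t ht =>
    (hy f t ht).continuousWithinAt
  have hexp : IntegrableOn (fun s : ℝ => Real.exp (-lam * s)) (Set.Ioi 0) :=
    integrableOn_exp_mul_Ioi (by linarith) 0
  have hexpval : ∫ s in Set.Ioi (0 : ℝ), Real.exp (-lam * s) = 1 / lam := by
    rw [integral_exp_mul_Ioi (by linarith)]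
    simp [neg_div_neg_eq]
  have hint : ∀ f, IntegrableOn (fun s => Real.exp (-lam * s) * y s f) (Set.Ioi 0) := fun f => by
    refine Integrable.mono' (hexp.mul_const (‖ι f‖ * ‖ι w‖)) ?_ ?_
    · exact (((Real.continuous_exp.comp (continuous_const.mul continuous_id)).continuousOn).mul
        ((hcont f).mono Set.Ioi_subset_Ici_self)).aestronglyMeasurable measurableSet_Ioi
    · refine (ae_restrict_iff' measurableSet_Ioi).2 (Eventually.of_forall fun s hs => ?_)
      rw [norm_mul, Real.norm_eq_abs, Real.abs_exp]
      exact mul_le_mul_of_nonneg_left (hcontr s (le_of_lt hs) f) (Real.exp_pos _).le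
  set G : V → ℝ := fun f => ∫ s in Set.Ioi (0 : ℝ), Real.exp (-lam * s) * y s f with hG
  have hGsub : ∀ f g, G f - G g = G (f - g) := fun f g => by
    simp only [hG]
    rw [← integral_sub (hint f) (hint g)]
    simp only [map_sub, mul_sub]
  have hGle : ∀ f, |G f| ≤ ‖ι f‖ * ‖ι w‖ / lam := fun f => by
    have h1 : ‖∫ s in Set.Ioi (0 : ℝ), Real.exp (-lam * s) * y s f‖ ≤
        ∫ s in Set.Ioi (0 : ℝ), Real.exp (-lam * s) * (‖ι f‖ * ‖ι w‖) := by
      refine norm_integral_le_of_norm_le (hexp.mul_const _) ?_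
      refine (ae_restrict_iff' measurableSet_Ioi).2 (Eventually.of_forall fun s hs => ?_)
      rw [norm_mul, Real.norm_eq_abs, Real.abs_exp]
      exact mul_le_mul_of_nonneg_left (hcontr s (le_of_lt hs) f) (Real.exp_pos _).le
    rw [integral_mul_const, hexpval] at h1
    refine h1.trans (le_of_eq ?_)
    ring
  have hGres : ∀ f, G (lam • f - L f) = inner ℝ (ι f) (ι w) := fun f => by
    have h1 := integral_Ioi_of_hasDerivAt_of_tendsto (a := 0) (m := 0)
      (f := fun s => -(Real.exp (-lam * s) * y s f))
      (f' := fun s => Real.exp (-lam * s) * y s (lam • f - L f)) ?_ ?_ (hint _) ?_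
    · simp only [hG]
      rw [h1, ← hy0]
      simp
    · refine ((Real.continuous_exp.comp (continuous_const.mul continuous_id)).continuousWithinAt.mul
        (hcont f 0 Set.self_mem_Ici)).neg
    · intro s hs
      have h2 : HasDerivAt (fun s => y s f) (y s (L f)) s :=
        (hy f s (le_of_lt hs)).hasDerivAt (Ici_mem_nhds hs)
      have h3 : HasDerivAt (fun s => Real.exp (-lam * s)) (Real.exp (-lam * s) * (-lam)) s := by
        have := ((hasDerivAt_id s).const_mul (-lam)).exp
        simpa using this
      refine (h3.mul h2).neg.congr_deriv ?_
      rw [map_sub, map_smul, smul_eq_mul]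
      ring
    · have h2 : Tendsto (fun s : ℝ => Real.exp (-lam * s) * (‖ι f‖ * ‖ι w‖)) atTop (𝓝 0) := by
        have h3 : Tendsto (fun s : ℝ => -lam * s) atTop atBot :=
          tendsto_id.const_mul_atTop_of_neg (by linarith)
        have := (Real.tendsto_exp_atBot.comp h3).mul_const (‖ι f‖ * ‖ι w‖)
        simpa using this
      refine squeeze_zero_norm' ?_ h2
      filter_upwards [eventually_ge_atTop 0] with s hs
      rw [norm_neg, norm_mul, Real.norm_eq_abs, Real.abs_exp]
      exact mul_le_mul_of_nonneg_left (hcontr s hs f) (Real.exp_pos _).le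
  choose f hf using fun n : ℕ => exists_norm_resolvent_sub_lt hdiss hρ han hlam w
    (ε := 1 / ((n : ℝ) + 1)) (by positivity)
  set a : ℕ → V := fun n => lam • f n - L (f n) with ha
  have hδ : Tendsto (fun n => ‖ι (a n) - ι w‖) atTop (𝓝 0) :=
    squeeze_zero (fun _ => norm_nonneg _) (fun n => (hf n).le)
      tendsto_one_div_add_atTop_nhds_zero_nat
  have haw : Tendsto (fun n => ι (a n)) atTop (𝓝 (ι w)) := tendsto_iff_norm_sub_tendsto_zero.2 hδ
  have hfn : ∀ n, ‖ι (f n)‖ ≤ (‖ι w‖ + 1) / lam := fun n => by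
    have h1 : lam * ‖ι (f n)‖ ^ 2 ≤ ‖ι (f n)‖ * ‖ι (a n)‖ := by
      have h2 := real_inner_le_norm (ι (f n)) (ι (a n))
      have h3 : inner ℝ (ι (f n)) (ι (a n)) = lam * ‖ι (f n)‖ ^ 2 -
          inner ℝ (ι (f n)) (ι (L (f n))) := by
        rw [ha, map_sub, map_smul, inner_sub_right, inner_smul_right, real_inner_self_eq_norm_sq]
      have := hdiss (f n)
      linarith
    have h4 : ‖ι (a n)‖ ≤ ‖ι w‖ + 1 := by
      have h5 : ‖ι (a n) - ι w‖ ≤ 1 := (hf n).le.trans (by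
        rw [div_le_one (by positivity)]
        linarith [n.cast_nonneg (α := ℝ)])
      have := norm_sub_norm_le (ι (a n)) (ι w)
      linarith
    rw [le_div_iff₀ hlam]
    rcases (norm_nonneg (ι (f n))).eq_or_lt with h5 | h5
    · rw [← h5, zero_mul]; positivity
    · have : ‖ι (f n)‖ * (‖ι (f n)‖ * lam) ≤ ‖ι (f n)‖ * ‖ι (a n)‖ := by linarith
      exact (le_of_mul_le_mul_left this h5).trans h4
  have hlim1 : Tendsto (fun n => inner ℝ (ι (a n)) h ^ 2) atTop (𝓝 (inner ℝ (ι w) h ^ 2)) :=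
    (haw.inner tendsto_const_nhds).pow 2
  have hlim2 : Tendsto (fun n => inner ℝ (ι (f n)) (ι (a n))) atTop (𝓝 (G w)) := by
    have h1 : Tendsto (fun n => ‖ι (a n) - ι w‖ * (‖ι w‖ / lam + (‖ι w‖ + 1) / lam)) atTop (𝓝 0) := by
      simpa using hδ.mul_const (‖ι w‖ / lam + (‖ι w‖ + 1) / lam)
    refine tendsto_iff_norm_sub_tendsto_zero.2 (squeeze_zero (fun _ => norm_nonneg _)
      (fun n => ?_) h1)
    have h2 : inner ℝ (ι (f n)) (ι (a n)) - G w =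
        G (a n - w) + inner ℝ (ι (f n)) (ι (a n) - ι w) := by
      rw [← hGsub, ha, hGres, inner_sub_right]; ring
    rw [h2]
    refine (norm_add_le _ _).trans ?_
    have h3 := hGle (a n - w)
    rw [map_sub] at h3
    have h4 := abs_real_inner_le_norm (ι (f n)) (ι (a n) - ι w)
    have h5 : ‖ι (f n)‖ * ‖ι (a n) - ι w‖ ≤ (‖ι w‖ + 1) / lam * ‖ι (a n) - ι w‖ := by
      gcongr
      exact hfn n
    rw [Real.norm_eq_abs, Real.norm_eq_abs]
    calc _ ≤ ‖ι (a n) - ι w‖ * ‖ι w‖ / lam + (‖ι w‖ + 1) / lam * ‖ι (a n) - ι w‖ :=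
          add_le_add h3 (h4.trans h5)
      _ = _ := by ring
  exact le_of_tendsto_of_tendsto' hlim1 (hlim2.const_mul K) fun n => hK (f n)

end Resolvent

/-! ### Symmetries and decay of the two-time correlations -/

section Family

variable {d : ℕ}

lemma abs_ev_le {u : Finset (Site d) → ℝ} {c : ℝ} (hu : ∀ A, |u A| ≤ c) (f : WalshSpace d) :
    |ev u f| ≤ c * ∑ A ∈ f.support, |f A| := by
  simp only [ev, Finsupp.linearCombination_apply, Finsupp.sum, Finset.mul_sum]
  refine (Finset.abs_sum_le_sum_abs _ _).trans (Finset.sum_le_sum fun A _ => ?_)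
  rw [smul_eq_mul, abs_mul, mul_comm]
  exact mul_le_mul_of_nonneg_right (hu A) (abs_nonneg _)

lemma ev_comm (U : Finset (Site d) → Finset (Site d) → ℝ) (f g : WalshSpace d) :
    ev (fun A => ev (fun B => U A B) f) g = ev (fun B => ev (fun A => U A B) g) f := by
  simp only [ev, Finsupp.linearCombination_apply, Finsupp.sum, smul_eq_mul, Finset.mul_sum]
  rw [Finset.sum_comm]
  exact Finset.sum_congr rfl fun _ _ => Finset.sum_congr rfl fun _ _ => by ring

lemma pow_len_add_le {a : ℝ} (ha : 0 < a) (ha1 : a ≤ 1) (x z : Site d) :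
    a ^ len (x + z) ≤ a⁻¹ ^ len z * a ^ len x := by
  have h1 : len x ≤ len (x + z) + len z := by
    have := len_add_le (x + z) (-z)
    rwa [len_neg, add_neg_cancel_right] at this
  have h2 : a ^ (len (x + z) + len z) ≤ a ^ len x := pow_le_pow_of_le_one ha.le ha1 h1
  rw [inv_pow, inv_mul_eq_div, le_div_iff₀ (by positivity), ← pow_add]
  exact h2

variable [NeZero d]

lemma IsSolution.sub {u v : ℝ → Finset (Site d) → ℝ} (hu : IsSolution u) (hv : IsSolution v) :
    IsSolution fun t A => u t A - v t A := fun A t ht => by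
  rw [ev_sub]
  exact (hu A t ht).sub (hv A t ht)

lemma IsSolution.vadd {u : ℝ → Finset (Site d) → ℝ} (hu : IsSolution u) (z : Site d) :
    IsSolution fun t A => u t (z +ᵥ A) := fun A t ht => by
  rw [← ev_row_vadd]
  exact hu _ t ht

/-- Solutions of moderate growth are determined by their initial values. -/
lemma IsSolution.ext {u v : ℝ → Finset (Site d) → ℝ} (hu : IsSolution u) (hv : IsSolution v)
    (h0 : ∀ A, u 0 A = v 0 A) {C K : ℝ} (hC : 0 ≤ C) (hK : 1 ≤ K)
    (hub : ∀ t, 0 ≤ t → ∀ A, |u t A| ≤ C * K ^ A.card)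
    (hvb : ∀ t, 0 ≤ t → ∀ A, |v t A| ≤ C * K ^ A.card) {t : ℝ} (ht : 0 ≤ t) (A : Finset (Site d)) :
    u t A = v t A := by
  refine sub_eq_zero.1 ((hu.sub hv).eq_zero (T := t) (C := 2 * C) (K := K)
    (fun A => sub_eq_zero.2 (h0 A)) (by positivity) hK (fun s hs _ A => ?_) ht le_rfl A)
  refine (abs_sub _ _).trans ?_
  linarith [hub s hs A, hvb s hs A]

/-- The analytic properties of the two-time correlations `U B t A = E[σ_A(t) σ_B(0)]` of the Walsh
functions `σ_A`. -/
structure IsCorrelation (U : Finset (Site d) → ℝ → Finset (Site d) → ℝ) : Prop where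
  isSolution : ∀ B, IsSolution (U B)
  abs_le : ∀ B t A, |U B t A| ≤ 1
  zero : ∀ B A, U B 0 A = if A = B then 1 else 0

lemma isCorrelation_twoTime {Ω : Type*} [MeasurableSpace Ω] {P : Measure Ω} [IsProbabilityMeasure P]
    {𝓕 : Filtration ℝ≥0 ‹MeasurableSpace Ω›} {X : ℝ≥0 → Ω → Config d} {p : Site d → ℝ}
    (hp : IsDriftLaw p) (hX : IsEquilibriumExclusion p halfDensity P 𝓕 X) :
    IsCorrelation (twoTime P X) :=
  ⟨isSolution_twoTime hp hX, abs_twoTime_le, fun B A => twoTime_zero hX A B⟩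

variable {U : Finset (Site d) → ℝ → Finset (Site d) → ℝ}

lemma IsCorrelation.vadd (hU : IsCorrelation U) (z : Site d) (B : Finset (Site d)) {t : ℝ}
    (ht : 0 ≤ t) (A : Finset (Site d)) : U (z +ᵥ B) t (z +ᵥ A) = U B t A := by
  refine ((hU.isSolution (z +ᵥ B)).vadd z).ext (hU.isSolution B) (C := 1) (K := 1) (fun A => ?_)
    (by norm_num) le_rfl (fun t _ A => by simpa using hU.abs_le _ _ _)
    (fun t _ A => by simpa using hU.abs_le _ _ _) ht A
  simp [hU.zero]

lemma row_empty (ε : ℝ) : row ε (∅ : Finset (Site d)) = 0 := by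
  simp [row, bondSites, driftSites]

/-- Correlations with the constant function: a Walsh function other than the constant one has mean
`0` at all times, which is the stationarity of the Bernoulli measure. The rows of the generator have no
entry at the empty set, as the adjoint annihilates the constants. -/
lemma IsCorrelation.empty (hU : IsCorrelation U) {t : ℝ} (ht : 0 ≤ t) (A : Finset (Site d)) :
    U ∅ t A = if A = ∅ then 1 else 0 := by
  refine (hU.isSolution ∅).ext (v := fun _ A => if A = ∅ then 1 else 0) (C := 1) (K := 1)
    (fun A t _ => ?_) (hU.zero ∅)
    (by norm_num) le_rfl (fun t _ A => by simpa using hU.abs_le _ _ _)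
    (fun t _ A => by split_ifs <;> simp) ht A
  rw [ev_ite_eq, row_apply_comm, row_empty]
  exact hasDerivWithinAt_const _ _ _

/-- The backward equation: the generator acting on the later argument equals its adjoint acting on
the earlier one. Both sides solve the forward equation in `A`, with the same initial values. -/
lemma IsCorrelation.backward (hU : IsCorrelation U) {t : ℝ} (ht : 0 ≤ t) (A B : Finset (Site d)) :
    ev (U B t) (row 1 A) = ev (fun C => U C t A) (row (-1) B) := by
  have hcard : ∀ A : Finset (Site d), (A.card : ℝ) ≤ 2 ^ A.card := fun A => by
    exact_mod_cast Nat.lt_two_pow_self.le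
  set K : ℝ := ∑ A ∈ (row (-1) B).support, |row (-1) B A| with hK
  have hK0 : 0 ≤ K := Finset.sum_nonneg fun _ _ => abs_nonneg _
  refine IsSolution.ext (u := fun t A => ev (U B t) (row 1 A))
    (v := fun t A => ev (fun C => U C t A) (row (-1) B)) (C := 2 * d + 1 + K) (K := 2)
    (fun A t ht => ?_) (fun A t ht => ?_) (fun A => ?_) (by positivity)
    (by norm_num) (fun t _ A => ?_) (fun t _ A => ?_) ht A
  · exact ((hU.isSolution B).hasDerivWithinAt_ev (row 1 A) t ht).congr_deriv (ev_gen _ _)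
  · rw [ev_comm]
    simp only [ev, Finsupp.linearCombination_apply, Finsupp.sum, smul_eq_mul]
    refine HasDerivWithinAt.fun_sum fun C _ => ((hU.isSolution C A t ht).const_mul _).congr_deriv ?_
    simp [ev, Finsupp.linearCombination_apply, Finsupp.sum]
  · have h1 : U B 0 = fun A => if A = B then 1 else 0 := funext fun A => hU.zero B A
    have h2 : (fun C => U C 0 A) = fun C => if C = A then 1 else 0 :=
      funext fun C => by rw [hU.zero]; simp only [eq_comm]
    rw [h1, h2, ev_ite_eq, ev_ite_eq, row_apply_comm]
  · have h1 := seminorm_row_le (G := 1) (isWeight_pow (d := d) (C := 1) (K := 1) (by norm_num) le_rfl)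
      zero_le_one (absSeminorm (ev (U B t))) A (fun C _ => by
        rw [absSeminorm_apply, ev_single]
        simpa using hU.abs_le B t C)
    rw [absSeminorm_apply] at h1
    simp only [one_pow, mul_one] at h1
    refine h1.trans (mul_le_mul ?_ (hcard A) (by positivity) (by positivity))
    linarith
  · refine (abs_ev_le (fun C => hU.abs_le C t A) _).trans ?_
    rw [one_mul, ← hK]
    have h1 : (1 : ℝ) ≤ 2 ^ A.card := one_le_pow₀ (by norm_num)
    have h2 : (0 : ℝ) ≤ 2 * d + 1 := by positivity
    calc K ≤ (2 * d + 1 + K) * 1 := by linarith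
      _ ≤ _ := by gcongr

end Family

section Moments

variable {d : ℕ}

lemma summable_pow_len {a : ℝ} (ha : 0 < a) (ha1 : a < 1) :
    Summable fun x : Site d => a ^ len x := by
  have hZ : Summable fun m : ℤ => a ^ m.natAbs := by
    refine Summable.of_nat_of_neg ?_ ?_ <;>
    simpa using summable_geometric_of_lt_one ha.le ha1
  refine summable_of_sum_le (c := ∏ _i : Fin d, ∑' m : ℤ, a ^ m.natAbs) (fun x => by positivity)
    fun s => ?_
  have hs : s ⊆ Fintype.piFinset fun i => s.image fun x => x i := fun x hx => by
    rw [Fintype.mem_piFinset]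
    exact fun i => Finset.mem_image_of_mem _ hx
  refine (Finset.sum_le_sum_of_subset_of_nonneg hs fun _ _ _ => by positivity).trans ?_
  have h1 : ∀ x : Site d, a ^ len x = ∏ i, a ^ (x i).natAbs := fun x => by
    rw [len, Finset.prod_pow_eq_pow_sum]
  simp only [h1]
  rw [← Finset.prod_univ_sum (t := fun i => s.image fun x => x i)
    (f := fun (_ : Fin d) (m : ℤ) => a ^ m.natAbs)]
  exact Finset.prod_le_prod (fun _ _ => by positivity) fun i _ =>
    hZ.sum_le_tsum _ fun _ _ => by positivity

lemma summable_len_pow_mul (k : ℕ) {a : ℝ} (ha : 0 < a) (ha1 : a < 1) :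
    Summable fun x : Site d => (1 + len x : ℝ) ^ k * a ^ len x := by
  set b := Real.sqrt a with hb
  have hb0 : 0 < b := Real.sqrt_pos.2 ha
  have hb1 : b < 1 := by rw [hb, Real.sqrt_lt' one_pos]; simpa using ha1
  have hab : a = b * b := (Real.mul_self_sqrt ha.le).symm
  have h1 : Summable fun n : ℕ => (n : ℝ) ^ k * b ^ n :=
    summable_pow_mul_geometric_of_norm_lt_one k (by rwa [Real.norm_of_nonneg hb0.le])
  refine Summable.of_nonneg_of_le (fun x => by positivity) (fun x => ?_)
    ((summable_pow_len (d := d) hb0 hb1).mul_left (b⁻¹ * ∑' n : ℕ, (n : ℝ) ^ k * b ^ n))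
  have h2 := h1.le_tsum (len x + 1) fun _ _ => by positivity
  push_cast at h2
  clear_value b
  subst hab
  calc (1 + len x : ℝ) ^ k * (b * b) ^ len x
      = b⁻¹ * ((len x + 1 : ℝ) ^ k * b ^ (len x + 1)) * b ^ len x := by
        rw [mul_pow, pow_succ, add_comm]; field_simp
    _ ≤ _ := by gcongr

lemma abs_coord_le (x : Site d) (i : Fin d) : |(x i : ℝ)| ≤ 1 + len x := by
  have h1 : (x i).natAbs ≤ len x :=
    Finset.single_le_sum (f := fun i => (x i).natAbs) (fun _ _ => Nat.zero_le _) (Finset.mem_univ i)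
  have h2 : |(x i : ℝ)| = (x i).natAbs := by simp
  rw [h2]
  have : ((x i).natAbs : ℝ) ≤ len x := by exact_mod_cast h1
  linarith

/-- Termwise differentiation of a series of functions on the half-line, with derivatives dominated
locally uniformly. -/
lemma hasDerivWithinAt_tsum_Ici {ι : Type*} {g g' : ι → ℝ → ℝ} {T : ℝ} {b : ι → ℝ}
    (hb : Summable b) (hg : ∀ i t, 0 ≤ t → HasDerivWithinAt (g i) (g' i t) (Set.Ici 0) t)
    (hgb : ∀ i t, 0 ≤ t → t ≤ T → |g i t| ≤ b i) (hgb' : ∀ i t, 0 ≤ t → t ≤ T → |g' i t| ≤ b i)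
    {t : ℝ} (ht : 0 ≤ t) (htT : t < T) :
    HasDerivWithinAt (fun s => ∑' i, g i s) (∑' i, g' i t) (Set.Ici 0) t := by
  have hs : ∀ s, 0 ≤ s → s ≤ T → Summable fun i => g i s := fun s h0 hT =>
    Summable.of_norm_bounded hb fun i => hgb i s h0 hT
  have hev : ∀ᶠ s in 𝓝[Set.Ici 0 \ {t}] t, 0 ≤ s ∧ s ≤ T := by
    have h1 : ∀ᶠ s in 𝓝[Set.Ici 0 \ {t}] t, s ∈ Set.Ici (0 : ℝ) \ {t} := self_mem_nhdsWithin
    have h2 : ∀ᶠ s in 𝓝[Set.Ici 0 \ {t}] t, s < T :=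
      mem_nhdsWithin_of_mem_nhds (Iio_mem_nhds htT)
    filter_upwards [h1, h2] with s h3 h4
    exact ⟨h3.1, h4.le⟩
  rw [hasDerivWithinAt_iff_tendsto_slope]
  have h1 : Tendsto (fun s => ∑' i, slope (g i) t s) (𝓝[Set.Ici 0 \ {t}] t)
      (𝓝 (∑' i, g' i t)) := by
    refine tendsto_tsum_of_dominated_convergence hb
      (fun i => (hasDerivWithinAt_iff_tendsto_slope.1 (hg i t ht))) ?_
    filter_upwards [hev] with s hs i
    have h2 := (convex_Icc (0 : ℝ) T).norm_image_sub_le_of_norm_hasDerivWithin_le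
      (f := g i) (f' := g' i) (C := b i) (x := t) (y := s)
      (fun r hr => (hg i r hr.1).mono Set.Icc_subset_Ici_self)
      (fun r hr => hgb' i r hr.1 hr.2) ⟨ht, htT.le⟩ hs
    rw [slope_def_field, norm_div]
    refine div_le_of_le_mul₀ (norm_nonneg _) ((abs_nonneg _).trans (hgb i t ht htT.le)) h2
  refine h1.congr' ?_
  filter_upwards [hev] with s hs'
  rw [slope_def_field, ← (hs s hs'.1 hs'.2).tsum_sub (hs t ht htT.le), ← tsum_div_const]
  exact tsum_congr fun i => slope_def_field _ _ _

variable [NeZero d] {U : Finset (Site d) → ℝ → Finset (Site d) → ℝ}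

/-- The initial values `1_{A = B}` decay exponentially because `B` contains a site. -/
lemma IsCorrelation.exists_decay (hU : IsCorrelation U) {B : Finset (Site d)} (hB : B.Nonempty)
    {T : ℝ} (hT : 0 ≤ T) :
    ∃ M a : ℝ, 1 ≤ M ∧ 0 < a ∧ a < 1 ∧
      ∀ t, 0 ≤ t → t ≤ T → ∀ A, |U B t A| ≤ decayWeight M a A := by
  obtain ⟨z, hz⟩ := hB
  have h2 : (1 : ℝ) ≤ 2 ^ len z := one_le_pow₀ (by norm_num)
  refine (hU.isSolution B).exists_decay (hU.abs_le B) (M₀ := 2 ^ len z) (a₀ := 1 / 2)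
    h2 (by norm_num) (by norm_num) (fun A => ?_) hT
  rw [hU.zero]
  split_ifs with h
  · subst h
    rw [abs_one]
    have h3 : (2 : ℝ) ^ len z ≤ (2 ^ len z) ^ A.card :=
      le_self_pow₀ h2 (Finset.card_pos.2 ⟨z, hz⟩).ne'
    have h4 : (1 / 2 : ℝ) ^ len z ≤ ∑ w ∈ A, (1 / 2 : ℝ) ^ len w :=
      Finset.single_le_sum (f := fun w => (1 / 2 : ℝ) ^ len w) (fun _ _ => by positivity) hz
    calc (1 : ℝ) = 2 ^ len z * (1 / 2) ^ len z := by rw [← mul_pow]; norm_num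
      _ ≤ _ := mul_le_mul h3 h4 (by positivity) (by positivity)
  · rw [abs_zero]
    exact decayWeight_nonneg (by positivity) (by norm_num) A

/-- The translates of a set decorrelate exponentially fast, locally uniformly in time. -/
lemma IsCorrelation.exists_abs_vadd_le (hU : IsCorrelation U) {B : Finset (Site d)}
    (hB : B.Nonempty) {T : ℝ} (hT : 0 ≤ T) :
    ∃ a : ℝ, 0 < a ∧ a < 1 ∧ ∃ K : Finset (Site d) → ℝ,
      ∀ t, 0 ≤ t → t ≤ T → ∀ (x : Site d) A, |U B t (x +ᵥ A)| ≤ K A * a ^ len x := by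
  obtain ⟨M, a, hM, ha, ha1, h⟩ := hU.exists_decay hB hT
  refine ⟨a, ha, ha1, fun A => M ^ A.card * ∑ z ∈ A, a⁻¹ ^ len z, fun t ht htT x A =>
    (h t ht htT _).trans ?_⟩
  rw [decayWeight, Finset.card_vadd_finset, mul_assoc, Finset.sum_mul]
  gcongr
  rw [Finset.vadd_finset_def, Finset.sum_image fun y _ z _ h => by simpa using h]
  exact Finset.sum_le_sum fun z _ => pow_len_add_le ha ha1.le x z

/-- The moments `∑_x x_0^k U B t (x + A)` along the direction of the drift. -/
def moment (U : Finset (Site d) → ℝ → Finset (Site d) → ℝ) (B : Finset (Site d)) (k : ℕ) (t : ℝ)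
    (A : Finset (Site d)) : ℝ :=
  ∑' x : Site d, (x 0 : ℝ) ^ k * U B t (x +ᵥ A)

lemma abs_coord_pow_mul_le {a K r : ℝ} (k : ℕ) {x : Site d} (h : |r| ≤ K * a ^ len x) :
    |(x 0 : ℝ) ^ k * r| ≤ K * ((1 + len x : ℝ) ^ k * a ^ len x) := by
  rw [abs_mul, abs_pow]
  calc |(x 0 : ℝ)| ^ k * |r| ≤ (1 + len x : ℝ) ^ k * (K * a ^ len x) := by
        gcongr
        exact abs_coord_le x 0
    _ = _ := by ring

lemma IsCorrelation.summable_moment (hU : IsCorrelation U) {B : Finset (Site d)} (hB : B.Nonempty)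
    (k : ℕ) {t : ℝ} (ht : 0 ≤ t) (A : Finset (Site d)) :
    Summable fun x : Site d => (x 0 : ℝ) ^ k * U B t (x +ᵥ A) := by
  obtain ⟨a, ha, ha1, K, hK⟩ := hU.exists_abs_vadd_le hB ht
  exact Summable.of_norm_bounded ((summable_len_pow_mul k ha ha1).mul_left (K A)) fun x =>
    abs_coord_pow_mul_le k (hK t ht le_rfl x A)

lemma IsCorrelation.ev_moment (hU : IsCorrelation U) {B : Finset (Site d)} (hB : B.Nonempty)
    (k : ℕ) {t : ℝ} (ht : 0 ≤ t) (f : WalshSpace d) :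
    ev (moment U B k t) f = ∑' x : Site d, (x 0 : ℝ) ^ k * ev (fun A => U B t (x +ᵥ A)) f := by
  simp only [ev, Finsupp.linearCombination_apply, Finsupp.sum, smul_eq_mul, moment,
    Finset.mul_sum]
  rw [Summable.tsum_finsetSum fun A _ => ?_]
  · refine Finset.sum_congr rfl fun A _ => ?_
    rw [← tsum_mul_left]
    exact tsum_congr fun x => by ring
  · refine ((hU.summable_moment hB k ht A).mul_left (f A)).congr fun x => ?_
    ring

/-- The moments evolve according to the same equation. -/
lemma IsCorrelation.isSolution_moment (hU : IsCorrelation U) {B : Finset (Site d)}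
    (hB : B.Nonempty) (k : ℕ) : IsSolution (moment U B k) := by
  intro A t ht
  rw [hU.ev_moment hB k ht]
  obtain ⟨a, ha, ha1, K, hK⟩ := hU.exists_abs_vadd_le hB (T := t + 1) (by linarith)
  set K' : ℝ := |K A| + ∑ C ∈ (row 1 A).support, |row 1 A C| * K C with hK'
  have hKnn : ∀ C, 0 ≤ K C := fun C => by
    have := (abs_nonneg _).trans (hK 0 le_rfl (by linarith) 0 C)
    exact nonneg_of_mul_nonneg_left this (by positivity)
  have hev : ∀ (x : Site d) (s : ℝ), 0 ≤ s → s ≤ t + 1 →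
      |ev (fun C => U B s (x +ᵥ C)) (row 1 A)| ≤ K' * a ^ len x := by
    intro x s hs hst
    simp only [ev, Finsupp.linearCombination_apply, Finsupp.sum, smul_eq_mul]
    refine (Finset.abs_sum_le_sum_abs _ _).trans ?_
    rw [hK', add_mul, Finset.sum_mul]
    refine le_add_of_nonneg_of_le (by positivity) (Finset.sum_le_sum fun C _ => ?_)
    rw [abs_mul, mul_assoc]
    exact mul_le_mul_of_nonneg_left (hK s hs hst x C) (abs_nonneg _)
  refine hasDerivWithinAt_tsum_Ici (T := t + 1)
    (g := fun (x : Site d) t => (x 0 : ℝ) ^ k * U B t (x +ᵥ A))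
    (g' := fun (x : Site d) t => (x 0 : ℝ) ^ k * ev (fun A => U B t (x +ᵥ A)) (row 1 A))
    ((summable_len_pow_mul k ha ha1).mul_left K') (fun x s hs => ?_) (fun x s hs hst => ?_)
    (fun x s hs hst => ?_) ht (by linarith)
  · exact ((hU.isSolution B).vadd x A s hs).const_mul _
  · refine abs_coord_pow_mul_le k ((hK s hs hst x A).trans ?_)
    gcongr
    rw [hK', abs_of_nonneg (hKnn A)]
    exact le_add_of_nonneg_right (Finset.sum_nonneg fun C _ => mul_nonneg (abs_nonneg _) (hKnn C))
  · exact abs_coord_pow_mul_le k (hev x s hs hst)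

lemma moment_vadd (B : Finset (Site d)) (k : ℕ) (t : ℝ) (z : Site d) (A : Finset (Site d)) :
    moment U B k t (z +ᵥ A) = ∑' x : Site d, (x 0 - z 0 : ℝ) ^ k * U B t (x +ᵥ A) := by
  rw [← (Equiv.addRight z).tsum_eq]
  refine tsum_congr fun x => ?_
  simp [vadd_vadd]

lemma IsCorrelation.moment_vadd_left (hU : IsCorrelation U) (B : Finset (Site d)) (k : ℕ) {t : ℝ}
    (ht : 0 ≤ t) (z : Site d) (A : Finset (Site d)) :
    moment U (z +ᵥ B) k t A = moment U B k t (-z +ᵥ A) := by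
  refine tsum_congr fun x => ?_
  rw [← hU.vadd z B ht, vadd_vadd, vadd_vadd]
  congr 3
  abel

lemma moment_zero_vadd (B : Finset (Site d)) (t : ℝ) (z : Site d) (A : Finset (Site d)) :
    moment U B 0 t (z +ᵥ A) = moment U B 0 t A := by
  rw [moment_vadd]; simp [moment]

lemma IsCorrelation.moment_one_vadd (hU : IsCorrelation U) {B : Finset (Site d)}
    (hB : B.Nonempty) {t : ℝ} (ht : 0 ≤ t) (z : Site d) (A : Finset (Site d)) :
    moment U B 1 t (z +ᵥ A) = moment U B 1 t A - z 0 * moment U B 0 t A := by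
  rw [moment_vadd, moment, moment, ← tsum_mul_left, ← (hU.summable_moment hB 1 ht A).tsum_sub
    ((hU.summable_moment hB 0 ht A).mul_left _)]
  exact tsum_congr fun x => by ring

lemma IsCorrelation.moment_two_vadd (hU : IsCorrelation U) {B : Finset (Site d)}
    (hB : B.Nonempty) {t : ℝ} (ht : 0 ≤ t) (z : Site d) (A : Finset (Site d)) :
    moment U B 2 t (z +ᵥ A) =
      moment U B 2 t A - 2 * z 0 * moment U B 1 t A + (z 0 : ℝ) ^ 2 * moment U B 0 t A := by
  rw [moment_vadd, moment, moment, moment, ← tsum_mul_left, ← tsum_mul_left,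
    ← (hU.summable_moment hB 2 ht A).tsum_sub ((hU.summable_moment hB 1 ht A).mul_left _),
    ← Summable.tsum_add ((hU.summable_moment hB 2 ht A).sub
      ((hU.summable_moment hB 1 ht A).mul_left _)) ((hU.summable_moment hB 0 ht A).mul_left _)]
  exact tsum_congr fun x => by ring

end Moments

/-! ### The Green–Kubo formula -/

section GreenKubo

variable {d : ℕ}

lemma unitVec_ne_zero (i : Fin d) : (unitVec i : Site d) ≠ 0 := by simp [unitVec]

lemma unitVec_ne_neg (i : Fin d) : (unitVec i : Site d) ≠ -unitVec i := by
  intro h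
  have := congrFun h i
  simp [unitVec] at this

lemma vadd_singleton_zero (x : Site d) : x +ᵥ ({0} : Finset (Site d)) = {x} := by
  ext z; simp

lemma vadd_singleton_zero_eq {x : Site d} (h : x +ᵥ ({0} : Finset (Site d)) = {0}) : x = 0 := by
  simpa using h

variable [NeZero d]

/-- The two sites which are exchanged by a jump in the direction of the drift. -/
def driftBond : Finset (Site d) := {0, unitVec 0}

lemma driftBond_nonempty : (driftBond : Finset (Site d)).Nonempty := ⟨0, by simp [driftBond]⟩

/-- The generator on a single spin: half the lattice Laplacian, and the discrete gradient of the
current through the bond along the drift. -/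
lemma ev_row_singleton (u : Finset (Site d) → ℝ) (ε : ℝ) :
    ev u (row ε {0}) = ∑ i : Fin d,
        (1 / 2 : ℝ) * (u ((unitVec i : Site d) +ᵥ ({0} : Finset (Site d))) +
          u ((-unitVec i : Site d) +ᵥ ({0} : Finset (Site d))) - 2 * u {0}) +
      (ε / 2 : ℝ) * (u driftBond - u ((-unitVec 0 : Site d) +ᵥ driftBond)) := by
  rw [ev_row_eq_sum]
  congr 1
  · refine Finset.sum_congr rfl fun i _ => ?_
    have h1 : bondSites i ({0} : Finset (Site d)) = {0, -unitVec i} := by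
      ext x; simp [bondSites]
    have h2 : (0 : Site d) ≠ -unitVec i := by simpa using unitVec_ne_zero i
    rw [h1, Finset.sum_pair h2]
    simp [swapSet]
    ring
  · have h1 : driftSites ({0} : Finset (Site d)) = {unitVec 0, -unitVec 0} := by
      ext x; simp [driftSites]
    have h2 : flip (unitVec 0) ({0} : Finset (Site d)) = driftBond := by
      rw [flip_of_notMem (by simp [unitVec_ne_zero]), driftBond, Finset.pair_comm]
    have h3 : flip (-unitVec 0) ({0} : Finset (Site d)) = (-unitVec 0 : Site d) +ᵥ driftBond := by
      rw [flip_of_notMem (by simp [unitVec_ne_zero])]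
      ext x; simp [driftBond, mem_vadd]
      constructor
      · rintro (rfl | rfl) <;> simp
      · rintro (h | h)
        · left; exact eq_neg_of_add_eq_zero_left h
        · right; exact h
    have h4 : (unitVec 0 : Site d) + unitVec 0 ≠ 0 := fun h =>
      unitVec_ne_neg 0 (eq_neg_of_add_eq_zero_left h)
    have h5 : -(unitVec 0 : Site d) - unitVec 0 ≠ 0 := fun h =>
      unitVec_ne_neg (d := d) 0 (sub_eq_zero.1 h).symm
    rw [h1, Finset.sum_pair (unitVec_ne_neg 0), h2, h3]
    simp [drift, unitVec_ne_zero, h4, h5]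
    ring

variable {U : Finset (Site d) → ℝ → Finset (Site d) → ℝ}

/-- The backward equation for the moments. -/
lemma IsCorrelation.ev_moment_row (hU : IsCorrelation U) {B : Finset (Site d)} (hB : B.Nonempty)
    (k : ℕ) {t : ℝ} (ht : 0 ≤ t) (A : Finset (Site d)) :
    ev (moment U B k t) (row 1 A) = ev (fun C => moment U C k t A) (row (-1) B) := by
  have h0 : ∀ C ∈ (row (-1) B).support, C.Nonempty := fun C hC => by
    rw [Finset.nonempty_iff_ne_empty]
    rintro rfl
    rw [Finsupp.mem_support_iff, row_apply_comm, row_empty] at hC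
    simp at hC
  rw [hU.ev_moment hB k ht]
  have h1 : ∀ x : Site d, ev (fun A => U B t (x +ᵥ A)) (row 1 A) =
      ev (fun C => U C t (x +ᵥ A)) (row (-1) B) := fun x => by
    rw [← ev_row_vadd, hU.backward ht]
  simp only [h1]
  simp only [ev, Finsupp.linearCombination_apply, Finsupp.sum, smul_eq_mul, moment,
    Finset.mul_sum]
  rw [Summable.tsum_finsetSum fun C hC => ?_]
  · refine Finset.sum_congr rfl fun C _ => ?_
    rw [← tsum_mul_left]
    exact tsum_congr fun x => by ring
  · refine ((hU.summable_moment (h0 C hC) k ht A).mul_left (row (-1) B C)).congr fun x => ?_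
    ring

lemma eq_of_hasDerivWithinAt_zero {g : ℝ → ℝ}
    (hg : ∀ t, 0 ≤ t → HasDerivWithinAt g 0 (Set.Ici 0) t) {t : ℝ} (ht : 0 ≤ t) : g t = g 0 :=
  constant_of_has_deriv_right_zero (a := 0) (b := t)
    (fun s hs => ((hg s hs.1).continuousWithinAt).mono Set.Icc_subset_Ici_self)
    (fun s hs => (hg s hs.1).mono (Set.Ici_subset_Ici.2 hs.1)) t ⟨ht, le_rfl⟩

lemma IsCorrelation.moment_at_zero (hU : IsCorrelation U) (k : ℕ) (A B : Finset (Site d))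
    (h : ∀ x : Site d, x +ᵥ A = B → x = 0) :
    moment U B k 0 A = if A = B then 0 ^ k else 0 := by
  rw [moment, tsum_eq_single 0]
  · simp [hU.zero]
  · intro x hx
    rw [hU.zero, if_neg fun h' => hx (h x h'), mul_zero]

lemma vadd_driftBond_ne (x : Site d) : x +ᵥ (driftBond : Finset (Site d)) ≠ {0} := by
  intro h
  have h1 := congrArg Finset.card h
  rw [Finset.card_vadd_finset, driftBond, Finset.card_pair (unitVec_ne_zero 0).symm] at h1
  simp at h1

/-- The derivative of a moment started from a single site, with both rows expanded: moments of
order `k` of the translates of `{0}` and of the bond. -/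
lemma IsCorrelation.hasDerivWithinAt_moment_singleton (hU : IsCorrelation U) (k : ℕ) {t : ℝ}
    (ht : 0 ≤ t) : HasDerivWithinAt (fun s => moment U {0} k s {0})
      (∑ i : Fin d, (1 / 2 : ℝ) * (moment U {0} k t ((unitVec i : Site d) +ᵥ ({0} : Finset (Site d))) +
        moment U {0} k t ((-unitVec i : Site d) +ᵥ ({0} : Finset (Site d))) - 2 * moment U {0} k t {0}) +
      (1 / 2 : ℝ) * (moment U {0} k t driftBond - moment U {0} k t ((-unitVec 0 : Site d) +ᵥ driftBond)))
      (Set.Ici 0) t := by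
  refine (hU.isSolution_moment (Finset.singleton_nonempty 0) k {0} t ht).congr_deriv ?_
  rw [ev_row_singleton]

/-- The derivative of the moments of the current, by the backward equation: the generator of the
backward equation acts on the single site at time `0`. -/
lemma IsCorrelation.hasDerivWithinAt_moment_driftBond (hU : IsCorrelation U) (k : ℕ) {t : ℝ}
    (ht : 0 ≤ t) : HasDerivWithinAt (fun s => moment U {0} k s driftBond)
      (∑ i : Fin d, (1 / 2 : ℝ) * (moment U {0} k t ((-unitVec i : Site d) +ᵥ driftBond) +
        moment U {0} k t ((unitVec i : Site d) +ᵥ driftBond) - 2 * moment U {0} k t driftBond) -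
      (1 / 2 : ℝ) * (moment U driftBond k t driftBond -
        moment U driftBond k t ((unitVec 0 : Site d) +ᵥ driftBond))) (Set.Ici 0) t := by
  refine (hU.isSolution_moment (Finset.singleton_nonempty 0) k driftBond t ht).congr_deriv ?_
  rw [hU.ev_moment_row (Finset.singleton_nonempty 0) k ht, ev_row_singleton]
  simp only [hU.moment_vadd_left _ k ht, neg_neg]
  ring

/-- The sum rule: the total density is conserved. -/
lemma IsCorrelation.moment_zero_singleton (hU : IsCorrelation U) {t : ℝ} (ht : 0 ≤ t) :
    moment U {0} 0 t {0} = 1 := by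
  have h1 := eq_of_hasDerivWithinAt_zero (g := fun s => moment U {0} 0 s {0}) (fun t ht =>
    (hU.hasDerivWithinAt_moment_singleton 0 ht).congr_deriv (by
      simp only [moment_zero_vadd]; ring_nf; simp)) ht
  refine h1.trans ?_
  rw [hU.moment_at_zero 0 _ _ fun x => vadd_singleton_zero_eq]
  simp

lemma IsCorrelation.moment_zero_driftBond (hU : IsCorrelation U) {t : ℝ} (ht : 0 ≤ t) :
    moment U {0} 0 t driftBond = 0 := by
  have h1 := eq_of_hasDerivWithinAt_zero (g := fun s => moment U {0} 0 s driftBond) (fun t ht =>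
    (hU.hasDerivWithinAt_moment_driftBond 0 ht).congr_deriv (by
      simp only [moment_zero_vadd]; ring_nf; simp)) ht
  refine h1.trans ?_
  rw [hU.moment_at_zero 0 _ _ fun x h => absurd h (vadd_driftBond_ne x)]
  simpa using vadd_driftBond_ne (0 : Site d)

/-- The mean displacement vanishes at density `1/2`. -/
lemma IsCorrelation.moment_one_singleton (hU : IsCorrelation U) {t : ℝ} (ht : 0 ≤ t) :
    moment U {0} 1 t {0} = 0 := by
  have h0 := Finset.singleton_nonempty (0 : Site d)
  have h1 := eq_of_hasDerivWithinAt_zero (g := fun s => moment U {0} 1 s {0}) (fun t ht =>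
    (hU.hasDerivWithinAt_moment_singleton 1 ht).congr_deriv (by
      simp only [hU.moment_one_vadd h0 ht, hU.moment_zero_driftBond ht, Pi.neg_apply]
      push_cast; ring_nf; simp)) ht
  refine h1.trans ?_
  rw [hU.moment_at_zero 1 _ _ fun x => vadd_singleton_zero_eq]
  simp

/-- The second moment grows with rate `1` from the symmetric jumps, corrected by the first moment of
the current. -/
lemma IsCorrelation.hasDerivWithinAt_moment_two (hU : IsCorrelation U) {t : ℝ} (ht : 0 ≤ t) :
    HasDerivWithinAt (fun s => moment U {0} 2 s {0}) (1 - moment U {0} 1 t driftBond)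
      (Set.Ici 0) t := by
  have h0 := Finset.singleton_nonempty (0 : Site d)
  refine (hU.hasDerivWithinAt_moment_singleton 2 ht).congr_deriv ?_
  simp only [hU.moment_two_vadd h0 ht, hU.moment_zero_driftBond ht, hU.moment_zero_singleton ht,
    hU.moment_one_singleton ht]
  rw [Finset.sum_eq_single (0 : Fin d)]
  · simp [unitVec]; ring
  · intro i _ hi
    simp [unitVec, hi.symm]; ring
  · simp

/-- The first moment of the current decreases with half the autocorrelation of the total current. -/
lemma IsCorrelation.hasDerivWithinAt_moment_one (hU : IsCorrelation U) {t : ℝ} (ht : 0 ≤ t) :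
    HasDerivWithinAt (fun s => moment U {0} 1 s driftBond)
      (-(1 / 2) * moment U driftBond 0 t driftBond) (Set.Ici 0) t := by
  have h0 := Finset.singleton_nonempty (0 : Site d)
  refine (hU.hasDerivWithinAt_moment_driftBond 1 ht).congr_deriv ?_
  simp only [hU.moment_one_vadd h0 ht, hU.moment_one_vadd driftBond_nonempty ht,
    hU.moment_zero_driftBond ht]
  simp [unitVec]
  right; ring

lemma IsCorrelation.moment_two_zero (hU : IsCorrelation U) : moment U {0} 2 0 {0} = 0 := by
  rw [hU.moment_at_zero 2 _ _ fun x => vadd_singleton_zero_eq]; simp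

lemma IsCorrelation.moment_one_zero (hU : IsCorrelation U) : moment U {0} 1 0 driftBond = 0 := by
  rw [hU.moment_at_zero 1 _ _ fun x h => absurd h (vadd_driftBond_ne x)]; simp

end GreenKubo

section Laplace

/-- A continuous function of polynomial growth has a Laplace transform. -/
lemma integrableOn_exp_mul {g : ℝ → ℝ} (hg : ContinuousOn g (Set.Ici 0)) {K : ℝ} {k : ℕ}
    (hb : ∀ t, 0 ≤ t → |g t| ≤ K * (1 + t) ^ k) {lam : ℝ} (hlam : 0 < lam) :
    IntegrableOn (fun t => Real.exp (-lam * t) * g t) (Set.Ioi 0) ∧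
      Tendsto (fun t => Real.exp (-lam * t) * g t) atTop (𝓝 0) := by
  have h1 : (fun t : ℝ => Real.exp (-lam * t) * g t) =O[atTop]
      fun t => Real.exp (-(lam / 2) * t) := by
    have h2 : (fun t : ℝ => (1 + t) ^ k) =O[atTop] fun t => Real.exp (lam / 2 * (1 + t)) :=
      (isLittleO_pow_exp_pos_mul_atTop k (by positivity : 0 < lam / 2)).isBigO.comp_tendsto
        (tendsto_atTop_add_const_left _ 1 tendsto_id)
    have h3 : g =O[atTop] fun t : ℝ => (1 + t) ^ k := by
      refine Asymptotics.IsBigO.of_bound K ?_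
      filter_upwards [eventually_ge_atTop 0] with t ht
      rw [Real.norm_eq_abs, Real.norm_of_nonneg (by positivity)]
      exact hb t ht
    refine ((Asymptotics.isBigO_refl (fun t : ℝ => Real.exp (-lam * t)) atTop).mul
      (h3.trans h2)).trans (Asymptotics.IsBigO.of_bound (Real.exp (lam / 2)) ?_)
    refine Eventually.of_forall fun t => le_of_eq ?_
    rw [← Real.exp_add, Real.norm_eq_abs, Real.norm_eq_abs, Real.abs_exp, Real.abs_exp,
      ← Real.exp_add]
    congr 1; ring
  refine ⟨integrable_of_isBigO_exp_neg (by positivity : 0 < lam / 2) ?_ h1, h1.trans_tendsto ?_⟩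
  · exact (Real.continuous_exp.comp (continuous_const.mul continuous_id)).continuousOn.mul hg
  · have h3 : Tendsto (fun s : ℝ => -(lam / 2) * s) atTop atBot :=
      tendsto_id.const_mul_atTop_of_neg (by linarith)
    exact Real.tendsto_exp_atBot.comp h3

/-- Integration divides the Laplace transform by its variable. -/
lemma laplace_of_hasDerivWithinAt {G g : ℝ → ℝ} (h0 : G 0 = 0)
    (hG : ∀ t, 0 ≤ t → HasDerivWithinAt G (g t) (Set.Ici 0) t)
    (hg : ContinuousOn g (Set.Ici 0)) {K : ℝ} {k : ℕ}
    (hb : ∀ t, 0 ≤ t → |g t| ≤ K * (1 + t) ^ k) :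
    (∀ t, 0 ≤ t → |G t| ≤ K * (1 + t) ^ (k + 1)) ∧
    ∀ lam : ℝ, 0 < lam →
      ∫ t in Set.Ioi 0, Real.exp (-lam * t) * G t =
        (∫ t in Set.Ioi 0, Real.exp (-lam * t) * g t) / lam := by
  have hK : 0 ≤ K := by
    have := (abs_nonneg _).trans (hb 0 le_rfl)
    simpa using this
  have hGb : ∀ t, 0 ≤ t → |G t| ≤ K * (1 + t) ^ (k + 1) := fun t ht => by
    have h1 := (convex_Icc (0 : ℝ) t).norm_image_sub_le_of_norm_hasDerivWithin_le
      (f := G) (f' := g) (C := K * (1 + t) ^ k) (x := 0) (y := t)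
      (fun r hr => (hG r hr.1).mono Set.Icc_subset_Ici_self)
      (fun r hr => (hb r hr.1).trans (by
        have := hr.1
        have := hr.2
        gcongr)) ⟨le_rfl, ht⟩ ⟨ht, le_rfl⟩
    rw [h0, sub_zero, sub_zero, Real.norm_eq_abs, Real.norm_of_nonneg ht] at h1
    refine h1.trans ?_
    rw [pow_succ, ← mul_assoc]
    gcongr
    linarith
  refine ⟨hGb, fun lam hlam => ?_⟩
  have hGc : ContinuousOn G (Set.Ici 0) := fun t ht => (hG t ht).continuousWithinAt
  obtain ⟨h1, h2⟩ := integrableOn_exp_mul hGc hGb hlam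
  obtain ⟨h3, -⟩ := integrableOn_exp_mul hg hb hlam
  have h4 := integral_Ioi_of_hasDerivAt_of_tendsto (a := 0) (m := 0)
    (f := fun s => Real.exp (-lam * s) * G s)
    (f' := fun s => Real.exp (-lam * s) * g s - lam * (Real.exp (-lam * s) * G s)) ?_ ?_
    (h3.sub (h1.const_mul lam)) h2
  · rw [integral_sub h3 (h1.const_mul lam), integral_const_mul, h0] at h4
    rw [eq_div_iff hlam.ne']
    linarith
  · exact ((Real.continuous_exp.comp (continuous_const.mul continuous_id)).continuousWithinAt.mul
      (hGc 0 Set.self_mem_Ici))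
  · intro s hs
    have h5 : HasDerivAt (fun s => Real.exp (-lam * s)) (Real.exp (-lam * s) * (-lam)) s := by
      have := ((hasDerivAt_id s).const_mul (-lam)).exp
      simpa using this
    refine (h5.mul ((hG s (le_of_lt hs)).hasDerivAt (Ici_mem_nhds hs))).congr_deriv ?_
    ring

end Laplace

section Formula

variable {d : ℕ} [NeZero d] {Ω : Type*} [MeasurableSpace Ω] {P : Measure Ω} [IsProbabilityMeasure P]
  {𝓕 : Filtration ℝ≥0 ‹MeasurableSpace Ω›} {X : ℝ≥0 → Ω → Config d} {p : Site d → ℝ}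

lemma corr_eq (hp : IsDriftLaw p) (hX : IsEquilibriumExclusion p halfDensity P 𝓕 X) (x : Site d)
    (t : ℝ≥0) :
    corr P X x t = (twoTime P X {0} t {x} - if x = 0 then 1 else 0) / 4 := by
  have hU := isCorrelation_twoTime hp hX
  have hi : ∀ (s : ℝ) (A B : Finset (Site d)),
      Integrable (fun ω => walsh A (X s.toNNReal ω) * walsh B (X 0 ω)) P := fun s A B =>
    (integrable_walsh (IsEquilibriumExclusion.measurable hX 0) B).bdd_mul (c := 1)
      ((measurable_walsh A).comp (IsEquilibriumExclusion.measurable hX _)).aestronglyMeasurable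
      (Eventually.of_forall fun ω => by simp [abs_walsh])
  have h1 : ∀ ω, (occ (X t ω) x - occ (X 0 ω) x) * occ (X 0 ω) 0 =
      ((walsh {x} (X (t : ℝ).toNNReal ω) * walsh ∅ (X 0 ω) -
        walsh {x} (X (0 : ℝ).toNNReal ω) * walsh ∅ (X 0 ω)) +
      (walsh {x} (X (t : ℝ).toNNReal ω) * walsh {0} (X 0 ω) -
        walsh {x} (X (0 : ℝ).toNNReal ω) * walsh {0} (X 0 ω))) / 4 := fun ω => by
    rw [occ_eq_walsh, occ_eq_walsh, occ_eq_walsh, Real.toNNReal_coe, Real.toNNReal_zero]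
    simp [walsh]
    ring
  rw [corr]
  simp only [h1]
  have hi' : ∀ B : Finset (Site d), Integrable (fun ω =>
      walsh {x} (X (t : ℝ).toNNReal ω) * walsh B (X 0 ω) -
        walsh {x} (X (0 : ℝ).toNNReal ω) * walsh B (X 0 ω)) P := fun B =>
    (hi _ _ _).sub (hi _ _ _)
  have h2 : ∀ B : Finset (Site d), ∫ ω, (walsh {x} (X (t : ℝ).toNNReal ω) * walsh B (X 0 ω) -
      walsh {x} (X (0 : ℝ).toNNReal ω) * walsh B (X 0 ω)) ∂P =
      twoTime P X B t {x} - twoTime P X B 0 {x} := fun B => integral_sub (hi _ _ _) (hi _ _ _)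
  rw [integral_div, integral_add (hi' ∅) (hi' {0}), h2, h2]
  rw [hU.empty t.coe_nonneg, hU.empty le_rfl, hU.zero]
  simp

/-- The moments of the correlation function are, up to the factor `1/4`, those of the Walsh
correlations. -/
lemma hasSum_corr (hp : IsDriftLaw p) (hX : IsEquilibriumExclusion p halfDensity P 𝓕 X) {k : ℕ}
    (hk : k ≠ 0) (t : ℝ≥0) :
    HasSum (fun x : Site d => (x 0 : ℝ) ^ k * corr P X x t)
      (moment (twoTime P X) {0} k t {0} / 4) := by
  have h1 := ((isCorrelation_twoTime hp hX).summable_moment (Finset.singleton_nonempty 0) k t.coe_nonneg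
    {0}).hasSum.div_const 4
  refine h1.congr_fun fun x => ?_
  rw [corr_eq hp hX, vadd_singleton_zero]
  split_ifs with h
  · simp [h, hk]
  · ring

lemma mul_diffusionCoeff (hp : IsDriftLaw p) (hX : IsEquilibriumExclusion p halfDensity P 𝓕 X)
    {t : ℝ} (ht : 0 < t) :
    t * diffusionCoeff halfDensity P X 0 0 t.toNNReal = moment (twoTime P X) {0} 2 t {0} / 2 := by
  have h1 := (hasSum_corr hp hX one_ne_zero t.toNNReal).tsum_eq
  have h2 := (hasSum_corr hp hX two_ne_zero t.toNNReal).tsum_eq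
  rw [Real.coe_toNNReal _ ht.le] at h1 h2
  rw [(isCorrelation_twoTime hp hX).moment_one_singleton ht.le] at h1
  simp only [pow_one, zero_div, sq] at h1 h2
  rw [diffusionCoeff, meanDisplacement, h1, h2, compressibility_half, Real.coe_toNNReal _ ht.le]
  field_simp
  ring

/-- The Green–Kubo formula for the Laplace transform of the mean square displacement: the
correction to ordinary diffusion is the transform of the current autocorrelation. -/
theorem greenKubo (hp : IsDriftLaw p) (hX : IsEquilibriumExclusion p halfDensity P 𝓕 X)
    (hφ : ∀ t, 0 ≤ t → |moment (twoTime P X) driftBond 0 t driftBond| ≤ 1) :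
    (∀ t : ℝ≥0, Summable fun x : Site d => (x 0 : ℝ) * (x 0 : ℝ) * corr P X x t) ∧
    ∀ lam : ℝ, 0 < lam →
      IntegrableOn (fun t : ℝ => Real.exp (-lam * t) *
        (t * diffusionCoeff halfDensity P X 0 0 t.toNNReal)) (Set.Ioi 0) ∧
      ∫ t in Set.Ioi (0 : ℝ), Real.exp (-lam * t) *
          (t * diffusionCoeff halfDensity P X 0 0 t.toNNReal) =
        (1 / 2 + (∫ t in Set.Ioi (0 : ℝ), Real.exp (-lam * t) *
          moment (twoTime P X) driftBond 0 t driftBond) / 4) / lam ^ 2 := by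
  have hU := isCorrelation_twoTime hp hX
  refine ⟨fun t => ?_, fun lam hlam => ?_⟩
  · have := (hasSum_corr hp hX two_ne_zero t).summable
    simpa only [sq] using this
  set φ : ℝ → ℝ := fun t => moment (twoTime P X) driftBond 0 t driftBond with hφd
  have hφc : ContinuousOn φ (Set.Ici 0) := fun t ht =>
    (hU.isSolution_moment driftBond_nonempty 0 driftBond t ht).continuousWithinAt
  obtain ⟨hb1, hl1⟩ := laplace_of_hasDerivWithinAt (K := 1) (k := 0)
    (G := fun t => moment (twoTime P X) {0} 1 t driftBond)
    (g := fun t => -(1 / 2) * φ t) hU.moment_one_zero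
    (fun t ht => hU.hasDerivWithinAt_moment_one ht) (continuousOn_const.mul hφc) (fun t ht => by
      rw [abs_mul, pow_zero, mul_one, abs_neg, abs_of_pos (by norm_num : (0 : ℝ) < 1 / 2)]
      linarith [hφ t ht])
  have hb2 : ∀ t : ℝ, 0 ≤ t → |1 - moment (twoTime P X) {0} 1 t driftBond| ≤ 2 * (1 + t) ^ 1 :=
    fun t ht => by
      have h1 := hb1 t ht
      have h2 := abs_sub (1 : ℝ) (moment (twoTime P X) {0} 1 t driftBond)
      rw [abs_one] at h2
      rw [zero_add, pow_one] at h1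
      rw [pow_one]
      linarith
  have hc2 : ContinuousOn (fun t => 1 - moment (twoTime P X) {0} 1 t driftBond) (Set.Ici 0) :=
    fun t ht => continuousWithinAt_const.sub
      (hU.hasDerivWithinAt_moment_one ht).continuousWithinAt
  obtain ⟨hb3, hl2⟩ := laplace_of_hasDerivWithinAt
    (G := fun t => moment (twoTime P X) {0} 2 t {0})
    (g := fun t => 1 - moment (twoTime P X) {0} 1 t driftBond) hU.moment_two_zero
    (fun t ht => hU.hasDerivWithinAt_moment_two ht) hc2 hb2
  have hc3 : ContinuousOn (fun t => moment (twoTime P X) {0} 2 t {0}) (Set.Ici 0) :=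
    fun t ht => (hU.hasDerivWithinAt_moment_two ht).continuousWithinAt
  have hc1 : ContinuousOn (fun t => moment (twoTime P X) {0} 1 t driftBond) (Set.Ici 0) :=
    fun t ht => (hU.hasDerivWithinAt_moment_one ht).continuousWithinAt
  have he : Set.EqOn (fun t : ℝ => Real.exp (-lam * t) *
      (t * diffusionCoeff halfDensity P X 0 0 t.toNNReal))
      (fun t => Real.exp (-lam * t) * moment (twoTime P X) {0} 2 t {0} / 2) (Set.Ioi 0) :=
    fun t ht => by
      simp only [mul_diffusionCoeff hp hX (Set.mem_Ioi.1 ht)]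
      ring
  have hi1 := (integrableOn_exp_mul (g := fun _ => (1 : ℝ)) (K := 1) (k := 0) continuousOn_const
    (fun t _ => by simp) hlam).1
  have hi2 := (integrableOn_exp_mul hc1 hb1 hlam).1
  have hi3 := (integrableOn_exp_mul hc3 hb3 hlam).1
  refine ⟨IntegrableOn.congr_fun (hi3.div_const 2) he.symm measurableSet_Ioi, ?_⟩
  rw [setIntegral_congr_fun measurableSet_Ioi he, integral_div, hl2 lam hlam]
  have h1 : ∫ t in Set.Ioi (0 : ℝ), Real.exp (-lam * t) *
      (1 - moment (twoTime P X) {0} 1 t driftBond) =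
      1 / lam - (∫ t in Set.Ioi (0 : ℝ), Real.exp (-lam * t) * (-(1 / 2) * φ t)) / lam := by
    rw [← hl1 lam hlam]
    simp only [mul_sub]
    rw [integral_sub hi1 hi2]
    simp only [mul_one]
    rw [integral_exp_mul_Ioi (by linarith)]
    simp
  have h2 : ∀ t, Real.exp (-lam * t) * (-(1 / 2) * φ t) =
      -(1 / 2) * (Real.exp (-lam * t) * φ t) := fun t => by ring
  rw [h1]
  simp only [h2, integral_const_mul]
  field_simp
  ring

end Formula

/-! ### The Hilbert space of translation classes -/

section ClassSpace

variable {d : ℕ}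

/-- The Hilbert space `ℓ²` over the translation classes of finite sets of sites. -/
abbrev ClassSpace (d : ℕ) : Type :=
  lp (fun _ : AddAction.orbitRel.Quotient (Site d) (Finset (Site d)) => ℝ) 2

open Classical in
/-- The unit vector of the class of `A`; the class of the empty set, which stands for the constant
functions, is discarded. -/
def classVec (A : Finset (Site d)) : ClassSpace d :=
  if A = ∅ then 0 else
    lp.single 2 (Quotient.mk (AddAction.orbitRel (Site d) (Finset (Site d))) A) (1 : ℝ)

/-- The sum of the translates of a combination of Walsh functions, as an element of the space of
classes. -/
def toClass : WalshSpace d →ₗ[ℝ] ClassSpace d := Finsupp.linearCombination ℝ classVec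

lemma toClass_single (A : Finset (Site d)) : toClass (Finsupp.single A 1) = classVec A := by
  simp [toClass]

/-- The coefficient of `toClass f` at the class of `A`. -/
def hat (f : WalshSpace d) (A : Finset (Site d)) : ℝ := inner ℝ (toClass f) (classVec A)

lemma inner_toClass (f g : WalshSpace d) : inner ℝ (toClass g) (toClass f) = ev (hat g) f := by
  induction f using Finsupp.induction_linear with
  | zero => simp
  | add f₁ f₂ h₁ h₂ => rw [map_add, map_add, inner_add_right, h₁, h₂]
  | single A c =>
    rw [ev_single, ← mul_one c, ← smul_eq_mul, ← Finsupp.smul_single, map_smul, inner_smul_right,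
      toClass_single]
    simp [hat]

lemma hat_add (f g : WalshSpace d) (A : Finset (Site d)) : hat (f + g) A = hat f A + hat g A := by
  rw [hat, map_add, inner_add_left]; rfl

lemma hat_smul (c : ℝ) (f : WalshSpace d) (A : Finset (Site d)) :
    hat (c • f) A = c * hat f A := by
  rw [hat, map_smul, inner_smul_left]; rfl

lemma hat_empty (f : WalshSpace d) : hat f ∅ = 0 := by simp [hat, classVec]

lemma classVec_vadd (x : Site d) (A : Finset (Site d)) : classVec (x +ᵥ A) = classVec A := by
  have h : Quotient.mk (AddAction.orbitRel (Site d) (Finset (Site d))) (x +ᵥ A) =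
      Quotient.mk (AddAction.orbitRel (Site d) (Finset (Site d))) A :=
    Quotient.sound (AddAction.mem_orbit A x)
  simp [classVec, h]

@[simp] lemma hat_vadd (f : WalshSpace d) (x : Site d) (A : Finset (Site d)) :
    hat f (x +ᵥ A) = hat f A := by
  rw [hat, classVec_vadd, hat]

open Classical in
lemma hat_single (A B : Finset (Site d)) :
    hat (Finsupp.single B 1) A = if B.Nonempty ∧ ∃ x : Site d, x +ᵥ B = A then 1 else 0 := by
  rw [hat, toClass_single]
  rcases B.eq_empty_or_nonempty with rfl | hB
  · simp [classVec]
  rcases A.eq_empty_or_nonempty with rfl | hA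
  · simp [classVec, hB.ne_empty]
  rw [classVec, classVec, if_neg hB.ne_empty, if_neg hA.ne_empty, lp.inner_single_left,
    lp.single_apply]
  have h : Quotient.mk (AddAction.orbitRel (Site d) (Finset (Site d))) B =
      Quotient.mk (AddAction.orbitRel (Site d) (Finset (Site d))) A ↔ ∃ x : Site d, x +ᵥ B = A := by
    rw [eq_comm, Quotient.eq]
    exact Iff.rfl
  rw [Pi.single_apply]
  simp only [h, hB, true_and]
  split_ifs <;> simp

lemma norm_classVec_le (A : Finset (Site d)) : ‖classVec A‖ ≤ 1 := by
  classical
  unfold classVec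
  split_ifs
  · simp
  · rw [lp.norm_single (by norm_num)]; simp

/-- A non-empty finite set is not invariant under any translation, as its sum of sites is moved. -/
lemma vadd_left_injective {B : Finset (Site d)} (hB : B.Nonempty) :
    Function.Injective fun x : Site d => x +ᵥ B := by
  intro x y h
  have h1 := congrArg (fun A : Finset (Site d) => ∑ z ∈ A, z) (show x +ᵥ B = y +ᵥ B from h)
  have h2 : ∀ x : Site d, ∑ z ∈ x +ᵥ B, z = B.card • x + ∑ z ∈ B, z := fun x => by
    rw [Finset.vadd_finset_def, Finset.sum_image fun y _ z _ h => by simpa using h]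
    exact (Finset.sum_add_distrib (f := fun _ => x) (g := fun z => z)).trans
      (by rw [Finset.sum_const])
  simp only [h2, add_left_inj] at h1
  exact smul_right_injective _ hB.card_pos.ne' h1

/-- Sums over translates unfold: a sum over the classes of a sum over sites becomes a sum over all
finite sets, seen from a fixed site. -/
lemma hasSum_hat_mul {ψ : Finset (Site d) → Site d → ℝ}
    (hψ : ∀ (z : Site d) A x, ψ (z +ᵥ A) (z + x) = ψ A x) (h0 : ∀ x, ψ ∅ x = 0)
    (hfin : ∀ A, (Function.support (ψ A)).Finite) (f : WalshSpace d) (x₀ : Site d) :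
    HasSum (fun A => hat f A * ψ A x₀) (ev (fun A => ∑' x, ψ A x) f) := by
  classical
  induction f using Finsupp.induction_linear with
  | zero => simp [hat]
  | add f g hf hg =>
    rw [map_add]
    refine (hf.add hg).congr_fun fun A => ?_
    rw [hat_add]; ring
  | single B c =>
    have hc : Finsupp.single B c = c • Finsupp.single B 1 := by simp
    rw [hc, map_smul, smul_eq_mul, ev_single, one_mul]
    simp only [hat_smul, mul_assoc]
    refine HasSum.mul_left c ?_
    rcases B.eq_empty_or_nonempty with rfl | hB
    · simp [h0, hat_single]
    have h1 : HasSum (fun x => ψ B x) (∑' x, ψ B x) :=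
      (summable_of_hasFiniteSupport (hfin B)).hasSum
    have h2 : HasSum (fun x : Site d => ψ B (x₀ - x)) (∑' x, ψ B x) :=
      (Equiv.subLeft x₀).hasSum_iff.2 h1
    refine (Function.Injective.hasSum_iff (vadd_left_injective hB) (fun A hA => ?_)).1
      (h2.congr_fun fun x => ?_)
    · rw [hat_single, if_neg, zero_mul]
      rintro ⟨-, x, rfl⟩
      exact hA ⟨x, rfl⟩
    · rw [Function.comp_apply, hat_single, if_pos ⟨hB, x, rfl⟩, one_mul]
      have := hψ x B (x₀ - x)
      rwa [add_sub_cancel] at this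

end ClassSpace

section DirichletForm

variable {d : ℕ}

/-- The contribution of the bonds in the direction `i` to the Dirichlet form. -/
def dirichlet (i : Fin d) (f g : WalshSpace d) : ℝ :=
  ∑' A, (hat f (swapSet 0 (unitVec i) A) - hat f A) * (hat g (swapSet 0 (unitVec i) A) - hat g A)

/-- The part of the generator which is due to the exchanges along bonds in the direction `i`. -/
lemma hasSum_exchange (i : Fin d) (f g : WalshSpace d) :
    HasSum (fun A => hat f A * (1 / 2 * (hat g (swapSet 0 (unitVec i) A) - hat g A)))
      (ev (fun A => ∑' x, 1 / 2 * (hat g (swapSet x (x + unitVec i) A) - hat g A)) f) := by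
  have := hasSum_hat_mul (ψ := fun A x => 1 / 2 * (hat g (swapSet x (x + unitVec i) A) - hat g A))
    (fun z A x => by rw [add_assoc, swapSet_vadd]; simp) (fun x => by simp [swapSet])
    (fun A => (bondSites i A).finite_toSet.subset fun x hx => by
      by_contra h
      exact hx (by simp only [swapSet_of_notMem_bondSites h]; simp)) f 0
  simpa using this

lemma hasSum_dirichlet (i : Fin d) (f g : WalshSpace d) :
    HasSum (fun A => (hat f (swapSet 0 (unitVec i) A) - hat f A) *
      (hat g (swapSet 0 (unitVec i) A) - hat g A)) (dirichlet i f g) ∧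
    ev (fun A => ∑' x, 1 / 2 * (hat g (swapSet x (x + unitVec i) A) - hat g A)) f =
      -(1 / 4) * dirichlet i f g := by
  have h1 := hasSum_exchange i f g
  -- The exchange is an involution, so the sum can be symmetrized.
  let e : Finset (Site d) ≃ Finset (Site d) := (Function.Involutive.toPerm
    (swapSet (0 : Site d) (unitVec i)) (swapSet_swapSet _ _))
  have h2 := e.hasSum_iff.2 h1
  have h3 := (h1.add h2).mul_left (-2)
  have h4 : HasSum (fun A => (hat f (swapSet 0 (unitVec i) A) - hat f A) *
      (hat g (swapSet 0 (unitVec i) A) - hat g A)) _ := h3.congr_fun fun A => by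
    change _ = -2 * (_ + hat f (swapSet 0 (unitVec i) A) *
      (1 / 2 * (hat g (swapSet 0 (unitVec i) (swapSet 0 (unitVec i) A)) -
        hat g (swapSet 0 (unitVec i) A))))
    rw [swapSet_swapSet]
    ring
  refine ⟨h4.summable.hasSum, ?_⟩
  rw [dirichlet, h4.tsum_eq]
  ring

lemma dirichlet_self_nonneg (i : Fin d) (f : WalshSpace d) : 0 ≤ dirichlet i f f :=
  tsum_nonneg fun _ => mul_self_nonneg _

variable [NeZero d]

/-- The generator on the space of classes: minus a quarter of the Dirichlet forms, plus the asymmetric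
part. -/
lemma ev_hat_row (f g : WalshSpace d) :
    inner ℝ (toClass g) (toClass (gen f)) = -(1 / 4) * ∑ i, dirichlet i f g +
      1 / 2 * ev (fun A => ∑' y, drift y A * hat g (flip y A)) f := by
  rw [inner_toClass, ev_gen]
  simp only [ev_row]
  rw [ev_add, ev_sum, Finset.mul_sum, ← ev_const_mul]
  congr 1
  · exact Finset.sum_congr rfl fun i _ => (hasSum_dirichlet i f g).2
  · congr 2
    funext A
    rw [← tsum_mul_left]
    exact tsum_congr fun y => by ring

lemma drift_support_finite (g : WalshSpace d) (A : Finset (Site d)) :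
    (Function.support fun y => drift y A * hat g (flip y A)).Finite :=
  (driftSites A).finite_toSet.subset fun y hy => by
    by_contra h
    exact hy (by simp only [drift_of_notMem h, zero_mul])

/-- The asymmetric part of the generator is antisymmetric. -/
lemma ev_drift_self (f : WalshSpace d) :
    ev (fun A => ∑' y, drift y A * hat f (flip y A)) f = 0 := by
  have h1 := hasSum_hat_mul (ψ := fun A y => drift y A * hat f (flip y A))
    (fun z A x => by rw [flip_vadd, drift_vadd, hat_vadd]) (fun x => by simp [drift])
    (drift_support_finite f) f 0
  let e : Finset (Site d) ≃ Finset (Site d) := (Function.Involutive.toPerm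
    (flip (0 : Site d)) (flip_flip _))
  have h2 := e.hasSum_iff.2 h1
  have h3 := h2.unique (h1.neg.congr_fun fun A => ?_)
  · linarith
  · change hat f (flip 0 A) * (drift 0 (flip 0 A) * hat f (flip 0 (flip 0 A))) = _
    rw [flip_flip, drift_flip]
    ring

lemma inner_gen_self (f : WalshSpace d) :
    inner ℝ (toClass f) (toClass (gen f)) = -(1 / 4) * ∑ i, dirichlet i f f := by
  rw [ev_hat_row, ev_drift_self]; ring

end DirichletForm

/-! ### The variational lower bound -/

section Autocorrelation

variable {d : ℕ} [NeZero d]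

lemma exists_norm_toClass_gen_pow_le (f : WalshSpace d) :
    ∃ C, 0 ≤ C ∧ ∀ n : ℕ, ‖toClass ((gen ^ n) f)‖ ≤
      C * (2 * (2 * d + 1) * 1 : ℝ) ^ n * n.factorial := by
  obtain ⟨C, hC, h⟩ := exists_seminorm_gen_pow_le (ι := Unit) zero_le_one
    (isWeight_pow (d := d) (C := 1) (K := 1) zero_le_one le_rfl)
    (fun _ => (normSeminorm ℝ (ClassSpace d)).comp toClass) (fun _ A => by
      rw [Seminorm.comp_apply, coe_normSeminorm, toClass_single]
      simpa using norm_classVec_le A) f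
  exact ⟨C, hC, fun n => h () n⟩

variable {U : Finset (Site d) → ℝ → Finset (Site d) → ℝ}

lemma IsCorrelation.exists_abs_moment_le (hU : IsCorrelation U) {B : Finset (Site d)}
    (hB : B.Nonempty) {T : ℝ} (hT : 0 ≤ T) :
    ∃ S M : ℝ, 0 ≤ S ∧ 1 ≤ M ∧ ∀ t, 0 ≤ t → t ≤ T → ∀ A, |moment U B 0 t A| ≤ S * M ^ A.card := by
  obtain ⟨M, a, hM, ha, ha1, h⟩ := hU.exists_decay hB hT
  have hs := summable_pow_len (d := d) ha ha1
  obtain ⟨S, hS⟩ := hs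
  have hS0 : 0 ≤ S := hS.nonneg fun _ => by positivity
  refine ⟨S, 2 * M, hS0, by linarith, fun t ht0 htT A => ?_⟩
  have h1 : ∀ x : Site d, decayWeight M a (x +ᵥ A) = M ^ A.card * ∑ z ∈ A, a ^ len (x + z) :=
    fun x => by
      rw [decayWeight, Finset.card_vadd_finset, Finset.vadd_finset_def,
        Finset.sum_image fun y _ z _ h => by simpa using h]
      simp only [vadd_eq_add]
  have h2 : ∀ z : Site d, HasSum (fun x => a ^ len (x + z)) S := fun z =>
    (Equiv.hasSum_iff (f := fun x : Site d => a ^ len x) (Equiv.addRight z)).2 hS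
  have h3 : HasSum (fun x : Site d => decayWeight M a (x +ᵥ A)) (M ^ A.card * (A.card * S)) := by
    simp only [h1]
    refine HasSum.mul_left _ ?_
    have h4 := hasSum_sum fun z (_ : z ∈ A) => h2 z
    rwa [Finset.sum_const, nsmul_eq_mul] at h4
  rw [← Real.norm_eq_abs, moment]
  refine (tsum_of_norm_bounded h3 fun x => ?_).trans ?_
  · rw [pow_zero, one_mul]
    exact h t ht0 htT _
  · rw [mul_pow]
    have h4 : (A.card : ℝ) ≤ 2 ^ A.card := by exact_mod_cast Nat.lt_two_pow_self.le
    calc M ^ A.card * (A.card * S) ≤ M ^ A.card * (2 ^ A.card * S) := by gcongr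
      _ = S * (2 ^ A.card * M ^ A.card) := by ring

lemma IsCorrelation.exists_abs_moment_gen_pow_le (hU : IsCorrelation U) {B : Finset (Site d)}
    (hB : B.Nonempty) {T : ℝ} (hT : 0 ≤ T) :
    ∃ ρ, 0 < ρ ∧ ∀ f, ∃ C, 0 ≤ C ∧ ∀ t, 0 ≤ t → t ≤ T → ∀ n : ℕ,
      |ev (moment U B 0 t) ((gen ^ n) f)| ≤ C * ρ ^ n * n.factorial := by
  obtain ⟨S, M, hS, hM, h⟩ := hU.exists_abs_moment_le hB hT
  have hb : ∀ (t : Set.Icc 0 T) (A : Finset (Site d)),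
      absSeminorm (ev (moment U B 0 t)) (Finsupp.single A 1) ≤ S * M ^ A.card := fun t A => by
    rw [absSeminorm_apply, ev_single, one_mul]
    exact h t t.2.1 t.2.2 A
  refine ⟨2 * (2 * d + 1) * M, by positivity, fun f => ?_⟩
  obtain ⟨C, hC, h1⟩ := exists_seminorm_gen_pow_le (κ := M) (by positivity)
    (isWeight_pow (d := d) hS hM) (fun t : Set.Icc 0 T => absSeminorm (ev (moment U B 0 t))) hb f
  refine ⟨C, hC, fun t h0 hT n => ?_⟩
  have h2 := h1 ⟨t, h0, hT⟩ n
  rwa [absSeminorm_apply] at h2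

lemma IsCorrelation.ev_moment_at_zero (hU : IsCorrelation U) {B : Finset (Site d)}
    (hB : B.Nonempty) (f : WalshSpace d) :
    ev (moment U B 0 0) f = inner ℝ (toClass f) (toClass (Finsupp.single B 1)) := by
  classical
  rw [real_inner_comm, inner_toClass]
  congr 2
  funext A
  rw [hat_single]
  simp only [moment, pow_zero, one_mul, hU.zero]
  split_ifs with h
  · obtain ⟨-, x, hx⟩ := h
    rw [tsum_eq_single (-x)]
    · rw [if_pos]; rw [← hx, neg_vadd_vadd]
    · intro y hy
      rw [if_neg]
      intro h
      refine hy (eq_neg_of_add_eq_zero_left ?_)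
      refine vadd_left_injective hB ?_
      simp only [← vadd_vadd, hx, h, zero_vadd]
  · refine (tsum_congr fun x => if_neg fun hx => h ⟨hB, -x, ?_⟩).trans tsum_zero
    rw [← hx, neg_vadd_vadd]

lemma inner_gen_self_nonpos (f : WalshSpace d) :
    inner ℝ (toClass f) (toClass (gen f)) ≤ 0 := by
  rw [inner_gen_self]
  have := Finset.sum_nonneg fun i (_ : i ∈ Finset.univ) => dirichlet_self_nonneg i f
  linarith

/-- The evolution is a contraction, so the autocorrelation of a class does not exceed its value at
time `0`. -/
lemma IsCorrelation.abs_autocorrelation_le (hU : IsCorrelation U) {B : Finset (Site d)}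
    (hB : B.Nonempty) {t : ℝ} (ht : 0 ≤ t) : |moment U B 0 t B| ≤ 1 := by
  have h1 := abs_functional_le (ι := toClass) (L := gen) (y := fun t => ev (moment U B 0 t))
    inner_gen_self_nonpos (ρ := 2 * (2 * d + 1) * 1) (by positivity)
    exists_norm_toClass_gen_pow_le (hU.isSolution_moment hB 0).hasDerivWithinAt_ev
    (fun T hT => hU.exists_abs_moment_gen_pow_le hB hT) (hU.ev_moment_at_zero hB) ht
    (Finsupp.single B 1)
  rw [ev_single, one_mul, toClass_single] at h1
  exact h1.trans (mul_le_one₀ (norm_classVec_le B) (norm_nonneg _) (norm_classVec_le B))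

/-- The lower bound for the Laplace transform of an autocorrelation from a test vector `h`. -/
lemma IsCorrelation.sq_hat_le_laplace (hU : IsCorrelation U) {B : Finset (Site d)}
    (hB : B.Nonempty) {lam : ℝ} (hlam : 0 < lam) {h : WalshSpace d} {K : ℝ}
    (hK : ∀ f, inner ℝ (toClass h) (toClass (lam • f - gen f)) ^ 2 ≤
      K * inner ℝ (toClass f) (toClass (lam • f - gen f))) :
    hat h B ^ 2 ≤ K * ∫ s in Set.Ioi (0 : ℝ), Real.exp (-lam * s) * moment U B 0 s B := by
  have h1 := sq_inner_le_laplace (ι := toClass) (L := gen) (y := fun t => ev (moment U B 0 t))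
    inner_gen_self_nonpos (ρ := 2 * (2 * d + 1) * 1) (by positivity)
    exists_norm_toClass_gen_pow_le (hU.isSolution_moment hB 0).hasDerivWithinAt_ev
    (fun T hT => hU.exists_abs_moment_gen_pow_le hB hT) (hU.ev_moment_at_zero hB) hlam
    (h := toClass h) (K := K) (fun f => by rw [real_inner_comm]; exact hK f)
  rw [real_inner_comm, toClass_single] at h1
  simpa [hat] using h1

end Autocorrelation

section Energy

variable {d : ℕ}

/-- The quadratic form of the symmetric part of the resolvent equation, polarized. -/
def energy (lam : ℝ) (f g : WalshSpace d) : ℝ :=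
  lam * inner ℝ (toClass f) (toClass g) + 1 / 4 * ∑ i, dirichlet i f g

lemma energy_self_nonneg {lam : ℝ} (hlam : 0 ≤ lam) (f : WalshSpace d) : 0 ≤ energy lam f f := by
  have h1 := Finset.sum_nonneg fun i (_ : i ∈ Finset.univ) => dirichlet_self_nonneg i f
  have h2 : 0 ≤ inner ℝ (toClass f) (toClass f) := real_inner_self_nonneg
  unfold energy
  positivity

lemma dirichlet_add_smul (i : Fin d) (f g : WalshSpace d) (t : ℝ) :
    dirichlet i (f + t • g) (f + t • g) =
      dirichlet i f f + 2 * t * dirichlet i f g + t * t * dirichlet i g g := by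
  have h := (((hasSum_dirichlet i f f).1.add ((hasSum_dirichlet i f g).1.mul_left (2 * t))).add
    ((hasSum_dirichlet i g g).1.mul_left (t * t)))
  rw [← h.tsum_eq, dirichlet]
  refine tsum_congr fun A => ?_
  simp only [hat_add, hat_smul]
  ring

lemma energy_add_smul (lam : ℝ) (f g : WalshSpace d) (t : ℝ) :
    energy lam (f + t • g) (f + t • g) =
      energy lam f f + 2 * t * energy lam f g + t * t * energy lam g g := by
  simp only [energy, dirichlet_add_smul, Finset.sum_add_distrib, ← Finset.mul_sum, map_add,
    map_smul, inner_add_left, inner_add_right, inner_smul_left, inner_smul_right]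
  rw [real_inner_comm (toClass f) (toClass g)]
  simp
  ring

/-- The Cauchy–Schwarz inequality for the energy. -/
lemma sq_energy_le {lam : ℝ} (hlam : 0 ≤ lam) (f g : WalshSpace d) :
    energy lam f g ^ 2 ≤ energy lam f f * energy lam g g := by
  have h := discrim_le_zero (a := energy lam g g) (b := 2 * energy lam f g) (c := energy lam f f)
    fun t => by
      have := energy_self_nonneg hlam (f + t • g)
      rw [energy_add_smul] at this
      linarith
  rw [discrim] at h
  nlinarith

variable [NeZero d]

lemma inner_resolvent_self (lam : ℝ) (f : WalshSpace d) :
    inner ℝ (toClass f) (toClass (lam • f - gen f)) = energy lam f f := by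
  rw [map_sub, map_smul, inner_sub_right, inner_smul_right, inner_gen_self, energy]
  ring

lemma inner_resolvent (lam : ℝ) (f g : WalshSpace d) :
    inner ℝ (toClass g) (toClass (lam • f - gen f)) = energy lam f g -
      1 / 2 * ev (fun A => ∑' y, drift y A * hat g (flip y A)) f := by
  rw [map_sub, map_smul, inner_sub_right, inner_smul_right, ev_hat_row, energy,
    real_inner_comm (toClass f) (toClass g)]
  ring

end Energy

/-! ### Test functions of degree two -/

section PairFunction

variable {d : ℕ}

/-- The combination of two-point Walsh functions with coefficient `H (b - a)` at the class of
`{a, b}`, for an even function `H` supported in `W`. The factor `1/2` is due to the fact that `{0, y}`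
and `{0, -y}` are in the same class. -/
def pairSum (H : Site d → ℝ) (W : Finset (Site d)) : WalshSpace d :=
  ∑ y ∈ W.erase 0, (H y / 2) • Finsupp.single {0, y} 1

lemma hat_pairSum (H : Site d → ℝ) (W A : Finset (Site d)) :
    hat (pairSum H W) A = ∑ y ∈ W.erase 0, H y / 2 * hat (Finsupp.single {0, y} 1) A := by
  simp only [← hat_smul]
  rw [pairSum, hat, map_sum, sum_inner]
  rfl

lemma vadd_pair (x a b : Site d) : x +ᵥ ({a, b} : Finset (Site d)) = {x + a, x + b} := by
  ext z; simp [mem_vadd, sub_eq_iff_eq_add']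

lemma hat_pairSum_of_card_ne {H : Site d → ℝ} {W A : Finset (Site d)} (hA : A.card ≠ 2) :
    hat (pairSum H W) A = 0 := by
  classical
  rw [hat_pairSum]
  refine Finset.sum_eq_zero fun y hy => ?_
  rw [hat_single, if_neg, mul_zero]
  rintro ⟨-, x, rfl⟩
  exact hA (by rw [Finset.card_vadd_finset, Finset.card_pair (Finset.ne_of_mem_erase hy).symm])

lemma hat_pairSum_pair {H : Site d → ℝ} (heven : ∀ y, H (-y) = H y) {W : Finset (Site d)}
    (hW : ∀ y, y ∉ W → H y = 0) {a b : Site d} (hab : a ≠ b) :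
    hat (pairSum H W) {a, b} = H (b - a) := by
  classical
  have hne : b - a ≠ 0 := sub_ne_zero.2 hab.symm
  have hne' : a - b ≠ 0 := sub_ne_zero.2 hab
  have h2 : b - a ≠ a - b := fun h => by
    refine hab (funext fun i => ?_)
    have := congrFun h i
    simp only [Pi.sub_apply] at this
    omega
  have h1 : ∀ y ∈ W.erase 0, H y / 2 * hat (Finsupp.single {0, y} 1) {a, b} =
      (if b - a = y then H y / 2 else 0) + if a - b = y then H y / 2 else 0 := fun y hy => by
    have hy0 := Finset.ne_of_mem_erase hy
    rw [hat_single]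
    have h3 : (({0, y} : Finset (Site d)).Nonempty ∧
        ∃ x : Site d, x +ᵥ ({0, y} : Finset (Site d)) = {a, b}) ↔ b - a = y ∨ a - b = y := by
      constructor
      · rintro ⟨-, x, hx⟩
        rw [vadd_pair, add_zero] at hx
        have hx1 : x ∈ ({a, b} : Finset (Site d)) := hx ▸ by simp
        have hx2 : x + y ∈ ({a, b} : Finset (Site d)) := hx ▸ by simp
        simp only [Finset.mem_insert, Finset.mem_singleton] at hx1 hx2
        rcases hx1 with rfl | rfl <;> rcases hx2 with h | h
        · exact absurd (by simpa using h) hy0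
        · left; rw [← h]; abel
        · right; rw [← h]; abel
        · exact absurd (by simpa using h) hy0
      · refine fun h => ⟨⟨0, by simp⟩, ?_⟩
        rcases h with rfl | rfl
        · exact ⟨a, by rw [vadd_pair]; simp⟩
        · exact ⟨b, by rw [vadd_pair]; simp [Finset.pair_comm]⟩
    by_cases h4 : b - a = y
    · have h5 : a - b ≠ y := fun h => h2 (h4.trans h.symm)
      rw [if_pos (h3.2 (Or.inl h4)), if_pos h4, if_neg h5]; ring
    · by_cases h5 : a - b = y
      · rw [if_pos (h3.2 (Or.inr h5)), if_neg h4, if_pos h5]; ring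
      · rw [if_neg (fun h => (h3.1 h).elim h4 h5), if_neg h4, if_neg h5]; ring
  rw [hat_pairSum, Finset.sum_congr rfl h1, Finset.sum_add_distrib, Finset.sum_ite_eq,
    Finset.sum_ite_eq]
  have h6 : ∀ y : Site d, y ≠ 0 → (if y ∈ W.erase 0 then H y / 2 else 0) = H y / 2 := fun y hy => by
    split_ifs with h
    · rfl
    · rw [hW y fun h' => h (Finset.mem_erase.2 ⟨hy, h'⟩), zero_div]
  rw [h6 _ hne, h6 _ hne', ← heven (a - b), neg_sub]
  ring

lemma inner_pairSum_self_le {H : Site d → ℝ} (heven : ∀ y, H (-y) = H y) {W : Finset (Site d)}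
    (hW : ∀ y, y ∉ W → H y = 0) :
    inner ℝ (toClass (pairSum H W)) (toClass (pairSum H W)) ≤ (∑ y ∈ W, H y ^ 2) / 2 := by
  rw [inner_toClass]
  nth_rw 2 [pairSum]
  rw [map_sum, Finset.sum_div]
  have h1 : ∀ y ∈ W.erase 0, ev (hat (pairSum H W)) ((H y / 2) • Finsupp.single {0, y} 1) =
      H y ^ 2 / 2 := fun y hy => by
    rw [map_smul, ev_single, hat_pairSum_pair heven hW (Finset.ne_of_mem_erase hy).symm, smul_eq_mul]
    simp
    ring
  rw [Finset.sum_congr rfl h1]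
  exact Finset.sum_le_sum_of_subset_of_nonneg (Finset.erase_subset _ _) fun _ _ _ => by positivity

lemma swapSet_pair {x y z : Site d} (hx : z ≠ x) (hy : z ≠ y) :
    swapSet x y {x, z} = {y, z} := by
  rw [swapSet, Finset.map_insert, Finset.map_singleton]
  simp [Equiv.swap_apply_of_ne_of_ne hx hy]

lemma swapSet_comm (x y : Site d) (A : Finset (Site d)) : swapSet x y A = swapSet y x A := by
  rw [swapSet, Equiv.swap_comm]; rfl

/-- An exchange along the bond `{0, e_i}` changes a pair only if the pair meets the bond in one site,
so the Dirichlet form of a pair function is that of the random walk of the difference of the two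
sites. -/
lemma dirichlet_pairSum_le {H : Site d → ℝ} (heven : ∀ y, H (-y) = H y) {W : Finset (Site d)}
    (i : Fin d) (hW : ∀ y, y ∉ W → H y = 0) (hW' : ∀ y, y ∉ W → H (y - unitVec i) = 0) :
    dirichlet i (pairSum H W) (pairSum H W) ≤ 2 * ∑ z ∈ W, (H (z - unitVec i) - H z) ^ 2 := by
  set e : Site d := unitVec i with he
  have he0 : e ≠ 0 := unitVec_ne_zero i
  set F : Finset (Site d) → ℝ := fun A => (hat (pairSum H W) (swapSet 0 e A) -
    hat (pairSum H W) A) * (hat (pairSum H W) (swapSet 0 e A) - hat (pairSum H W) A) with hF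
  have hF0 : ∀ A, 0 ≤ F A := fun A => mul_self_nonneg _
  set Z : Finset (Site d) := (W.erase 0).erase e with hZ
  have hmem : ∀ z, z ∈ Z ↔ z ≠ e ∧ z ≠ 0 ∧ z ∈ W := fun z => by simp [hZ]
  have hF1 : ∀ z, z ≠ e → z ≠ 0 → F {0, z} = (H (z - e) - H z) ^ 2 := fun z h1 h0 => by
    simp only [hF]
    rw [swapSet_pair h0 h1, hat_pairSum_pair heven hW h0.symm, hat_pairSum_pair heven hW h1.symm,
      sub_zero, sq]
  have hF2 : ∀ z, z ≠ e → z ≠ 0 → F {e, z} = (H (z - e) - H z) ^ 2 := fun z h1 h0 => by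
    simp only [hF]
    rw [swapSet_comm, swapSet_pair h1 h0, hat_pairSum_pair heven hW h0.symm,
      hat_pairSum_pair heven hW h1.symm, sub_zero]
    ring
  have hpair : ∀ (A : Finset (Site d)) (a b : Site d), a ∈ A → b ∉ A → A.card = 2 →
      ∃ z, z ≠ a ∧ z ≠ b ∧ A = {a, z} := fun A a b ha hb hc => by
    obtain ⟨x, y, hxy, rfl⟩ := Finset.card_eq_two.1 hc
    simp only [Finset.mem_insert, Finset.mem_singleton, not_or] at ha hb
    rcases ha with rfl | rfl
    · exact ⟨y, hxy.symm, fun h => hb.2 h.symm, rfl⟩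
    · exact ⟨x, hxy, fun h => hb.1 h.symm, Finset.pair_comm _ _⟩
  have hsupp : ∀ A ∉ Z.image (fun z => ({0, z} : Finset (Site d))) ∪
      Z.image (fun z => ({e, z} : Finset (Site d))), F A = 0 := fun A hA => by
    by_contra hne
    have hcard : A.card = 2 := by
      by_contra h
      refine hne ?_
      simp only [hF]
      rw [hat_pairSum_of_card_ne h, hat_pairSum_of_card_ne (by rwa [card_swapSet])]
      ring
    have hout : ∀ z, z ≠ e → z ≠ 0 → (H (z - e) - H z) ^ 2 ≠ 0 → z ∈ Z := fun z h1 h0 h => by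
      rw [hmem]
      refine ⟨h1, h0, ?_⟩
      by_contra h2
      exact h (by rw [hW z h2, hW' z h2]; ring)
    refine hA (Finset.mem_union.2 ?_)
    by_cases h0 : (0 : Site d) ∈ A <;> by_cases h1 : e ∈ A
    · exact absurd (by simp only [hF, swapSet_eq_self (iff_of_true h0 h1)]; ring) hne
    · obtain ⟨z, hz0, hz1, rfl⟩ := hpair A 0 e h0 h1 hcard
      exact Or.inl (Finset.mem_image_of_mem _ (hout z hz1 hz0 (hF1 z hz1 hz0 ▸ hne)))
    · obtain ⟨z, hz1, hz0, rfl⟩ := hpair A e 0 h1 h0 hcard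
      exact Or.inr (Finset.mem_image_of_mem _ (hout z hz1 hz0 (hF2 z hz1 hz0 ▸ hne)))
    · exact absurd (by simp only [hF, swapSet_eq_self (iff_of_false h0 h1)]; ring) hne
  have hinj : ∀ a : Site d, a ∉ Z → Set.InjOn (fun z => ({a, z} : Finset (Site d))) Z :=
    fun a ha z hz w hw h => by
      have h1 : z ∈ ({a, w} : Finset (Site d)) := by
        have : z ∈ ({a, z} : Finset (Site d)) := by simp
        rwa [show ({a, z} : Finset (Site d)) = {a, w} from h] at this
      simp only [Finset.mem_insert, Finset.mem_singleton] at h1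
      exact h1.resolve_left fun h => ha (h ▸ hz)
  have h0Z : (0 : Site d) ∉ Z := fun h => ((hmem 0).1 h).2.1 rfl
  have heZ : e ∉ Z := fun h => ((hmem e).1 h).1 rfl
  rw [dirichlet, tsum_eq_sum hsupp]
  have h1 : ∑ z ∈ Z, (H (z - e) - H z) ^ 2 ≤ ∑ z ∈ W, (H (z - e) - H z) ^ 2 :=
    Finset.sum_le_sum_of_subset_of_nonneg
      ((Finset.erase_subset _ _).trans (Finset.erase_subset _ _)) fun _ _ _ => sq_nonneg _
  have h2 := Finset.sum_union_inter (s₁ := Z.image (fun z => ({0, z} : Finset (Site d))))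
    (s₂ := Z.image (fun z => ({e, z} : Finset (Site d)))) (f := F)
  rw [Finset.sum_image (hinj 0 h0Z), Finset.sum_image (hinj e heZ),
    Finset.sum_congr rfl fun z hz => hF1 z ((hmem z).1 hz).1 ((hmem z).1 hz).2.1,
    Finset.sum_congr rfl fun z hz => hF2 z ((hmem z).1 hz).1 ((hmem z).1 hz).2.1] at h2
  have h3 : 0 ≤ ∑ A ∈ Z.image (fun z => ({0, z} : Finset (Site d))) ∩
      Z.image (fun z => ({e, z} : Finset (Site d))), F A := Finset.sum_nonneg fun A _ => hF0 A
  have h4 : ∑ A ∈ Z.image (fun z => ({0, z} : Finset (Site d))) ∪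
      Z.image (fun z => ({e, z} : Finset (Site d))), F A ≤
      2 * ∑ z ∈ W, (H (z - e) - H z) ^ 2 := by linarith
  exact h4

end PairFunction

section Drift

variable {d : ℕ} [NeZero d]

/-- The sign with which the Walsh function of `A` is multiplied at `y`. -/
def driftSign (y : Site d) (A : Finset (Site d)) : ℝ := if y ∈ A then -1 else 1

/-- The asymmetric part of the generator, seen from the bond along which the particle jumps. -/
lemma hasSum_drift (f g : WalshSpace d) :
    HasSum (fun A => hat f A *
      ((if 0 ∈ A then driftSign (unitVec 0) A * hat g (flip (unitVec 0) A) else 0) -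
        if unitVec 0 ∈ A then driftSign 0 A * hat g (flip 0 A) else 0))
      (ev (fun A => ∑' y, drift y A * hat g (flip y A)) f) := by
  have hinv : ∀ (z : Site d) A x, driftSign (z + x) (z +ᵥ A) = driftSign x A := fun z A x => by
    simp [driftSign]
  have h1 := hasSum_hat_mul (ψ := fun A y =>
      if y - unitVec 0 ∈ A then driftSign y A * hat g (flip y A) else 0)
    (fun z A x => by
      simp only [mem_vadd, hinv, flip_vadd, hat_vadd]
      congr 2
      abel_nf) (fun x => by simp)
    (fun A => (driftSites A).finite_toSet.subset fun y hy => by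
      by_contra h
      rw [SetLike.mem_coe, mem_driftSites, not_or] at h
      exact hy (if_neg h.1)) f (unitVec 0)
  have h2 := hasSum_hat_mul (ψ := fun A y =>
      if y + unitVec 0 ∈ A then driftSign y A * hat g (flip y A) else 0)
    (fun z A x => by
      simp only [mem_vadd, hinv, flip_vadd, hat_vadd]
      congr 2
      abel_nf) (fun x => by simp)
    (fun A => (driftSites A).finite_toSet.subset fun y hy => by
      by_contra h
      rw [SetLike.mem_coe, mem_driftSites, not_or] at h
      exact hy (if_neg h.2)) f 0
  have h3 : (fun A => ∑' y, drift y A * hat g (flip y A)) = fun A =>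
      (∑' y, if y - unitVec 0 ∈ A then driftSign y A * hat g (flip y A) else 0) -
        ∑' y, if y + unitVec 0 ∈ A then driftSign y A * hat g (flip y A) else 0 := by
    funext A
    rw [← Summable.tsum_sub]
    · refine tsum_congr fun y => ?_
      simp only [drift, driftSign]
      split_ifs <;> ring
    · refine summable_of_hasFiniteSupport ((driftSites A).finite_toSet.subset fun y hy => ?_)
      by_contra h
      rw [SetLike.mem_coe, mem_driftSites, not_or] at h
      exact hy (if_neg h.1)
    · refine summable_of_hasFiniteSupport ((driftSites A).finite_toSet.subset fun y hy => ?_)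
      by_contra h
      rw [SetLike.mem_coe, mem_driftSites, not_or] at h
      exact hy (if_neg h.2)
  rw [h3, ev_sub]
  refine (h1.sub h2).congr_fun fun A => ?_
  rw [sub_self, zero_add, mul_sub]

/-- The three sites `0`, `e_0` and `z`. -/
def triple (z : Site d) : Finset (Site d) := {0, unitVec 0, z}

lemma card_triple {z : Site d} (h0 : z ≠ 0) (h1 : z ≠ unitVec 0) : (triple z).card = 3 := by
  rw [triple, Finset.card_insert_of_notMem, Finset.card_pair h1.symm]
  simp only [Finset.mem_insert, Finset.mem_singleton, not_or]
  exact ⟨(unitVec_ne_zero 0).symm, h0.symm⟩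

/-- The asymmetric part of the generator maps pair functions to functions of three sites: the
components with one site cancel. Only the triples that contain a bond along the drift occur, with the
gradient of `H` in that direction. -/
lemma ev_drift_pairSum {H : Site d → ℝ} (heven : ∀ y, H (-y) = H y) {W : Finset (Site d)}
    (hW : ∀ y, y ∉ W → H y = 0) (hW' : ∀ y, y ∉ W → H (y - unitVec 0) = 0) (f : WalshSpace d) :
    ev (fun A => ∑' y, drift y A * hat (pairSum H W) (flip y A)) f =
      ∑ z ∈ (W.erase 0).erase (unitVec 0), hat f (triple z) * (H (z - unitVec 0) - H z) := by
  set e : Site d := unitVec 0 with he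
  have he0 : e ≠ 0 := unitVec_ne_zero 0
  set Z : Finset (Site d) := (W.erase 0).erase e with hZ
  have hmem : ∀ z, z ∈ Z ↔ z ≠ e ∧ z ≠ 0 ∧ z ∈ W := fun z => by simp [hZ]
  set G := hat (pairSum H W) with hG
  have h1 := hasSum_drift f (pairSum H W)
  rw [← he, ← hG] at h1
  -- The sets of one site contribute two terms, which cancel.
  have h2 : HasSum (fun A : Finset (Site d) => (if A = {0} then hat f {0} * H e else 0) -
      if A = {e} then hat f {e} * H e else 0) 0 := by
    have h3 := (hasSum_ite_eq ({0} : Finset (Site d)) (hat f {0} * H e)).sub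
      (hasSum_ite_eq ({e} : Finset (Site d)) (hat f {e} * H e))
    have h4 : hat f {e} = hat f {0} := by
      rw [he, ← vadd_singleton_zero (unitVec 0 : Site d), hat_vadd]
    rw [h4, sub_self] at h3
    rw [h4]
    exact h3
  have h3 := (h1.sub h2).unique (hasSum_sum_of_ne_finset_zero (s := Z.image triple) fun A hA => ?_)
  · rw [sub_zero] at h3
    rw [h3, Finset.sum_image]
    · refine Finset.sum_congr rfl fun z hz => ?_
      obtain ⟨hz1, hz0, -⟩ := (hmem z).1 hz
      have hc := card_triple hz0 hz1
      have hm0 : (0 : Site d) ∈ triple z := by simp [triple]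
      have hm1 : e ∈ triple z := by simp [triple, ← he]
      have hne : ∀ w : Site d, triple z ≠ {w} := fun w h => by simp [h] at hc
      have hf0 : flip 0 (triple z) = {e, z} := by
        rw [flip_of_mem hm0, triple, ← he, Finset.erase_insert]
        simp [he0.symm, hz0.symm]
      have hf1 : flip e (triple z) = {0, z} := by
        rw [flip_of_mem hm1, triple, ← he, Finset.insert_comm, Finset.erase_insert]
        simp [he0, hz1.symm]
      rw [if_pos hm0, if_pos hm1, if_neg (hne 0), if_neg (hne e), hf0, hf1,
        hG, hat_pairSum_pair heven hW hz0.symm, hat_pairSum_pair heven hW hz1.symm, driftSign,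
        driftSign, if_pos hm0, if_pos hm1, sub_zero]
      ring
    · intro z hz w hw h
      obtain ⟨hz1, hz0, -⟩ := (hmem z).1 hz
      have h4 : z ∈ triple w := h ▸ by simp [triple]
      simp only [triple, Finset.mem_insert, Finset.mem_singleton] at h4
      rcases h4 with h4 | h4 | h4
      · exact absurd h4 hz0
      · exact absurd h4 hz1
      · exact h4
  · have hG2 : ∀ B : Finset (Site d), B.card ≠ 2 → G B = 0 := fun B hB => hat_pairSum_of_card_ne hB
    by_cases h0 : (0 : Site d) ∈ A <;> by_cases h1 : e ∈ A
    · have hne : ∀ w, (w = 0 ∨ w = e) → A ≠ {w} := fun w hw h => by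
        rw [h, Finset.mem_singleton] at h0 h1
        exact he0 (h1.trans h0.symm)
      rw [if_neg (hne 0 (Or.inl rfl)), if_neg (hne e (Or.inr rfl)), if_pos h0, if_pos h1]
      by_cases hc : A.card = 3
      · have hc2 : ((A.erase 0).erase e).card = 1 := by
          rw [Finset.card_erase_of_mem (Finset.mem_erase.2 ⟨he0, h1⟩),
            Finset.card_erase_of_mem h0, hc]
        obtain ⟨z, hz⟩ := Finset.card_eq_one.1 hc2
        have hzA : z ∈ (A.erase 0).erase e := hz ▸ Finset.mem_singleton_self z
        have hz1 : z ≠ e := Finset.ne_of_mem_erase hzA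
        have hz0 : z ≠ 0 := Finset.ne_of_mem_erase (Finset.mem_of_mem_erase hzA)
        have hA1 : A.erase 0 = {e, z} := by
          rw [← Finset.insert_erase (Finset.mem_erase.2 ⟨he0, h1⟩), hz]
        have hA2 : A = triple z := by
          rw [← Finset.insert_erase h0, hA1]; rfl
        have hA3 : A.erase e = {0, z} := by
          rw [hA2, triple, ← he, Finset.insert_comm, Finset.erase_insert]
          simp [he0, hz1.symm]
        have hzW : z ∉ W := fun h => hA (hA2 ▸ Finset.mem_image_of_mem _ ((hmem z).2 ⟨hz1, hz0, h⟩))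
        rw [flip_of_mem h0, flip_of_mem h1, hA1, hA3, hG, hat_pairSum_pair heven hW hz0.symm,
          hat_pairSum_pair heven hW hz1.symm, sub_zero, hW z hzW, hW' z hzW]
        ring
      · have hcard : ∀ w ∈ A, (A.erase w).card ≠ 2 := fun w hw h => by
          rw [Finset.card_erase_of_mem hw] at h
          omega
        rw [flip_of_mem h0, flip_of_mem h1, hG2 _ (hcard 0 h0), hG2 _ (hcard e h1)]
        ring
    · have hne : A ≠ {e} := fun h => h1 (by simp [h])
      rw [if_pos h0, if_neg h1, if_neg hne, flip_of_notMem h1, driftSign, if_neg h1]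
      split_ifs with h4
      · rw [h4, hG, hat_pairSum_pair heven hW he0, ← heven]
        simp
      · rw [hG2]
        · ring
        · rw [Finset.card_insert_of_notMem h1]
          intro h5
          obtain ⟨w, rfl⟩ := Finset.card_eq_one.1 (by omega : A.card = 1)
          exact h4 (by rw [Finset.mem_singleton.1 h0])
    · have hne : A ≠ {0} := fun h => h0 (by simp [h])
      rw [if_pos h1, if_neg h0, if_neg hne, flip_of_notMem h0, driftSign, if_neg h0]
      split_ifs with h4
      · rw [h4, hG, hat_pairSum_pair heven hW he0.symm]
        simp
      · rw [hG2]
        · ring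
        · rw [Finset.card_insert_of_notMem h0]
          intro h5
          obtain ⟨w, rfl⟩ := Finset.card_eq_one.1 (by omega : A.card = 1)
          exact h4 (by rw [Finset.mem_singleton.1 h1])
    · have hne : ∀ w, (w = 0 ∨ w = e) → A ≠ {w} := fun w hw h => by
        rcases hw with rfl | rfl
        · exact h0 (by simp [h])
        · exact h1 (by simp [h])
      rw [if_neg h0, if_neg h1, if_neg (hne 0 (Or.inl rfl)), if_neg (hne e (Or.inr rfl))]
      ring

variable {U : Finset (Site d) → ℝ → Finset (Site d) → ℝ}

/-- The lower bound for the autocorrelation of the current from a pair function: the price for the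
asymmetric part of the generator is a trace inequality for functions of three sites. -/
theorem IsCorrelation.sq_le_laplace (hU : IsCorrelation U) {lam : ℝ} (hlam : 0 < lam)
    {H : Site d → ℝ} (heven : ∀ y, H (-y) = H y) {W : Finset (Site d)}
    (hW : ∀ y, y ∉ W → H y = 0) (hW' : ∀ i y, y ∉ W → H (y - unitVec i) = 0) {T : ℝ}
    (htrace : ∀ (f : WalshSpace d) (Z : Finset (Site d)), 0 ∉ Z → unitVec 0 ∉ Z →
      ∑ z ∈ Z, hat f (triple z) ^ 2 ≤ T * energy lam f f) :
    H (unitVec 0) ^ 2 ≤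
      (lam * ∑ y ∈ W, H y ^ 2 + ∑ i, ∑ y ∈ W, (H (y - unitVec i) - H y) ^ 2 +
        T / 2 * ∑ y ∈ W, (H (y - unitVec 0) - H y) ^ 2) *
      ∫ s in Set.Ioi (0 : ℝ), Real.exp (-lam * s) * moment U driftBond 0 s driftBond := by
  have h0 := (unitVec_ne_zero (d := d) 0).symm
  have h1 : hat (pairSum H W) driftBond = H (unitVec 0) := by
    rw [driftBond, hat_pairSum_pair heven hW h0, sub_zero]
  rw [← h1]
  refine hU.sq_hat_le_laplace driftBond_nonempty hlam fun f => ?_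
  rw [inner_resolvent_self, inner_resolvent, ev_drift_pairSum heven hW (hW' 0)]
  set Z := (W.erase 0).erase (unitVec 0) with hZ
  set N := energy lam f f with hN
  have hN0 : 0 ≤ N := energy_self_nonneg hlam.le f
  have h2 : energy lam f (pairSum H W) ^ 2 ≤ N * (lam / 2 * ∑ y ∈ W, H y ^ 2 +
      1 / 2 * ∑ i, ∑ y ∈ W, (H (y - unitVec i) - H y) ^ 2) := by
    refine (sq_energy_le hlam.le f _).trans (mul_le_mul_of_nonneg_left ?_ hN0)
    have h3 := Finset.sum_le_sum fun i (_ : i ∈ Finset.univ) =>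
      dirichlet_pairSum_le heven i hW (hW' i)
    rw [← Finset.mul_sum] at h3
    have h4 := mul_le_mul_of_nonneg_left (inner_pairSum_self_le heven hW) hlam.le
    unfold energy
    linarith
  have h3 : (∑ z ∈ Z, hat f (triple z) * (H (z - unitVec 0) - H z)) ^ 2 ≤
      T * N * ∑ y ∈ W, (H (y - unitVec 0) - H y) ^ 2 := by
    -- The Cauchy–Schwarz inequality, then the trace inequality for the first factor.
    refine (Finset.sum_mul_sq_le_sq_mul_sq _ _ _).trans ?_
    have h4 := htrace f Z (by simp [hZ]) (by simp [hZ])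
    refine mul_le_mul h4 (Finset.sum_le_sum_of_subset_of_nonneg
      ((Finset.erase_subset _ _).trans (Finset.erase_subset _ _)) fun _ _ _ => sq_nonneg _)
      (Finset.sum_nonneg fun _ _ => sq_nonneg _) ?_
    exact (Finset.sum_nonneg fun _ _ => sq_nonneg _).trans h4
  -- `(a - b / 2) ^ 2 ≤ 2 a ^ 2 + b ^ 2 / 2`
  nlinarith [sq_nonneg (energy lam f (pairSum H W) +
    1 / 2 * ∑ z ∈ Z, hat f (triple z) * (H (z - unitVec 0) - H z))]

end Drift

/-! ### The trace inequality -/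

section Trace

variable {d : ℕ}

/-- A sum over sets with a marked site, moved so that the marked site becomes the origin, is
controlled by the sum over all sets if all the sets share a site `c`: a set `B` arises at most once
for each of the places in `B` to which `c` can have been moved. -/
lemma sum_neg_vadd_le {κ : Type*} {g : Finset (Site d) → ℝ} {E : ℝ} (hg : ∀ A, 0 ≤ g A)
    (hE : HasSum g E) (s : Finset κ) (A : κ → Finset (Site d)) (x : κ → Site d) (c : Site d)
    (hinj : Set.InjOn (fun k => (A k, x k)) s) (hc : ∀ k ∈ s, c ∈ A k)
    (hcard : ∀ k ∈ s, (A k).card ≤ 3) : ∑ k ∈ s, g (-x k +ᵥ A k) ≤ 3 * E := by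
  classical
  rw [Finset.sum_comp g fun k => -x k +ᵥ A k]
  have h1 : ∀ B ∈ s.image (fun k => -x k +ᵥ A k),
      (s.filter fun k => -x k +ᵥ A k = B).card • g B ≤ 3 * g B := fun B hB => by
    obtain ⟨k₀, hk₀, rfl⟩ := Finset.mem_image.1 hB
    rw [nsmul_eq_mul]
    refine mul_le_mul_of_nonneg_right ?_ (hg _)
    have h2 : (s.filter fun k => -x k +ᵥ A k = -x k₀ +ᵥ A k₀).card ≤ (-x k₀ +ᵥ A k₀).card := by
      refine Finset.card_le_card_of_injOn (fun k => c - x k) (fun k hk => ?_)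
        fun k hk l hl hkl => ?_
      · rw [Finset.mem_coe, Finset.mem_filter] at hk
        rw [Finset.mem_coe, ← hk.2, mem_vadd, sub_neg_eq_add, sub_add_cancel]
        exact hc k hk.1
      · rw [Finset.mem_coe, Finset.mem_filter] at hk hl
        have hx : x k = x l := sub_right_injective hkl
        refine hinj hk.1 hl.1 (Prod.ext ?_ hx)
        have h3 := hk.2.trans hl.2.symm
        rw [hx] at h3
        exact (vadd_left_cancel_iff _).1 h3
    rw [Finset.card_vadd_finset] at h2
    exact_mod_cast h2.trans (hcard k₀ hk₀)
  refine (Finset.sum_le_sum h1).trans ?_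
  rw [← Finset.mul_sum]
  exact mul_le_mul_of_nonneg_left (sum_le_hasSum _ (fun _ _ => hg _) hE) (by norm_num)

/-- The norm as a sum over the sets that contain the origin, each class being counted once for each of
its sites. -/
lemma hasSum_norm_sq (f : WalshSpace d) :
    HasSum (fun A => if (0 : Site d) ∈ A then hat f A ^ 2 / A.card else 0)
      (inner ℝ (toClass f) (toClass f)) := by
  have h1 := hasSum_hat_mul (ψ := fun A x => if x ∈ A then hat f A / A.card else 0)
    (fun z A x => by simp) (fun x => by simp)
    (fun A => A.finite_toSet.subset fun x hx => by
      by_contra h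
      exact hx (if_neg h)) f 0
  have h2 : ∀ A : Finset (Site d), ∑' x, (if x ∈ A then hat f A / A.card else 0) = hat f A :=
    fun A => by
      rw [tsum_eq_sum (s := A) fun x hx => if_neg hx, Finset.sum_congr rfl fun x hx => if_pos hx,
        Finset.sum_const, nsmul_eq_mul]
      rcases A.eq_empty_or_nonempty with rfl | hA
      · simp [hat_empty]
      · have : (A.card : ℝ) ≠ 0 := by exact_mod_cast hA.card_pos.ne'
        field_simp
  simp only [h2] at h1
  rw [inner_toClass]
  refine h1.congr_fun fun A => ?_
  split_ifs <;> ring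

lemma card_three {a c z : Site d} (h1 : a ≠ c) (h2 : a ≠ z) (h3 : c ≠ z) :
    ({a, c, z} : Finset (Site d)).card = 3 := Finset.card_eq_three.2 ⟨a, c, z, h1, h2, h3, rfl⟩

/-- Three-point sets with a fixed site `c` are determined by another marked site and the third one. -/
lemma injOn_three {s : Finset (Site d × Site d)} {c : Site d}
    (hs : ∀ k ∈ s, k.2 ≠ c ∧ k.2 ≠ k.1) :
    Set.InjOn (fun k : Site d × Site d => (({k.1, c, k.2} : Finset (Site d)), k.1)) s := by
  rintro ⟨a, z⟩ hk ⟨b, w⟩ hl h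
  simp only [Prod.mk.injEq] at h
  obtain ⟨h1, rfl⟩ := h
  have hz : z ∈ ({a, c, w} : Finset (Site d)) := h1 ▸ by simp
  obtain ⟨h2, h3⟩ := hs _ hk
  simp only [Finset.mem_insert, Finset.mem_singleton] at hz
  rw [(hz.resolve_left h3).resolve_left h2]

/-- The values of `hat f` at the three-point sets with a common site are square summable with a bound
by the norm. -/
lemma sum_hat_sq_le (f : WalshSpace d) {s : Finset (Site d × Site d)} {c : Site d}
    (hs : ∀ k ∈ s, k.1 ≠ c ∧ k.2 ≠ c ∧ k.2 ≠ k.1) :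
    ∑ k ∈ s, hat f {k.1, c, k.2} ^ 2 ≤ 9 * inner ℝ (toClass f) (toClass f) := by
  have h1 := sum_neg_vadd_le (fun A => by split_ifs <;> positivity) (hasSum_norm_sq f) s
    (fun k => {k.1, c, k.2}) (fun k => k.1) c (injOn_three fun k hk => (hs k hk).2)
    (fun k _ => by simp)
    fun k hk => (card_three (hs k hk).1 (hs k hk).2.2.symm (hs k hk).2.1.symm).le
  have h2 : ∀ k ∈ s, (if (0 : Site d) ∈ -k.1 +ᵥ ({k.1, c, k.2} : Finset (Site d)) then
      hat f (-k.1 +ᵥ ({k.1, c, k.2} : Finset (Site d))) ^ 2 /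
        (-k.1 +ᵥ ({k.1, c, k.2} : Finset (Site d))).card else 0) =
      1 / 3 * hat f {k.1, c, k.2} ^ 2 := fun k hk => by
    rw [if_pos (by rw [mem_vadd]; simp), hat_vadd, Finset.card_vadd_finset,
      card_three (hs k hk).1 (hs k hk).2.2.symm (hs k hk).2.1.symm]
    push_cast
    ring
  rw [Finset.sum_congr rfl h2, ← Finset.mul_sum] at h1
  linarith

/-- The gradient of `hat f` in one site of a three-point set, while the other two stay, is bounded by
the Dirichlet form. -/
lemma sum_gradient_sq_le (f : WalshSpace d) (i : Fin d) {s : Finset (Site d × Site d)} {c : Site d}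
    (hs : ∀ k ∈ s, k.2 ≠ c ∧ k.1 ≠ c ∧ k.2 ≠ k.1 ∧ k.1 + unitVec i ≠ c ∧ k.1 + unitVec i ≠ k.2) :
    ∑ k ∈ s, (hat f {k.1 + unitVec i, c, k.2} - hat f {k.1, c, k.2}) ^ 2 ≤
      3 * dirichlet i f f := by
  have h0 : HasSum (fun A => (hat f (swapSet 0 (unitVec i) A) - hat f A) ^ 2) (dirichlet i f f) := by
    simpa only [sq] using (hasSum_dirichlet i f f).1
  have h1 := sum_neg_vadd_le (fun A => sq_nonneg _) h0 s
    (fun k => {k.1, c, k.2}) (fun k => k.1) c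
    (injOn_three fun k hk => ⟨(hs k hk).1, (hs k hk).2.2.1⟩) (fun k _ => by simp)
    fun k hk => (card_three (hs k hk).2.1 (hs k hk).2.2.1.symm (hs k hk).1.symm).le
  refine le_trans (le_of_eq (Finset.sum_congr rfl fun k hk => ?_)) h1
  obtain ⟨h2, h3, h4, h5, h6⟩ := hs k hk
  have h7 := swapSet_vadd (-k.1) k.1 (k.1 + unitVec i) {k.1, c, k.2}
  rw [neg_add_cancel, neg_add_cancel_left] at h7
  have h8 : swapSet k.1 (k.1 + unitVec i) {k.1, c, k.2} = {k.1 + unitVec i, c, k.2} := by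
    rw [swapSet, Finset.map_insert, Finset.map_insert, Finset.map_singleton]
    simp [Equiv.swap_apply_of_ne_of_ne h3.symm h5.symm, Equiv.swap_apply_of_ne_of_ne h4 h6.symm]
  rw [h7, hat_vadd, hat_vadd, h8]

/-- A bound for the value of a function at the origin by its sum of squares over a finite set and
its gradient along finitely many bonds. -/
structure IsFlowBound (box : Finset (Site d)) (bonds : Fin d → Finset (Site d)) (α β : ℝ) :
    Prop where
  mem : ∀ i, ∀ x ∈ bonds i, x ∈ box ∧ x + unitVec i ∈ box
  le : ∀ u : Site d → ℝ, u 0 ^ 2 ≤ α * ∑ x ∈ box, u x ^ 2 +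
    β * ∑ i, ∑ x ∈ bonds i, (u (x + unitVec i) - u x) ^ 2

lemma IsFlowBound.neg {box : Finset (Site d)} {bonds : Fin d → Finset (Site d)} {α β : ℝ}
    (h : IsFlowBound box bonds α β) :
    IsFlowBound (box.image fun x => -x) (fun i => (bonds i).image fun x => -(x + unitVec i)) α β where
  mem i x hx := by
    obtain ⟨y, hy, rfl⟩ := Finset.mem_image.1 hx
    obtain ⟨h1, h2⟩ := h.mem i y hy
    refine ⟨Finset.mem_image_of_mem _ h2, ?_⟩
    rw [neg_add, neg_add_cancel_right]
    exact Finset.mem_image_of_mem _ h1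
  le u := by
    have h1 := h.le fun x => u (-x)
    rw [neg_zero] at h1
    rw [Finset.sum_image fun x _ y _ hxy => neg_injective hxy]
    refine h1.trans (le_of_eq ?_)
    congr 2
    refine Finset.sum_congr rfl fun i _ => ?_
    rw [Finset.sum_image fun x _ y _ hxy => by simpa using hxy]
    refine Finset.sum_congr rfl fun x _ => ?_
    rw [neg_add, neg_add_cancel_right]
    ring

/-- The bound at the origin is applied to `x ↦ hat f {x, c, z}` for each `z` and summed: the particle
at `x` can move along the flow without meeting the other two. -/
lemma IsFlowBound.sum_hat_sq_le {box : Finset (Site d)} {bonds : Fin d → Finset (Site d)} {α β : ℝ}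
    (h : IsFlowBound box bonds α β) (hα : 0 ≤ α) (hβ : 0 ≤ β) (f : WalshSpace d) {c : Site d}
    {Z : Finset (Site d)} (hc : c ∉ box) (hcZ : c ∉ Z) (hZ : ∀ z ∈ Z, z ∉ box) :
    ∑ z ∈ Z, hat f {0, c, z} ^ 2 ≤ 9 * α * inner ℝ (toClass f) (toClass f) +
      3 * β * ∑ i, dirichlet i f f := by
  have h1 := Exclusion.sum_hat_sq_le f (s := box ×ˢ Z) (c := c) fun k hk => by
    obtain ⟨hk1, hk2⟩ := Finset.mem_product.1 hk
    exact ⟨fun h => hc (h ▸ hk1), fun h => hcZ (h ▸ hk2), fun h => hZ _ hk2 (h ▸ hk1)⟩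
  have h2 : ∀ i, ∑ k ∈ bonds i ×ˢ Z, (hat f {k.1 + unitVec i, c, k.2} - hat f {k.1, c, k.2}) ^ 2 ≤
      3 * dirichlet i f f := fun i => sum_gradient_sq_le f i fun k hk => by
    obtain ⟨hk1, hk2⟩ := Finset.mem_product.1 hk
    obtain ⟨hk3, hk4⟩ := h.mem i _ hk1
    exact ⟨fun h => hcZ (h ▸ hk2), fun h => hc (h ▸ hk3), fun h => hZ _ hk2 (h ▸ hk3),
      fun h => hc (h ▸ hk4), fun h => hZ _ hk2 (h ▸ hk4)⟩
  have h3 := Finset.sum_le_sum fun z (_ : z ∈ Z) => h.le fun x => hat f {x, c, z}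
  refine h3.trans ?_
  rw [Finset.sum_add_distrib, ← Finset.mul_sum, ← Finset.mul_sum, Finset.sum_comm,
    ← Finset.sum_product' (f := fun x z => hat f {x, c, z} ^ 2)]
  have h4 : ∑ z ∈ Z, ∑ i, ∑ x ∈ bonds i, (hat f {x + unitVec i, c, z} - hat f {x, c, z}) ^ 2 =
      ∑ i, ∑ k ∈ bonds i ×ˢ Z, (hat f {k.1 + unitVec i, c, k.2} - hat f {k.1, c, k.2}) ^ 2 := by
    rw [Finset.sum_comm]
    refine Finset.sum_congr rfl fun i _ => ?_
    rw [Finset.sum_comm, ← Finset.sum_product'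
      (f := fun x z => (hat f {x + unitVec i, c, z} - hat f {x, c, z}) ^ 2)]
  rw [h4]
  have h5 := Finset.sum_le_sum fun i (_ : i ∈ Finset.univ) => h2 i
  rw [← Finset.mul_sum] at h5
  have h6 := mul_le_mul_of_nonneg_left h1 hα
  have h7 := mul_le_mul_of_nonneg_left h5 hβ
  linarith

variable [NeZero d]

/-- The trace inequality: the values of `hat f` at the triples that contain a bond along the drift are
controlled by the energy. If the third particle is on one side of the bond, then the particle at
the other end of the bond is free to move away on its side. -/
lemma IsFlowBound.trace {box : Finset (Site d)} {bonds : Fin d → Finset (Site d)} {α β : ℝ}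
    (h : IsFlowBound box bonds α β) (hbox : ∀ x ∈ box, 0 ≤ x 0) (hα : 0 ≤ α) (hβ : 0 ≤ β)
    {lam T : ℝ} (hT : 9 * α ≤ T * lam) (hT' : 12 * β ≤ T) (f : WalshSpace d)
    (Z : Finset (Site d)) (h0 : 0 ∉ Z) (he : unitVec 0 ∉ Z) :
    ∑ z ∈ Z, hat f (triple z) ^ 2 ≤ 2 * T * energy lam f f := by
  have hbound : 9 * α * inner ℝ (toClass f) (toClass f) + 3 * β * ∑ i, dirichlet i f f ≤
      T * energy lam f f := by
    have h1 : 0 ≤ inner ℝ (toClass f) (toClass f) := real_inner_self_nonneg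
    have h2 := Finset.sum_nonneg fun i (_ : i ∈ Finset.univ) => dirichlet_self_nonneg i f
    have h3 := mul_le_mul_of_nonneg_right hT h1
    have h4 := mul_le_mul_of_nonneg_right hT' h2
    unfold energy
    linarith
  have he0 : (unitVec 0 : Site d) 0 = 1 := by simp [unitVec]
  rw [← Finset.sum_filter_add_sum_filter_not Z fun z => z 0 ≤ 0]
  have h1 : ∑ z ∈ Z.filter fun z => z 0 ≤ 0, hat f (triple z) ^ 2 ≤ T * energy lam f f := by
    -- The triple is translated by `-e_0`, so that the moving particle starts from the origin.
    refine le_trans (le_of_eq ?_) ((h.sum_hat_sq_le hα hβ f (c := -unitVec 0)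
      (Z := (Z.filter fun z => z 0 ≤ 0).image fun z => z - unitVec 0) (fun hc => ?_) (fun hc => ?_)
      fun z hz hzb => ?_).trans hbound)
    · rw [Finset.sum_image fun x _ y _ hxy => sub_left_injective hxy]
      refine Finset.sum_congr rfl fun z _ => ?_
      rw [← hat_vadd f (unitVec 0) {0, -unitVec 0, z - unitVec 0}]
      congr 2
      ext x
      simp only [triple, Finset.mem_insert, Finset.mem_singleton, mem_vadd, sub_eq_iff_eq_add]
      simp only [zero_add, neg_add_cancel, sub_add_cancel]
      tauto
    · have := hbox _ hc
      rw [Pi.neg_apply, he0] at this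
      omega
    · obtain ⟨z, hz, hz'⟩ := Finset.mem_image.1 hc
      have : z = 0 := by simpa [sub_eq_iff_eq_add] using hz'
      exact h0 (this ▸ (Finset.mem_filter.1 hz).1)
    · obtain ⟨w, hw, rfl⟩ := Finset.mem_image.1 hz
      have h1 := (Finset.mem_filter.1 hw).2
      have h2 := hbox _ hzb
      rw [Pi.sub_apply, he0] at h2
      omega
  -- For `z` on the right the particle at the origin moves to the left, by the reflected flow.
  have h2 : ∑ z ∈ Z.filter fun z => ¬ z 0 ≤ 0, hat f (triple z) ^ 2 ≤ T * energy lam f f := by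
    have hbox' : ∀ x ∈ box.image (fun x => -x), x 0 ≤ 0 := fun x hx => by
      obtain ⟨y, hy, rfl⟩ := Finset.mem_image.1 hx
      have := hbox y hy
      rw [Pi.neg_apply]
      omega
    refine (h.neg.sum_hat_sq_le hα hβ f (c := unitVec 0)
      (Z := Z.filter fun z => ¬ z 0 ≤ 0) (fun hc => ?_) (fun hc => ?_)
      fun z hz hzb => ?_).trans hbound
    · have := hbox' _ hc
      rw [he0] at this
      omega
    · exact he (Finset.mem_filter.1 hc).1
    · exact (Finset.mem_filter.1 hz).2 (hbox' z hzb)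
  linarith

end Trace

section Flow

/-- In one dimension: compare the value at the origin with the average over an interval. -/
lemma isFlowBound_one (R : ℕ) :
    IsFlowBound ((Finset.range (R + 1)).image fun (n : ℕ) (_ : Fin 1) => (n : ℤ))
      (fun _ => (Finset.range R).image fun (n : ℕ) (_ : Fin 1) => (n : ℤ))
      (2 / (R + 1)) (2 * R) := by
  have hinj : Function.Injective fun (n : ℕ) (_ : Fin 1) => (n : ℤ) := fun m n h => by
    have := congrFun h 0
    simpa using this
  have hsucc : ∀ n : ℕ, (fun _ : Fin 1 => (n : ℤ)) + unitVec 0 = fun _ => ((n + 1 : ℕ) : ℤ) :=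
    fun n => by
      funext i
      simp [unitVec, Subsingleton.elim i 0]
  refine ⟨fun i x hx => ?_, fun u => ?_⟩
  · obtain ⟨n, hn, rfl⟩ := Finset.mem_image.1 hx
    rw [Finset.mem_range] at hn
    rw [Subsingleton.elim i 0, hsucc]
    exact ⟨Finset.mem_image_of_mem _ (Finset.mem_range.2 (by omega)),
      Finset.mem_image_of_mem _ (Finset.mem_range.2 (by omega))⟩
  · simp only [Finset.univ_unique, Finset.sum_singleton, Fin.default_eq_zero,
      Finset.sum_image hinj.injOn, hsucc]
    set v : ℕ → ℝ := fun n => u fun _ => (n : ℤ) with hv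
    change (v 0) ^ 2 ≤ 2 / (R + 1) * ∑ n ∈ Finset.range (R + 1), v n ^ 2 +
      2 * R * ∑ n ∈ Finset.range R, (v (n + 1) - v n) ^ 2
    set E := ∑ n ∈ Finset.range R, (v (n + 1) - v n) ^ 2 with hE
    have h1 : ∀ n ∈ Finset.range (R + 1), v 0 ^ 2 ≤ 2 * v n ^ 2 + 2 * R * E := fun n hn => by
      rw [Finset.mem_range] at hn
      have h2 : (v n - v 0) ^ 2 ≤ R * E := by
        rw [← Finset.sum_range_sub]
        refine (sq_sum_le_card_mul_sum_sq).trans ?_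
        rw [Finset.card_range]
        gcongr
        · exact_mod_cast (by omega : n ≤ R)
        · exact Finset.sum_le_sum_of_subset_of_nonneg
            (Finset.range_subset_range.2 (by omega)) fun _ _ _ => sq_nonneg _
      nlinarith [sq_nonneg (v n + (v n - v 0))]
    have h3 := Finset.sum_le_sum h1
    rw [Finset.sum_const, Finset.card_range, nsmul_eq_mul, Finset.sum_add_distrib, ← Finset.mul_sum,
      Finset.sum_const, Finset.card_range, nsmul_eq_mul] at h3
    push_cast at h3
    have h4 : (0 : ℝ) < R + 1 := by positivity
    refine le_of_mul_le_mul_left (h3.trans (le_of_eq ?_)) h4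
    field_simp

end Flow

section LayerFlow

variable (v : ℕ × ℕ → ℝ)

/-- The average of `v` over the `n`-th layer of the quadrant. -/
def layerMean (n : ℕ) : ℝ := (∑ p ∈ Finset.HasAntidiagonal.antidiagonal n, v p) / (n + 1)

/-- The sum of the squared gradients of `v` between two successive layers. -/
def layerEnergy (n : ℕ) : ℝ :=
  ∑ p ∈ Finset.HasAntidiagonal.antidiagonal n, ((v (p.1 + 1, p.2) - v p) ^ 2 + (v (p.1, p.2 + 1) - v p) ^ 2)

/-- The flow which goes from `(i, j)` to `(i + 1, j)` and `(i, j + 1)` with the probabilities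
`(i + 1) / (i + j + 2)` and `(j + 1) / (i + j + 2)` of Pólya's urn carries the uniform distribution
of each layer to that of the next one. -/
lemma layerMean_succ_sub (n : ℕ) :
    ((n : ℝ) + 1) * (n + 2) * (layerMean v (n + 1) - layerMean v n) =
      ∑ p ∈ Finset.HasAntidiagonal.antidiagonal n, (((p.1 : ℝ) + 1) * (v (p.1 + 1, p.2) - v p) +
        ((p.2 : ℝ) + 1) * (v (p.1, p.2 + 1) - v p)) := by
  have h1 : ∑ q ∈ Finset.HasAntidiagonal.antidiagonal (n + 1), (q.1 : ℝ) * v q =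
      ∑ p ∈ Finset.HasAntidiagonal.antidiagonal n, ((p.1 : ℝ) + 1) * v (p.1 + 1, p.2) := by
    rw [Finset.Nat.sum_antidiagonal_succ]; simp
  have h2 : ∑ q ∈ Finset.HasAntidiagonal.antidiagonal (n + 1), (q.2 : ℝ) * v q =
      ∑ p ∈ Finset.HasAntidiagonal.antidiagonal n, ((p.2 : ℝ) + 1) * v (p.1, p.2 + 1) := by
    rw [Finset.Nat.sum_antidiagonal_succ']; simp
  have h3 : ∑ q ∈ Finset.HasAntidiagonal.antidiagonal (n + 1), (q.1 : ℝ) * v q +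
      ∑ q ∈ Finset.HasAntidiagonal.antidiagonal (n + 1), (q.2 : ℝ) * v q =
      (n + 1) * ∑ q ∈ Finset.HasAntidiagonal.antidiagonal (n + 1), v q := by
    rw [← Finset.sum_add_distrib, Finset.mul_sum]
    refine Finset.sum_congr rfl fun q hq => ?_
    have : (q.1 : ℝ) + q.2 = n + 1 := by exact_mod_cast Finset.HasAntidiagonal.mem_antidiagonal.1 hq
    rw [← this]; ring
  have h4 : ∑ p ∈ Finset.HasAntidiagonal.antidiagonal n, (((p.1 : ℝ) + 1) * v p + ((p.2 : ℝ) + 1) * v p) =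
      (n + 2) * ∑ p ∈ Finset.HasAntidiagonal.antidiagonal n, v p := by
    rw [Finset.mul_sum]
    refine Finset.sum_congr rfl fun q hq => ?_
    have : (q.1 : ℝ) + q.2 = n := by exact_mod_cast Finset.HasAntidiagonal.mem_antidiagonal.1 hq
    rw [← this]; ring
  have h5 : ∑ p ∈ Finset.HasAntidiagonal.antidiagonal n, (((p.1 : ℝ) + 1) * (v (p.1 + 1, p.2) - v p) +
        ((p.2 : ℝ) + 1) * (v (p.1, p.2 + 1) - v p)) =
      ∑ p ∈ Finset.HasAntidiagonal.antidiagonal n, ((p.1 : ℝ) + 1) * v (p.1 + 1, p.2) +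
      ∑ p ∈ Finset.HasAntidiagonal.antidiagonal n, ((p.2 : ℝ) + 1) * v (p.1, p.2 + 1) -
      ∑ p ∈ Finset.HasAntidiagonal.antidiagonal n, (((p.1 : ℝ) + 1) * v p + ((p.2 : ℝ) + 1) * v p) := by
    rw [← Finset.sum_add_distrib, ← Finset.sum_sub_distrib]
    exact Finset.sum_congr rfl fun _ _ => by ring
  rw [h5, ← h1, ← h2, h3, h4, layerMean, layerMean]
  push_cast
  field_simp
  ring

lemma layerEnergy_nonneg (n : ℕ) : 0 ≤ layerEnergy v n :=
  Finset.sum_nonneg fun _ _ => by positivity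

/-- The flow through the bonds between the layers `n` and `n + 1` is of order `1 / n`, over `n` sites.
-/
lemma sq_layerMean_succ_sub_le (n : ℕ) :
    ((n : ℝ) + 1) * (layerMean v (n + 1) - layerMean v n) ^ 2 ≤ layerEnergy v n := by
  have h1 : (∑ p ∈ Finset.HasAntidiagonal.antidiagonal n, (((p.1 : ℝ) + 1) * (v (p.1 + 1, p.2) - v p) +
        ((p.2 : ℝ) + 1) * (v (p.1, p.2 + 1) - v p))) ^ 2 ≤
      ((n + 1) * (n + 2) ^ 2) * layerEnergy v n := by
    refine sq_sum_le_card_mul_sum_sq.trans ?_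
    rw [Finset.Nat.card_antidiagonal, layerEnergy, Finset.mul_sum, Finset.mul_sum]
    refine Finset.sum_le_sum fun p hp => ?_
    have h2 : (p.1 : ℝ) + p.2 = n := by exact_mod_cast Finset.HasAntidiagonal.mem_antidiagonal.1 hp
    push_cast
    rw [← h2]
    set a := v (p.1 + 1, p.2) - v p
    set b := v (p.1, p.2 + 1) - v p
    have h3 : (((p.1 : ℝ) + 1) * a + (p.2 + 1) * b) ^ 2 ≤
        ((p.1 : ℝ) + p.2 + 2) ^ 2 * (a ^ 2 + b ^ 2) := by
      have h4 : (((p.1 : ℝ) + 1) * a + (p.2 + 1) * b) ^ 2 ≤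
          (((p.1 : ℝ) + 1) ^ 2 + (p.2 + 1) ^ 2) * (a ^ 2 + b ^ 2) := by
        nlinarith [sq_nonneg (((p.1 : ℝ) + 1) * b - (p.2 + 1) * a)]
      refine h4.trans (mul_le_mul_of_nonneg_right ?_ (by positivity))
      nlinarith [mul_nonneg (p.1.cast_nonneg (α := ℝ)) (p.2.cast_nonneg (α := ℝ)),
        p.1.cast_nonneg (α := ℝ), p.2.cast_nonneg (α := ℝ)]
    calc _ ≤ ((p.1 : ℝ) + p.2 + 1) * (((p.1 : ℝ) + p.2 + 2) ^ 2 * (a ^ 2 + b ^ 2)) := by gcongr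
      _ = _ := by ring
  rw [← layerMean_succ_sub] at h1
  have h2 : (0 : ℝ) < (n + 1) * (n + 2) ^ 2 := by positivity
  refine le_of_mul_le_mul_left (le_trans (le_of_eq ?_) h1) h2
  ring

/-- The Cauchy–Schwarz inequality with the resistances `1 / (k + 1)` of the layers, whose sum is
logarithmic. -/
lemma sq_layerMean_sub_le {n R : ℕ} (hn : n ≤ R) :
    (layerMean v n - layerMean v 0) ^ 2 ≤
      (1 + Real.log R) * ∑ k ∈ Finset.range R, layerEnergy v k := by
  have h0 : ∀ k ∈ Finset.range n, (0 : ℝ) ≤ ((k : ℝ) + 1)⁻¹ := fun k _ => by positivity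
  have h1 := Finset.sum_sq_le_sum_mul_sum_of_sq_le_mul (Finset.range n)
    (r := fun k => layerMean v (k + 1) - layerMean v k) (f := fun k => ((k : ℝ) + 1)⁻¹)
    (g := fun k => ((k : ℝ) + 1) * (layerMean v (k + 1) - layerMean v k) ^ 2)
    h0 (fun k _ => by positivity) fun k _ => le_of_eq (by field_simp)
  rw [Finset.sum_range_sub] at h1
  refine h1.trans (mul_le_mul ?_ ?_ (Finset.sum_nonneg fun k _ => by positivity) ?_)
  · have h2 := harmonic_le_one_add_log R
    rw [harmonic] at h2
    push_cast at h2
    refine le_trans (Finset.sum_le_sum_of_subset_of_nonneg (Finset.range_subset_range.2 hn)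
      fun k _ _ => by positivity) h2
  · refine (Finset.sum_le_sum fun k _ => sq_layerMean_succ_sub_le v k).trans ?_
    exact Finset.sum_le_sum_of_subset_of_nonneg (Finset.range_subset_range.2 hn)
      fun k _ _ => layerEnergy_nonneg v k
  · have := Real.log_natCast_nonneg R
    linarith

/-- The value at the corner is compared with the mean of each layer, and the layers are averaged with
their numbers of sites as weights. -/
lemma sq_zero_le_layers (R : ℕ) :
    v (0, 0) ^ 2 ≤
      4 / ((R : ℝ) + 1) ^ 2 * (∑ n ∈ Finset.range (R + 1), ∑ p ∈ Finset.HasAntidiagonal.antidiagonal n, v p ^ 2) +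
      2 * (1 + Real.log R) * ∑ k ∈ Finset.range R, layerEnergy v k := by
  set E := ∑ k ∈ Finset.range R, layerEnergy v k with hE
  set L := 1 + Real.log R with hL
  have h0 : layerMean v 0 = v (0, 0) := by simp [layerMean]
  have h1 : ∀ n ∈ Finset.range (R + 1), ((n : ℝ) + 1) * v (0, 0) ^ 2 ≤
      2 * ∑ p ∈ Finset.HasAntidiagonal.antidiagonal n, v p ^ 2 + ((n : ℝ) + 1) * (2 * (L * E)) := fun n hn => by
    have h2 := sq_layerMean_sub_le v (Nat.lt_succ_iff.1 (Finset.mem_range.1 hn))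
    rw [h0] at h2
    have h3 : ((n : ℝ) + 1) * layerMean v n ^ 2 ≤ ∑ p ∈ Finset.HasAntidiagonal.antidiagonal n, v p ^ 2 := by
      have h4 := sq_sum_le_card_mul_sum_sq (s := Finset.HasAntidiagonal.antidiagonal n) (f := v)
      rw [Finset.Nat.card_antidiagonal] at h4
      push_cast at h4
      have h5 : (0 : ℝ) < n + 1 := by positivity
      refine le_of_mul_le_mul_left (le_trans (le_of_eq ?_) h4) h5
      rw [layerMean]
      field_simp
    have h6 : v (0, 0) ^ 2 ≤ 2 * layerMean v n ^ 2 + 2 * (L * E) := by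
      nlinarith [sq_nonneg (layerMean v n + (layerMean v n - v (0, 0)))]
    have h7 : (0 : ℝ) ≤ n + 1 := by positivity
    have h8 := mul_le_mul_of_nonneg_left h6 h7
    linarith
  have h2 := Finset.sum_le_sum h1
  have h2' : ∑ n ∈ Finset.range (R + 1), (2 * ∑ p ∈ Finset.HasAntidiagonal.antidiagonal n, v p ^ 2 +
      ((n : ℝ) + 1) * (2 * (L * E))) =
      2 * (∑ n ∈ Finset.range (R + 1), ∑ p ∈ Finset.HasAntidiagonal.antidiagonal n, v p ^ 2) +
        (∑ n ∈ Finset.range (R + 1), ((n : ℝ) + 1)) * (2 * (L * E)) := by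
    clear_value E
    rw [Finset.mul_sum, Finset.sum_mul, ← Finset.sum_add_distrib]
  rw [← Finset.sum_mul, h2'] at h2
  have h3 : ((R : ℝ) + 1) ^ 2 / 2 ≤ ∑ n ∈ Finset.range (R + 1), ((n : ℝ) + 1) := by
    have h4 : ∀ m : ℕ, ∑ n ∈ Finset.range m, ((n : ℝ) + 1) = m * (m + 1) / 2 := fun m => by
      induction m with
      | zero => simp
      | succ m ih => rw [Finset.sum_range_succ, ih]; push_cast; ring
    rw [h4]
    push_cast
    have : (0 : ℝ) ≤ R := R.cast_nonneg
    nlinarith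
  set S := ∑ n ∈ Finset.range (R + 1), ((n : ℝ) + 1) with hS
  set Q := ∑ n ∈ Finset.range (R + 1), ∑ p ∈ Finset.HasAntidiagonal.antidiagonal n, v p ^ 2 with hQ
  have hR : (0 : ℝ) < ((R : ℝ) + 1) ^ 2 / 2 := by positivity
  have h4 : (((R : ℝ) + 1) ^ 2 / 2) * (v (0, 0) ^ 2 - 2 * (L * E)) ≤ 2 * Q := by
    rcases le_or_gt (v (0, 0) ^ 2 - 2 * (L * E)) 0 with h5 | h5
    · have hQ0 : 0 ≤ Q := Finset.sum_nonneg fun _ _ => Finset.sum_nonneg fun _ _ => sq_nonneg _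
      exact (mul_nonpos_of_nonneg_of_nonpos hR.le h5).trans (by positivity)
    · refine (mul_le_mul_of_nonneg_right h3 h5.le).trans ?_
      linarith
  have h5 : v (0, 0) ^ 2 - 2 * (L * E) ≤ 4 / ((R : ℝ) + 1) ^ 2 * Q := by
    refine le_of_mul_le_mul_left (h4.trans (le_of_eq ?_)) hR
    field_simp
    ring
  linarith

/-- In two dimensions: compare the value at the origin with the averages over the layers of a
triangle. -/
lemma isFlowBound_two (R : ℕ) :
    IsFlowBound (((Finset.range (R + 1)).biUnion fun n => Finset.HasAntidiagonal.antidiagonal n).image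
        fun p : ℕ × ℕ => (![(p.1 : ℤ), p.2] : Site 2))
      (fun _ => ((Finset.range R).biUnion fun n => Finset.HasAntidiagonal.antidiagonal n).image
        fun p : ℕ × ℕ => (![(p.1 : ℤ), p.2] : Site 2))
      (4 / ((R : ℝ) + 1) ^ 2) (2 * (1 + Real.log R)) := by
  have hinj : Function.Injective fun p : ℕ × ℕ => (![(p.1 : ℤ), p.2] : Site 2) := fun p q h => by
    have h0 := congrFun h 0
    have h1 := congrFun h 1
    simp only [Matrix.cons_val_zero, Matrix.cons_val_one] at h0 h1
    exact Prod.ext (by exact_mod_cast h0) (by exact_mod_cast h1)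
  have hs0 : ∀ p : ℕ × ℕ, (![(p.1 : ℤ), p.2] : Site 2) + unitVec 0 =
      ![((p.1 + 1 : ℕ) : ℤ), p.2] := fun p => by
    funext i; fin_cases i <;> simp [unitVec]
  have hs1 : ∀ p : ℕ × ℕ, (![(p.1 : ℤ), p.2] : Site 2) + unitVec 1 =
      ![(p.1 : ℤ), ((p.2 + 1 : ℕ) : ℤ)] := fun p => by
    funext i; fin_cases i <;> simp [unitVec]
  have hdisj : ∀ m : ℕ, Set.PairwiseDisjoint (Finset.range m : Set ℕ)
      fun n => Finset.HasAntidiagonal.antidiagonal n := fun m n _ k _ hnk =>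
    Finset.disjoint_left.2 fun p hp hq => hnk
      ((Finset.HasAntidiagonal.mem_antidiagonal.1 hp).symm.trans (Finset.HasAntidiagonal.mem_antidiagonal.1 hq))
  have hmem : ∀ m (p : ℕ × ℕ), p ∈ (Finset.range m).biUnion (fun n => Finset.HasAntidiagonal.antidiagonal n) ↔
      p.1 + p.2 < m := fun m p => by simp
  refine ⟨fun i x hx => ?_, fun u => ?_⟩
  · obtain ⟨p, hp, rfl⟩ := Finset.mem_image.1 hx
    rw [hmem] at hp
    refine ⟨Finset.mem_image_of_mem _ ((hmem _ _).2 (by omega)), ?_⟩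
    fin_cases i
    · exact Finset.mem_image.2 ⟨(p.1 + 1, p.2), (hmem _ _).2 (by dsimp only; omega), (hs0 p).symm⟩
    · exact Finset.mem_image.2 ⟨(p.1, p.2 + 1), (hmem _ _).2 (by dsimp only; omega), (hs1 p).symm⟩
  · have h1 := sq_zero_le_layers (fun p => u ![(p.1 : ℤ), p.2]) R
    have h0 : (![((0 : ℕ) : ℤ), ((0 : ℕ) : ℤ)] : Site 2) = 0 := by
      funext i; fin_cases i <;> rfl
    simp only [layerEnergy, Finset.sum_add_distrib] at h1
    rw [h0] at h1
    simp only [Fin.sum_univ_two, Finset.sum_image hinj.injOn, hs0, hs1,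
      Finset.sum_biUnion (hdisj _)]
    exact h1

end LayerFlow

/-! ### Cut-off functions -/

section Cutoff

variable {d : ℕ}

/-- The cube of the sites with all coordinates between `-N` and `N`. -/
def cube (d N : ℕ) : Finset (Site d) :=
  Fintype.piFinset fun _ => Finset.Icc (-(N : ℤ)) N

lemma mem_cube {N : ℕ} {y : Site d} : y ∈ cube d N ↔ ∀ j, |y j| ≤ N := by
  simp [cube, abs_le]

lemma card_cube (d N : ℕ) : (cube d N).card = (2 * N + 1) ^ d := by
  rw [cube, Fintype.card_piFinset_const, Int.card_Icc]
  congr 1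
  omega

/-- The cut-off function `max 0 (1 - g)`. -/
def cutoff (g : Site d → ℝ) (y : Site d) : ℝ := max 0 (1 - g y)

lemma cutoff_sq_le {g : Site d → ℝ} (hg : ∀ y, 0 ≤ g y) (y : Site d) : cutoff g y ^ 2 ≤ 1 := by
  have h1 : 0 ≤ cutoff g y := le_max_left _ _
  have h2 : cutoff g y ≤ 1 := max_le zero_le_one (by linarith [hg y])
  exact pow_le_one₀ h1 h2

lemma sq_cutoff_sub_le (g : Site d → ℝ) (x y : Site d) :
    (cutoff g x - cutoff g y) ^ 2 ≤ (g x - g y) ^ 2 := by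
  refine sq_le_sq.2 ?_
  have h1 := abs_max_sub_max_le_max 0 (1 - g x) 0 (1 - g y)
  rw [sub_self, abs_zero, sub_sub_sub_cancel_left, abs_sub_comm (g y)] at h1
  exact h1.trans (max_le (abs_nonneg _) le_rfl)

lemma cutoff_eq_zero {g : Site d → ℝ} {N : ℕ} (hN : ∀ (y : Site d) j, (N : ℤ) ≤ |y j| → 1 ≤ g y)
    {y : Site d} (hy : y ∉ cube d N) : cutoff g y = 0 := by
  rw [mem_cube] at hy
  push Not at hy
  obtain ⟨j, hj⟩ := hy
  exact max_eq_left (by linarith [hN y j hj.le])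

lemma cutoff_sub_eq_zero {g : Site d → ℝ} {N : ℕ}
    (hN : ∀ (y : Site d) j, (N : ℤ) ≤ |y j| → 1 ≤ g y)
    (i : Fin d) {y : Site d} (hy : y ∉ cube d N) : cutoff g (y - unitVec i) = 0 := by
  rw [mem_cube] at hy
  push Not at hy
  obtain ⟨j, hj⟩ := hy
  refine max_eq_left (sub_nonpos.2 (hN (y - unitVec i) j ?_))
  have h1 : |(unitVec i : Site d) j| ≤ 1 := by
    by_cases h : j = i
    · subst h; simp [unitVec]
    · simp [unitVec, h]
  have h2 := abs_sub_abs_le_abs_sub (y j) ((unitVec i : Site d) j)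
  rw [Pi.sub_apply]
  omega

variable [NeZero d] {Ω : Type*} [MeasurableSpace Ω] {P : Measure Ω} [IsProbabilityMeasure P]
  {𝓕 : Filtration ℝ≥0 ‹MeasurableSpace Ω›} {X : ℝ≥0 → Ω → Config d} {p : Site d → ℝ}

lemma summable_and_integrableOn (hp : IsDriftLaw p)
    (hX : IsEquilibriumExclusion p halfDensity P 𝓕 X) :
    (∀ t : ℝ≥0, Summable fun x : Site d => (x 0 : ℝ) * (x 0 : ℝ) * corr P X x t) ∧
      ∀ lam : ℝ, 0 < lam → IntegrableOn (fun t : ℝ => Real.exp (-lam * t) *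
        (t * diffusionCoeff halfDensity P X 0 0 t.toNNReal)) (Set.Ioi 0) := by
  have h := greenKubo hp hX fun t ht =>
    (isCorrelation_twoTime hp hX).abs_autocorrelation_le driftBond_nonempty ht
  exact ⟨h.1, fun lam hlam => (h.2 lam hlam).1⟩

/-- The lower bound for the mean square displacement which a cut-off function gives. The constant `K`
collects the norm, the Dirichlet form and the cost of the asymmetric part; the function has to be
close to `1` at `e_0`, where it is tested against the current. -/
theorem le_laplace_of_cutoff (hp : IsDriftLaw p) (hX : IsEquilibriumExclusion p halfDensity P 𝓕 X)
    {lam : ℝ} (hlam : 0 < lam) {g : Site d → ℝ} (hg : ∀ y, 0 ≤ g y) (heven : ∀ y, g (-y) = g y)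
    (hg1 : g (unitVec 0) ≤ 1 / 2) {N : ℕ} (hN : ∀ (y : Site d) j, (N : ℤ) ≤ |y j| → 1 ≤ g y)
    {T : ℝ} (hT : 0 ≤ T) (htrace : ∀ (f : WalshSpace d) (Z : Finset (Site d)), 0 ∉ Z →
      unitVec 0 ∉ Z → ∑ z ∈ Z, hat f (triple z) ^ 2 ≤ T * energy lam f f)
    {S : Fin d → ℝ} (hS : ∀ i, ∑ y ∈ cube d N, (g (y - unitVec i) - g y) ^ 2 ≤ S i) {K : ℝ}
    (hK : lam * (2 * N + 1) ^ d + ∑ i, S i + T / 2 * S 0 ≤ K) :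
    1 / (16 * K * lam ^ 2) ≤ ∫ t in Set.Ioi (0 : ℝ), Real.exp (-lam * t) *
      (t * diffusionCoeff halfDensity P X 0 0 t.toNNReal) := by
  have hU := isCorrelation_twoTime hp hX
  have h1 := hU.sq_le_laplace hlam (H := cutoff g) (W := cube d N)
    (fun y => by rw [cutoff, heven, cutoff]) (fun y hy => cutoff_eq_zero hN hy)
    (fun i y hy => cutoff_sub_eq_zero hN i hy) htrace
  rw [((greenKubo hp hX fun t ht => hU.abs_autocorrelation_le driftBond_nonempty ht).2 lam hlam).2]
  set J := ∫ t in Set.Ioi (0 : ℝ), Real.exp (-lam * t) *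
    moment (twoTime P X) driftBond 0 t driftBond with hJ
  have hgrad : ∀ i, ∑ y ∈ cube d N, (cutoff g (y - unitVec i) - cutoff g y) ^ 2 ≤ S i := fun i =>
    (Finset.sum_le_sum fun y _ => sq_cutoff_sub_le g _ _).trans (hS i)
  have hsq : ∑ y ∈ cube d N, cutoff g y ^ 2 ≤ (2 * N + 1) ^ d := by
    refine (Finset.sum_le_sum fun y _ => cutoff_sq_le hg y).trans (le_of_eq ?_)
    rw [Finset.sum_const, card_cube, nsmul_eq_mul, mul_one]
    push_cast
    rfl
  set K' := lam * ∑ y ∈ cube d N, cutoff g y ^ 2 +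
    ∑ i, ∑ y ∈ cube d N, (cutoff g (y - unitVec i) - cutoff g y) ^ 2 +
    T / 2 * ∑ y ∈ cube d N, (cutoff g (y - unitVec 0) - cutoff g y) ^ 2 with hK'
  have hK'0 : 0 ≤ K' := by positivity
  have hK'K : K' ≤ K := by
    have h2 := mul_le_mul_of_nonneg_left hsq hlam.le
    have h3 := Finset.sum_le_sum fun i (_ : i ∈ Finset.univ) => hgrad i
    have h4 := mul_le_mul_of_nonneg_left (hgrad 0) (by positivity : 0 ≤ T / 2)
    linarith
  have h2 : 1 / 2 ≤ cutoff g (unitVec 0) := le_max_of_le_right (by linarith)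
  -- The test function `H = cutoff g` has `H(e_0) ≥ 1/2`.
  have h3 : 1 / 4 ≤ K' * J := by nlinarith
  have hJ0 : 0 < J := by
    by_contra h
    have := mul_nonpos_of_nonneg_of_nonpos hK'0 (not_lt.1 h)
    linarith
  have h4 : 1 / 4 ≤ K * J := h3.trans (mul_le_mul_of_nonneg_right hK'K hJ0.le)
  have hK0 : 0 < K := by
    by_contra h
    have := mul_nonpos_of_nonpos_of_nonneg (not_lt.1 h) hJ0.le
    linarith
  rw [div_le_div_iff₀ (by positivity) (by positivity)]
  have h5 : 0 < lam ^ 2 := by positivity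
  nlinarith

end Cutoff

/-! ### The lower bounds in one and two dimensions -/

section Dimensions

lemma isDriftLaw_jumpLaw1 : IsDriftLaw jumpLaw1 := by
  intro F
  rw [tsum_eq_single (unitVec 0)]
  · rw [show (Finset.univ.erase (0 : Fin 1)) = ∅ by decide]
    simp [jumpLaw1]
  · intro z hz
    simp [jumpLaw1, hz]

lemma isDriftLaw_jumpLaw2 : IsDriftLaw jumpLaw2 := by
  intro F
  have h01 : (unitVec 0 : Site 2) ≠ unitVec 1 := fun h => by
    have := congrFun h 0
    simp [unitVec] at this
  have h02 : (unitVec 0 : Site 2) ≠ -unitVec 1 := fun h => by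
    have := congrFun h 0
    simp [unitVec] at this
  have h12 : (unitVec 1 : Site 2) ≠ -unitVec 1 := unitVec_ne_neg 1
  rw [tsum_eq_sum (s := {unitVec 0, unitVec 1, -unitVec 1})]
  · rw [Finset.sum_insert (by simp [h01, h02]), Finset.sum_pair h12,
      show (Finset.univ.erase (0 : Fin 2)) = {1} by decide, Finset.sum_singleton]
    simp [jumpLaw2, h01.symm, h02.symm]
    ring
  · intro z hz
    simp only [Finset.mem_insert, Finset.mem_singleton, not_or] at hz
    simp [jumpLaw2, hz.1, hz.2.1, hz.2.2]

/-- In one dimension the tent of width `N = μ³`, `μ = λ^{-1/4}`, gives the lower bound. The trace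
inequality holds with `T` of the order of the diffusive length `R = λ^{-1/2} = μ²`, and the costs are
`λ N` for the norm and `T / N` for the asymmetric part; both are of order `1 / μ`. -/
theorem le_laplace_one {Ω : Type*} [MeasurableSpace Ω] {P : Measure Ω} [IsProbabilityMeasure P]
    {𝓕 : Filtration ℝ≥0 ‹MeasurableSpace Ω›} {X : ℝ≥0 → Ω → Config 1}
    (hX : IsEquilibriumExclusion jumpLaw1 halfDensity P 𝓕 X) {lam μ : ℝ} (hμ : 1 < μ)
    (hlam : lam = (μ ^ 4)⁻¹) :
    1 / (16 * (156 / μ) * lam ^ 2) ≤ ∫ t in Set.Ioi (0 : ℝ), Real.exp (-lam * t) *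
      (t * diffusionCoeff halfDensity P X 0 0 t.toNNReal) := by
  have hμ0 : 0 < μ := by linarith
  have hlam0 : 0 < lam := by rw [hlam]; positivity
  have hμ2 : 1 < μ ^ 2 := one_lt_pow₀ hμ two_ne_zero
  have hμ3 : 1 < μ ^ 3 := one_lt_pow₀ hμ three_ne_zero
  set R : ℕ := ⌈μ ^ 2⌉₊ with hR
  have hR1 : μ ^ 2 ≤ R := Nat.le_ceil _
  have hR2 : (R : ℝ) ≤ 2 * μ ^ 2 := by
    have := Nat.ceil_lt_add_one (a := μ ^ 2) (by positivity)
    linarith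
  set N : ℕ := ⌈μ ^ 3⌉₊ with hN
  have hN1 : μ ^ 3 ≤ N := Nat.le_ceil _
  have hN2 : (N : ℝ) ≤ 2 * μ ^ 3 := by
    have := Nat.ceil_lt_add_one (a := μ ^ 3) (by positivity)
    linarith
  have hN3 : (2 : ℝ) ≤ N := by
    have h1 : 1 < N := by
      have : (1 : ℝ) < N := by linarith
      exact_mod_cast this
    exact_mod_cast h1
  have hN0 : (0 : ℝ) < N := by linarith
  have hgrad : ∀ y : Site 1, (|(((y - unitVec 0 : Site 1) 0 : ℤ) : ℝ)| / N -
      |((y 0 : ℤ) : ℝ)| / N) ^ 2 ≤ 1 / (N : ℝ) ^ 2 := fun y => by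
    rw [← sub_div, div_pow]
    refine div_le_div_of_nonneg_right ?_ (by positivity)
    have h1 := abs_abs_sub_abs_le (((y - unitVec 0 : Site 1) 0 : ℤ) : ℝ) ((y 0 : ℤ) : ℝ)
    have h2 : (((y - unitVec 0 : Site 1) 0 : ℤ) : ℝ) - ((y 0 : ℤ) : ℝ) = -1 := by simp [unitVec]
    rw [h2, abs_neg, abs_one] at h1
    rw [← sq_abs]
    exact pow_le_one₀ (abs_nonneg _) h1
  refine le_laplace_of_cutoff isDriftLaw_jumpLaw1 hX hlam0
    (g := fun y => |(y 0 : ℝ)| / N) (N := N) (T := 2 * (48 * μ ^ 2))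
    (S := fun _ => (2 * (N : ℝ) + 1) * (1 / (N : ℝ) ^ 2)) (fun y => by positivity) (fun y => by simp) ?_
    (fun y j hj => ?_) (by positivity) (fun f Z h0 he => ?_) (fun i => ?_) ?_
  · have : |((unitVec 0 : Site 1) 0 : ℝ)| = 1 := by simp [unitVec]
    rw [this]
    exact one_div_le_one_div_of_le (by norm_num) hN3
  · rw [Subsingleton.elim j 0] at hj
    rw [one_le_div hN0]
    exact_mod_cast hj
  · refine (isFlowBound_one R).trace (fun x hx => ?_) (by positivity) (by positivity) ?_ ?_ f Z h0 he
    · obtain ⟨n, -, rfl⟩ := Finset.mem_image.1 hx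
      exact Int.natCast_nonneg n
    · have h1 : (2 : ℝ) / (R + 1) ≤ 2 / μ ^ 2 := by gcongr; linarith
      have h2 : 48 * μ ^ 2 * lam = 48 / μ ^ 2 := by rw [hlam]; field_simp
      rw [h2]
      calc 9 * (2 / ((R : ℝ) + 1)) ≤ 9 * (2 / μ ^ 2) := by gcongr
        _ = 18 / μ ^ 2 := by ring
        _ ≤ 48 / μ ^ 2 := by gcongr; norm_num
    · linarith
  · rw [Subsingleton.elim i 0]
    refine (Finset.sum_le_sum fun y _ => hgrad y).trans (le_of_eq ?_)
    rw [Finset.sum_const, card_cube, nsmul_eq_mul]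
    push_cast
    ring
  · have h1 : (2 * (N : ℝ) + 1) * (1 / (N : ℝ) ^ 2) ≤ 3 / μ ^ 3 := by
      calc (2 * (N : ℝ) + 1) * (1 / (N : ℝ) ^ 2) ≤ (3 * (N : ℝ)) * (1 / (N : ℝ) ^ 2) := by gcongr; linarith
        _ = 3 / (N : ℝ) := by field_simp
        _ ≤ 3 / μ ^ 3 := by gcongr
    have h2 : lam * (2 * (N : ℝ) + 1) ≤ 6 / μ := by
      calc lam * (2 * (N : ℝ) + 1) ≤ lam * (3 * (2 * μ ^ 3)) := by gcongr; linarith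
        _ = 6 / μ := by rw [hlam]; field_simp; norm_num
    have h3 : 3 / μ ^ 3 ≤ 3 / μ := by
      gcongr
      exact le_self_pow₀ hμ.le three_ne_zero
    have h4 : 2 * (48 * μ ^ 2) / 2 * (3 / μ ^ 3) = 144 / μ := by field_simp; norm_num
    have h5 : 2 * (48 * μ ^ 2) / 2 * ((2 * (N : ℝ) + 1) * (1 / (N : ℝ) ^ 2)) ≤ 144 / μ := by
      rw [← h4]; gcongr
    simp only [Finset.univ_unique, Finset.sum_singleton, pow_one]
    have h6 : (156 : ℝ) / μ = 6 / μ + 3 / μ + 144 / μ + 3 / μ := by ring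
    have h7 : 0 ≤ 3 / μ := by positivity
    linarith

lemma sum_one_div_add_sq_le {a : ℝ} (ha : 1 ≤ a) (n : ℕ) :
    ∑ k ∈ Finset.range n, 1 / (a + k) ^ 2 ≤ 2 / a := by
  have h : ∑ k ∈ Finset.range n, 1 / (a + k) ^ 2 ≤ 2 / a - 2 / (a + n) := by
    induction n with
    | zero => simp
    | succ n ih =>
      rw [Finset.sum_range_succ]
      have h0 : (0 : ℝ) ≤ n := n.cast_nonneg
      have h1 : 1 / (a + n) ^ 2 ≤ 2 / (a + n) - 2 / (a + (n + 1 : ℕ)) := by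
        have h2 : 0 < a + n := by linarith
        have h3 : 0 < a + (n + 1 : ℕ) := by positivity
        rw [div_sub_div _ _ h2.ne' h3.ne', div_le_div_iff₀ (by positivity) (by positivity)]
        push_cast
        nlinarith [mul_pos h2 h2]
      linarith
  have h1 : 0 ≤ 2 / (a + n) := by positivity
  linarith

lemma sum_Icc_natAbs_le {f : ℕ → ℝ} (hf : ∀ n, 0 ≤ f n) (N : ℕ) :
    ∑ k ∈ Finset.Icc (-(N : ℤ)) N, f k.natAbs ≤ 2 * ∑ n ∈ Finset.range (N + 1), f n := by
  have hsub : Finset.Icc (-(N : ℤ)) N ⊆ (Finset.range (N + 1)).image (fun n : ℕ => (n : ℤ)) ∪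
      (Finset.range (N + 1)).image (fun n : ℕ => -(n : ℤ)) := fun k hk => by
    rw [Finset.mem_Icc] at hk
    simp only [Finset.mem_union, Finset.mem_image, Finset.mem_range]
    rcases le_total 0 k with h | h
    · exact Or.inl ⟨k.natAbs, by omega, by omega⟩
    · exact Or.inr ⟨k.natAbs, by omega, by omega⟩
  refine (Finset.sum_le_sum_of_subset_of_nonneg hsub fun k _ _ => hf _).trans ?_
  have h1 := Finset.sum_union_inter (s₁ := (Finset.range (N + 1)).image (fun n : ℕ => (n : ℤ)))
    (s₂ := (Finset.range (N + 1)).image (fun n : ℕ => -(n : ℤ))) (f := fun k => f k.natAbs)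
  have h2 : 0 ≤ ∑ k ∈ (Finset.range (N + 1)).image (fun n : ℕ => (n : ℤ)) ∩
      (Finset.range (N + 1)).image (fun n : ℕ => -(n : ℤ)), f k.natAbs :=
    Finset.sum_nonneg fun k _ => hf _
  rw [Finset.sum_image (fun a _ b _ h => by simpa using h),
    Finset.sum_image (fun a _ b _ h => by simpa using h)] at h1
  simp only [Int.natAbs_neg, Int.natAbs_natCast] at h1
  linarith

lemma sum_cube_two (F : ℤ → ℤ → ℝ) (N : ℕ) :
    ∑ y ∈ cube 2 N, F (y 0) (y 1) =
      ∑ b ∈ Finset.Icc (-(N : ℤ)) N, ∑ a ∈ Finset.Icc (-(N : ℤ)) N, F a b := by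
  rw [Finset.sum_comm, ← Finset.sum_product']
  refine Finset.sum_bij' (fun y _ => (y 0, y 1)) (fun q _ => ![q.1, q.2]) ?_ ?_ ?_ ?_ ?_
  · intro y hy
    simp only [cube, Fintype.mem_piFinset] at hy
    exact Finset.mem_product.2 ⟨hy 0, hy 1⟩
  · intro q hq
    rw [Finset.mem_product] at hq
    simp only [cube, Fintype.mem_piFinset, Fin.forall_fin_two]
    exact hq
  · intro y _
    ext j
    fin_cases j <;> rfl
  · intro q _
    rfl
  · intro y _
    rfl

/-- The radial function of the plane which is used for the logarithmic cut-off; its level sets are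
stretched by the factor `s` along the drift. -/
def radius (s : ℝ) (y : Site 2) : ℝ := |(y 1 : ℝ)| + |(y 0 : ℝ)| / s

lemma radius_nonneg {s : ℝ} (hs : 0 ≤ s) (y : Site 2) : 0 ≤ radius s y := by
  unfold radius
  positivity

/-- The lattice version of `∫ r⁻² r dr` over a disc stretched by the factor `s`. -/
lemma sum_one_div_radius_sq_le {s : ℝ} (hs : 1 ≤ s) (N : ℕ) :
    ∑ y ∈ cube 2 N, 1 / (1 + radius s y) ^ 2 ≤ 8 * s * (1 + Real.log (N + 1)) := by
  have hs0 : 0 < s := by linarith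
  have hcol : ∀ b : ℤ, ∑ a ∈ Finset.Icc (-(N : ℤ)) N, 1 / (1 + (|(b : ℝ)| + |(a : ℝ)| / s)) ^ 2 ≤
      4 * s * (1 / ((b.natAbs : ℝ) + 1)) := fun b => by
    set c : ℝ := s * ((b.natAbs : ℝ) + 1) with hc
    have hc1 : 1 ≤ c := by
      have : (0 : ℝ) ≤ b.natAbs := Nat.cast_nonneg _
      nlinarith
    have h1 : ∀ a : ℤ, 1 / (1 + (|(b : ℝ)| + |(a : ℝ)| / s)) ^ 2 =
        s ^ 2 * (1 / (c + (a.natAbs : ℝ)) ^ 2) := fun a => by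
      have h2 : 1 + (|(b : ℝ)| + |(a : ℝ)| / s) = (c + (a.natAbs : ℝ)) / s := by
        rw [hc, Nat.cast_natAbs, Nat.cast_natAbs, Int.cast_abs, Int.cast_abs]
        field_simp
        ring
      rw [h2, div_pow, one_div_div]
      ring
    rw [Finset.sum_congr rfl fun a _ => h1 a, ← Finset.mul_sum]
    have h3 := (sum_Icc_natAbs_le (f := fun n : ℕ => 1 / (c + (n : ℝ)) ^ 2)
      (fun n => by positivity) N).trans
        (mul_le_mul_of_nonneg_left (sum_one_div_add_sq_le hc1 (N + 1)) zero_le_two)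
    refine (mul_le_mul_of_nonneg_left h3 (sq_nonneg s)).trans (le_of_eq ?_)
    rw [hc]
    field_simp
    norm_num
  have hharm : ∑ n ∈ Finset.range (N + 1), 1 / ((n : ℝ) + 1) ≤ 1 + Real.log (N + 1) := by
    have h1 := harmonic_le_one_add_log (N + 1)
    simp only [harmonic] at h1
    push_cast at h1
    simpa only [one_div] using h1
  calc ∑ y ∈ cube 2 N, 1 / (1 + radius s y) ^ 2
      = ∑ b ∈ Finset.Icc (-(N : ℤ)) N, ∑ a ∈ Finset.Icc (-(N : ℤ)) N,
          1 / (1 + (|(b : ℝ)| + |(a : ℝ)| / s)) ^ 2 :=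
        sum_cube_two (fun a b => 1 / (1 + (|(b : ℝ)| + |(a : ℝ)| / s)) ^ 2) N
    _ ≤ ∑ b ∈ Finset.Icc (-(N : ℤ)) N, 4 * s * (1 / ((b.natAbs : ℝ) + 1)) :=
        Finset.sum_le_sum fun b _ => hcol b
    _ = 4 * s * ∑ b ∈ Finset.Icc (-(N : ℤ)) N, 1 / ((b.natAbs : ℝ) + 1) := by
        rw [Finset.mul_sum]
    _ ≤ 4 * s * (2 * (1 + Real.log (N + 1))) := by
        gcongr
        exact (sum_Icc_natAbs_le (f := fun n : ℕ => 1 / ((n : ℝ) + 1))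
          (fun n => by positivity) N).trans (by linarith)
    _ = 8 * s * (1 + Real.log (N + 1)) := by ring

lemma sq_log_sub_log_le {x y δ : ℝ} (hx : 1 ≤ x) (hy : 1 ≤ y) (hδ : δ ≤ 1) (h : |x - y| ≤ δ) :
    (Real.log x - Real.log y) ^ 2 ≤ 4 * δ ^ 2 * (1 / y ^ 2) := by
  have hx0 : 0 < x := by linarith
  have hy0 : 0 < y := by linarith
  obtain ⟨h1, h2⟩ := abs_le.1 h
  have hδ0 : 0 ≤ δ := (abs_nonneg _).trans h
  have h3 : Real.log x - Real.log y ≤ 2 * δ / y := by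
    rw [← Real.log_div hx0.ne' hy0.ne']
    refine (Real.log_le_sub_one_of_pos (by positivity)).trans ?_
    rw [div_sub_one hy0.ne']
    gcongr
    linarith
  have h4 : Real.log y - Real.log x ≤ 2 * δ / y := by
    rw [← Real.log_div hy0.ne' hx0.ne']
    refine (Real.log_le_sub_one_of_pos (by positivity)).trans ?_
    rw [div_sub_one hx0.ne', div_le_div_iff₀ hx0 hy0]
    nlinarith
  have h5 : 4 * δ ^ 2 * (1 / y ^ 2) = (2 * δ / y) ^ 2 := by ring
  rw [h5]
  exact sq_le_sq' (by linarith) h3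

lemma abs_radius_sub_zero_le {s : ℝ} (hs : 0 < s) (y : Site 2) :
    |radius s (y - unitVec 0) - radius s y| ≤ 1 / s := by
  have h1 : (y - unitVec 0 : Site 2) 1 = y 1 := by simp [unitVec]
  have h2 : (((y - unitVec 0 : Site 2) 0 : ℤ) : ℝ) = (y 0 : ℝ) - 1 := by simp [unitVec]
  rw [radius, radius, h1, h2, add_sub_add_left_eq_sub, ← sub_div, abs_div, abs_of_pos hs]
  gcongr
  refine (abs_abs_sub_abs_le _ _).trans ?_
  simp

lemma abs_radius_sub_one_le (s : ℝ) (y : Site 2) :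
    |radius s (y - unitVec 1) - radius s y| ≤ 1 := by
  have h1 : (y - unitVec 1 : Site 2) 0 = y 0 := by simp [unitVec]
  have h2 : (((y - unitVec 1 : Site 2) 1 : ℤ) : ℝ) = (y 1 : ℝ) - 1 := by simp [unitVec]
  rw [radius, radius, h1, h2, add_sub_add_right_eq_sub]
  refine (abs_abs_sub_abs_le _ _).trans ?_
  simp

/-- In two dimensions a logarithmic cut-off at the scale `λ^{-1/8}`, with the axis along the drift
stretched by the factor `s = |log λ|^{1/2}`, gives the lower bound. The Dirichlet form of the cut-off
is `1 / (s Λ)` along the drift and `s / Λ` across, up to constants, where `Λ = s² / 8`; the trace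
inequality at the scale `R = λ^{-1/2}` costs a factor `T` of order `Λ` for the former. The stretching
makes both costs of order `1 / s`. -/
theorem le_laplace_two {Ω : Type*} [MeasurableSpace Ω] {P : Measure Ω} [IsProbabilityMeasure P]
    {𝓕 : Filtration ℝ≥0 ‹MeasurableSpace Ω›} {X : ℝ≥0 → Ω → Config 2}
    (hX : IsEquilibriumExclusion jumpLaw2 halfDensity P 𝓕 X) {lam s : ℝ} (hs : 8 ≤ s)
    (hlam : lam = Real.exp (-s ^ 2)) :
    1 / (16 * (20484 / s) * lam ^ 2) ≤ ∫ t in Set.Ioi (0 : ℝ), Real.exp (-lam * t) *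
      (t * diffusionCoeff halfDensity P X 0 0 t.toNNReal) := by
  have hs0 : 0 < s := by linarith
  have hlam0 : 0 < lam := by rw [hlam]; positivity
  obtain ⟨Λ, hΛ⟩ : ∃ Λ : ℝ, Λ = s ^ 2 / 8 := ⟨_, rfl⟩
  have hΛs : s ≤ Λ := by rw [hΛ]; nlinarith
  have hΛ8 : 8 ≤ Λ := hs.trans hΛs
  have hΛ0 : 0 < Λ := by linarith
  -- All scales are powers of `E = exp Λ = λ^{-1/8}`.
  obtain ⟨E, hE⟩ : ∃ E : ℝ, E = Real.exp Λ := ⟨_, rfl⟩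
  have hpow : ∀ n : ℕ, E ^ n = Real.exp (n * Λ) := fun n => by rw [hE, Real.exp_nat_mul]
  have hΛE : Λ + 1 ≤ E := hE ▸ Real.add_one_le_exp Λ
  have hE0 : 0 < E := by linarith
  have hE9 : 9 ≤ E := by linarith
  have hlamE : lam = (E ^ 8)⁻¹ := by
    rw [hpow, hlam, ← Real.exp_neg, hΛ]
    congr 1
    push_cast
    ring
  obtain ⟨N, hNdef⟩ : ∃ N : ℕ, N = ⌈s * E⌉₊ := ⟨_, rfl⟩
  have hN1 : s * E ≤ N := hNdef ▸ Nat.le_ceil _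
  have hN2 : (N : ℝ) + 1 ≤ E ^ 3 := by
    have h1 : (N : ℝ) < s * E + 1 := hNdef ▸ Nat.ceil_lt_add_one (by positivity)
    nlinarith [mul_pos hE0 hE0]
  have hlog : 1 + Real.log (N + 1) ≤ 4 * Λ := by
    have h1 : Real.log (N + 1) ≤ 3 * Λ := by
      rw [Real.log_le_iff_le_exp (by positivity)]
      exact hN2.trans (hpow 3).le
    linarith
  obtain ⟨R, hRdef⟩ : ∃ R : ℕ, R = ⌈E ^ 4⌉₊ := ⟨_, rfl⟩
  have hR1 : E ^ 4 ≤ R := hRdef ▸ Nat.le_ceil _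
  have hR0 : (0 : ℝ) < R := lt_of_lt_of_le (by positivity) hR1
  have hR2 : (R : ℝ) ≤ E ^ 5 := by
    have h1 : (R : ℝ) < E ^ 4 + 1 := hRdef ▸ Nat.ceil_lt_add_one (by positivity)
    have h2 : 1 ≤ E ^ 4 := one_le_pow₀ (by linarith)
    nlinarith
  have hlogR : Real.log R ≤ 5 * Λ := by
    rw [Real.log_le_iff_le_exp hR0]
    exact hR2.trans (hpow 5).le
  have hgrad : ∀ (i : Fin 2) (δ : ℝ), δ ≤ 1 →
      (∀ y : Site 2, |radius s (y - unitVec i) - radius s y| ≤ δ) →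
      ∑ y ∈ cube 2 N, (Real.log (1 + radius s (y - unitVec i)) / Λ -
        Real.log (1 + radius s y) / Λ) ^ 2 ≤ 1024 * δ ^ 2 / s := fun i δ hδ h => by
    have h1 : ∀ y : Site 2, (Real.log (1 + radius s (y - unitVec i)) / Λ -
        Real.log (1 + radius s y) / Λ) ^ 2 ≤
        4 * δ ^ 2 / Λ ^ 2 * (1 / (1 + radius s y) ^ 2) := fun y => by
      rw [← sub_div, div_pow, div_mul_eq_mul_div]
      refine div_le_div_of_nonneg_right (sq_log_sub_log_le ?_ ?_ hδ ?_) (by positivity)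
      · linarith [radius_nonneg hs0.le (y - unitVec i)]
      · linarith [radius_nonneg hs0.le y]
      · rw [add_sub_add_left_eq_sub]
        exact h y
    refine (Finset.sum_le_sum fun y _ => h1 y).trans ?_
    rw [← Finset.mul_sum]
    calc 4 * δ ^ 2 / Λ ^ 2 * ∑ y ∈ cube 2 N, 1 / (1 + radius s y) ^ 2
        ≤ 4 * δ ^ 2 / Λ ^ 2 * (8 * s * (4 * Λ)) := by
          gcongr
          exact (sum_one_div_radius_sq_le (by linarith) N).trans (by gcongr)
      _ = 1024 * δ ^ 2 / s := by
          rw [hΛ]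
          field_simp
          ring
  refine le_laplace_of_cutoff isDriftLaw_jumpLaw2 hX hlam0
    (g := fun y => Real.log (1 + radius s y) / Λ) (N := N) (T := 36 * s ^ 2)
    (S := ![1024 * (1 / s) ^ 2 / s, 1024 * 1 ^ 2 / s])
    (fun y => div_nonneg (Real.log_nonneg (by linarith [radius_nonneg hs0.le y])) hΛ0.le)
    (fun y => by simp [radius]) ?_ (fun y j hj => ?_) (by positivity) (fun f Z h0 he => ?_)
    (fun i => ?_) ?_
  · have h1 : radius s (unitVec 0) = 1 / s := by simp [radius, unitVec]
    have h2 : 1 / s ≤ 1 := by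
      rw [div_le_one hs0]
      linarith
    rw [h1, div_le_iff₀ hΛ0]
    linarith [Real.log_le_sub_one_of_pos (show 0 < 1 + 1 / s by positivity)]
  · rw [one_le_div hΛ0, Real.le_log_iff_exp_le (by linarith [radius_nonneg hs0.le y]), ← hE]
    have h1 : s * E ≤ |(y j : ℝ)| := hN1.trans (by exact_mod_cast hj)
    have h2 : 0 ≤ |(y 0 : ℝ)| / s := by positivity
    have h3 : 0 ≤ |(y 1 : ℝ)| := abs_nonneg _
    rw [radius]
    have hj2 : j = 0 ∨ j = 1 := by omega
    rcases hj2 with rfl | rfl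
    · have : E ≤ |(y 0 : ℝ)| / s := by
        rw [le_div_iff₀ hs0]
        linarith
      linarith
    · nlinarith
  · have htr := (isFlowBound_two R).trace (lam := lam) (T := 18 * s ^ 2) (fun x hx => ?_)
      (by positivity) (by positivity) ?_ ?_ f Z h0 he
    · linarith
    · obtain ⟨q, -, rfl⟩ := Finset.mem_image.1 hx
      exact Int.natCast_nonneg _
    · have h1 : (4 : ℝ) / (R + 1) ^ 2 ≤ 4 / (E ^ 4) ^ 2 := by
        gcongr
        linarith
      have h2 : (4 : ℝ) / (E ^ 4) ^ 2 = 4 * lam := by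
        rw [hlamE]
        field_simp
      nlinarith
    · nlinarith
  · fin_cases i
    · refine hgrad 0 (1 / s) ?_ (abs_radius_sub_zero_le hs0)
      rw [div_le_one hs0]
      linarith
    · exact hgrad 1 1 le_rfl (abs_radius_sub_one_le s)
  · have h1 : lam * (2 * (N : ℝ) + 1) ^ 2 ≤ 4 / s := by
      calc lam * (2 * (N : ℝ) + 1) ^ 2 ≤ lam * (2 * E ^ 3) ^ 2 := by
            gcongr
            linarith
        _ = 4 / E ^ 2 := by
            rw [hlamE]
            field_simp
            norm_num
        _ ≤ 4 / s := by
            gcongr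
            nlinarith
    have h2 : 1024 * (1 / s) ^ 2 / s ≤ 1024 / s := by
      gcongr
      have : (1 / s) ^ 2 ≤ 1 := by
        refine pow_le_one₀ (by positivity) ?_
        rw [div_le_one hs0]
        linarith
      linarith
    have h3 : 36 * s ^ 2 / 2 * (1024 * (1 / s) ^ 2 / s) = 18432 / s := by
      field_simp
      norm_num
    have h4 : 20484 / s = 4 / s + (1024 / s + 1024 / s) + 18432 / s := by ring
    simp only [Fin.sum_univ_two, Matrix.cons_val_zero, Matrix.cons_val_one, one_pow, mul_one]
    rw [h3, h4]
    linarith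

end Dimensions

end Exclusion

end

theorem theorem1p1 :
    ∃ C : ℝ, 0 < C ∧ ∃ lam₀ : ℝ, 0 < lam₀ ∧
      (∀ (Ω : Type*) [MeasurableSpace Ω] (P : Measure Ω) [IsProbabilityMeasure P]
        (𝓕 : Filtration ℝ≥0 ‹MeasurableSpace Ω›) (X : ℝ≥0 → Ω → Config 1),
        IsEquilibriumExclusion jumpLaw1 halfDensity P 𝓕 X →
        (∀ t : ℝ≥0, Summable fun x : Site 1 => (x 0 : ℝ) * (x 0 : ℝ) * corr P X x t) ∧
        ∀ lam : ℝ, 0 < lam → lam < lam₀ →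
          IntegrableOn (fun t : ℝ => Real.exp (-lam * t) *
            (t * diffusionCoeff halfDensity P X 0 0 t.toNNReal)) (Set.Ioi 0) ∧
          C * lam ^ (-2 - 1 / 4 : ℝ) ≤
            ∫ t in Set.Ioi (0 : ℝ), Real.exp (-lam * t) *
              (t * diffusionCoeff halfDensity P X 0 0 t.toNNReal)) ∧
      (∀ (Ω : Type*) [MeasurableSpace Ω] (P : Measure Ω) [IsProbabilityMeasure P]
        (𝓕 : Filtration ℝ≥0 ‹MeasurableSpace Ω›) (X : ℝ≥0 → Ω → Config 2),
        IsEquilibriumExclusion jumpLaw2 halfDensity P 𝓕 X →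
        (∀ t : ℝ≥0, Summable fun x : Site 2 => (x 0 : ℝ) * (x 0 : ℝ) * corr P X x t) ∧
        ∀ lam : ℝ, 0 < lam → lam < lam₀ →
          IntegrableOn (fun t : ℝ => Real.exp (-lam * t) *
            (t * diffusionCoeff halfDensity P X 0 0 t.toNNReal)) (Set.Ioi 0) ∧
          C * (lam ^ (-2 : ℝ) * |Real.log lam| ^ (1 / 2 : ℝ)) ≤
            ∫ t in Set.Ioi (0 : ℝ), Real.exp (-lam * t) *
              (t * diffusionCoeff halfDensity P X 0 0 t.toNNReal)) := by
  -- `327744 = 16 * 20484` is the constant in two dimensions, the one in one dimension is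
  -- `2496 = 16 * 156`. The bound `exp (-64)` makes `|log λ|^{1/2}` at least `8`.
  refine ⟨1 / 327744, by norm_num, Real.exp (-64), Real.exp_pos _,
    fun Ω _ P _ 𝓕 X hX => ?_, fun Ω _ P _ 𝓕 X hX => ?_⟩
  · obtain ⟨h1, h2⟩ := Exclusion.summable_and_integrableOn Exclusion.isDriftLaw_jumpLaw1 hX
    refine ⟨h1, fun lam hlam hlam1 => ⟨h2 lam hlam, ?_⟩⟩
    have hlt : lam < 1 := hlam1.trans (by simp)
    obtain ⟨μ, hμ⟩ : ∃ μ : ℝ, μ = lam ^ (-(1 / 4) : ℝ) := ⟨_, rfl⟩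
    have hμ1 : 1 < μ := hμ ▸ Real.one_lt_rpow_of_pos_of_lt_one_of_neg hlam hlt (by norm_num)
    have hμ4 : lam = (μ ^ 4)⁻¹ := by
      rw [hμ, ← Real.rpow_mul_natCast hlam.le, show (-(1 / 4) : ℝ) * (4 : ℕ) = -1 by norm_num,
        Real.rpow_neg_one, inv_inv]
    refine le_trans ?_ (Exclusion.le_laplace_one hX hμ1 hμ4)
    rw [show (-2 - 1 / 4 : ℝ) = -2 + -(1 / 4) by ring, Real.rpow_add hlam, ← hμ,
      Real.rpow_neg hlam.le, Real.rpow_two]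
    have hμ0 : 0 < μ := by linarith
    rw [show 1 / (16 * (156 / μ) * lam ^ 2) = 1 / 2496 * ((lam ^ 2)⁻¹ * μ) by field_simp; norm_num]
    gcongr
    norm_num
  · obtain ⟨h1, h2⟩ := Exclusion.summable_and_integrableOn Exclusion.isDriftLaw_jumpLaw2 hX
    refine ⟨h1, fun lam hlam hlam1 => ⟨h2 lam hlam, ?_⟩⟩
    have hlog : Real.log lam < -64 := (Real.log_lt_iff_lt_exp hlam).2 hlam1
    have hs : 8 ≤ √|Real.log lam| := by
      rw [abs_of_neg (by linarith)]
      exact Real.le_sqrt_of_sq_le (by linarith)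
    have hlam2 : lam = Real.exp (-√|Real.log lam| ^ 2) := by
      rw [Real.sq_sqrt (abs_nonneg _), abs_of_neg (by linarith), neg_neg, Real.exp_log hlam]
    refine le_trans (le_of_eq ?_) (Exclusion.le_laplace_two hX hs hlam2)
    have hs0 : 0 < √|Real.log lam| := by linarith
    rw [← Real.sqrt_eq_rpow, Real.rpow_neg hlam.le, Real.rpow_two]
    field_simp
    norm_num
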